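/- **Setting.** Let $\pi:E\to B$ be a smooth real vector bundle of finite rank over a connected (finite-dimensional, Hausdorff, second countable) manifold $B$ with symplectic form $\omega$; identify $B$ with the zero section. All tensors, forms and functions on $E$ are given near $B$ (germs at $B$). Let $\mathbb V=\ker d\pi$, let $\mathbb V^0\subset T^*E$ be its annihilator, and for a bivector field $\Pi$ let $\langle\beta,\Pi^\natural\alpha\rangle=\Pi(\alpha,\beta)$. A *coupling Poisson tensor* is a Poisson tensor $\Pi$ such that $\mathbb H=\Pi^\natural(\mathbb V^0)$ is a complement of $\mathbb V$. Its *geometric data* $(\Upsilon,\Gamma,F)$ are: the connection $\Gamma$ with horizontal bundle $\mathbb H$ and horizontal lift $\mathrm{hor}$; the vertical part $\Upsilon=\Pi_V$ of $\Pi$ in $TE=\mathbb H\oplus\mathbb V$; and the 2-form $F\in\Omega^2(B)\otimes C^\infty(E)$ with $\Pi(\beta_1,\beta_2)=(\pi^*F)(\Pi^\natural\beta_1,\Pi^\natural\beta_2)$ for $\beta_1,\beta_2\in\mathbb V^0$. Here $\Omega^k(B)\otimes\mathcal A$ denotes the $k$-forms on $B$ with values in a space $\mathcal A$ of functions on $E$.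 For $Q\in\Omega^1(B)\otimes C^\infty(E)$ and vector fields $u_0,u_1$ on $B$ put $$(\partial^\Gamma Q)(u_0,u_1)=L_{\mathrm{hor}(u_0)}Q(u_1)-L_{\mathrm{hor}(u_1)}Q(u_0)-Q([u_0,u_1]),$$ $$\{Q\wedge Q\}_\Upsilon(u_0,u_1)=\{Q(u_0),Q(u_1)\}_\Upsilon-\{Q(u_1),Q(u_0)\}_\Upsilon .$$ Let $\mathfrak{Diff}^0_B(E)$ be the group of germs at $B$ of diffeomorphisms $\phi$ between neighborhoods of $B$ that are time-1 maps of the flow of a smooth time-dependent vector field $Z_t$ ($t\in[0,1]$), defined near $B$, with $Z_t|_B=0$. **Theorem 3.4.** Let $\Pi,\tilde\Pi$ be coupling Poisson tensors near $B$, both having $(B,\omega)$ as a symplectic leaf, with geometric data $(\Upsilon,\Gamma,F)$ and $(\Upsilon,\tilde\Gamma,\tilde F)$, i.e. with the same vertical part $\Upsilon$. Suppose: 1. $\tilde\Pi\sim_Q\Pi$, that is, $Q$ is a 1-form on $B$ with values in smooth functions near $B$ vanishing on $B$, and $\mathrm{hor}^{\tilde\Gamma}(u)=\mathrm{hor}^{\Gamma}(u)+\Upsilon^\natural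 dQ(u)$ for every vector field $u$ on $B$; 2. $[C_{\tilde\Pi,\Pi}]=0$, that is, the Casimir 2-cocycle $C=\tilde F-F+\big(\partial^\Gamma Q+\tfrac12\{Q\wedge Q\}_\Upsilon\big)$ equals $\partial^\Gamma K$ near $B$ for some 1-form $K$ on $B$ with values in Casimir functions of $\Upsilon$ vanishing on $B$. Then $\Pi$ and $\tilde\Pi$ are isomorphic by a diffeomorphism $\phi\in\mathfrak{Diff}^0_B(E)$: $\phi^*\tilde\Pi=\Pi$ near $B$. More precisely, $Q$ can be chosen in 1 so that moreover $C=0$ near $B$; and for every such choice of $Q$ the following holds on a neighborhood of $B$ for all $t\in[0,1]$. The form $$F^t=F-\big(t\,\partial^\Gamma Q+\tfrac{t^2}{2}\{Q\wedge Q\}_\Upsilon\big)$$ is nondegenerate, and for $\phi$ one can take the time-1 flow of the time-dependent vector field $X_t$ that is horizontal for the connection $\Gamma^t$ with lift $\mathrm{hor}^t(u)=\mathrm{hor}^\Gamma(u)+t\,\Upsilon^\natural dQ(u)$ and is determined by $\mathbf i_{X_t}F^t=Q$. This $X_t$ vanishes on $B$. -/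

import Mathlib

open Set Bundle
open scoped Manifold ContDiff

namespace CouplingPoisson

noncomputable section

/-! ### Bivector fields and Poisson tensors on a manifold -/

section Bivector

variable {E : Type*} [NormedAddCommGroup E] [NormedSpace ℝ E]
  {H : Type*} [TopologicalSpace H] {I : ModelWithCorners ℝ E H}
  {M : Type*} [TopologicalSpace M] [ChartedSpace H M]

variable (I M) in
/-- A (pointwise) bivector field `Π` on `M`, recorded through its sharp map
`Π♯ : T*M → TM`, where `⟨β, Π♯ α⟩ = Π(α, β)`. -/
structure BivectorField where
  sharp : ∀ m : M, (TangentSpace I m →L[ℝ] ℝ) →L[ℝ] TangentSpace I m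
  skew : ∀ (m : M) (α β : TangentSpace I m →L[ℝ] ℝ), β (sharp m α) = -α (sharp m β)

/-- The value `Π(α, β)` at the point `m`. -/
def BivectorField.pair (P : BivectorField I M) (m : M)
    (α β : TangentSpace I m →L[ℝ] ℝ) : ℝ :=
  β (P.sharp m α)

/-- The Hamiltonian vector field `Π♯ df`. -/
def BivectorField.ham (P : BivectorField I M) (f : M → ℝ) (m : M) : TangentSpace I m :=
  P.sharp m (mvfderiv I f m)

/-- The bracket of functions `{f, g} = Π(df, dg)`. -/
def BivectorField.bracket (P : BivectorField I M) (f g : M → ℝ) (m : M) : ℝ :=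
  P.pair m (mvfderiv I f m) (mvfderiv I g m)

/-- `Π` is a smooth bivector field on the open set `N` (it is smooth on pairs of differentials of
locally defined smooth functions, i.e. its coefficients are smooth). -/
def BivectorField.SmoothOn (P : BivectorField I M) (N : Set M) : Prop :=
  ∀ U : Set M, IsOpen U → U ⊆ N → ∀ f g : M → ℝ,
    ContMDiffOn I 𝓘(ℝ, ℝ) ∞ f U → ContMDiffOn I 𝓘(ℝ, ℝ) ∞ g U →
      ContMDiffOn I 𝓘(ℝ, ℝ) ∞ (P.bracket f g) U

/-- `Π` is a Poisson tensor on the open set `N`: it is smooth and its bracket satisfies the Jacobi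
identity. -/
structure BivectorField.IsPoissonOn (P : BivectorField I M) (N : Set M) : Prop where
  smooth : P.SmoothOn N
  jacobi : ∀ U : Set M, IsOpen U → U ⊆ N → ∀ f g h : M → ℝ,
    ContMDiffOn I 𝓘(ℝ, ℝ) ∞ f U → ContMDiffOn I 𝓘(ℝ, ℝ) ∞ g U →
    ContMDiffOn I 𝓘(ℝ, ℝ) ∞ h U → ∀ m ∈ U,
      P.bracket f (P.bracket g h) m + P.bracket g (P.bracket h f) m
        + P.bracket h (P.bracket f g) m = 0

/-- `φ^* P' = P` on the set `W`, i.e. `dφ ∘ P♯ ∘ (dφ)^* = P'♯` along `φ`. -/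
def PullsBackOn (φ : M → M) (P' P : BivectorField I M) (W : Set M) : Prop :=
  ∀ m ∈ W, ∀ α : TangentSpace I (φ m) →L[ℝ] ℝ,
    mfderiv I I φ m (P.sharp m (α.comp (mfderiv I I φ m))) = P'.sharp (φ m) α

/-- `u` is a smooth vector field on the set `W`. -/
def SmoothVFOn (I : ModelWithCorners ℝ E H) [IsManifold I 1 M]
    (u : ∀ b : M, TangentSpace I b) (W : Set M) : Prop :=
  ContMDiffOn I I.tangent ∞ (fun b => (⟨b, u b⟩ : TangentBundle I M)) W

/-- `Z` is a smooth time-dependent vector field on `W`, with time running through `[0, 1]`. -/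
def SmoothTimeVFOn (I : ModelWithCorners ℝ E H) [IsManifold I 1 M]
    (Z : ℝ → ∀ m : M, TangentSpace I m) (W : Set M) : Prop :=
  ContMDiffOn (𝓘(ℝ, ℝ).prod I) I.tangent ∞
    (fun p : ℝ × M => (⟨p.2, Z p.1 p.2⟩ : TangentBundle I M)) (Icc (0 : ℝ) 1 ×ˢ W)

/-- A symplectic form on `M`: a smooth, skew, nondegenerate and closed `2`-form. -/
structure IsSymplecticForm (I : ModelWithCorners ℝ E H) [IsManifold I 1 M]
    (σ : ∀ b : M, TangentSpace I b →L[ℝ] TangentSpace I b →L[ℝ] ℝ) : Prop where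
  skew : ∀ b u v, σ b u v = -σ b v u
  nondegenerate : ∀ b u, (∀ v, σ b u v = 0) → u = 0
  smooth : ∀ W : Set M, IsOpen W → ∀ u v : ∀ b : M, TangentSpace I b,
    SmoothVFOn I u W → SmoothVFOn I v W →
      ContMDiffOn I 𝓘(ℝ, ℝ) ∞ (fun b => σ b (u b) (v b)) W
  closed : ∀ u v w : ∀ b : M, TangentSpace I b,
    SmoothVFOn I u univ → SmoothVFOn I v univ → SmoothVFOn I w univ → ∀ b : M,
      mvfderiv I (fun c => σ c (v c) (w c)) b (u b)
        + mvfderiv I (fun c => σ c (w c) (u c)) b (v b)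
        + mvfderiv I (fun c => σ c (u c) (v c)) b (w b)
        - σ b (VectorField.mlieBracket I u v b) (w b)
        - σ b (VectorField.mlieBracket I v w b) (u b)
        - σ b (VectorField.mlieBracket I w u b) (v b) = 0

end Bivector

/-! ### Coupling Poisson tensors on a vector bundle -/

section Coupling

variable {EB : Type*} [NormedAddCommGroup EB] [NormedSpace ℝ EB]
  {B : Type*} [TopologicalSpace B] [ChartedSpace EB B]
  {Fib : Type*} [NormedAddCommGroup Fib] [NormedSpace ℝ Fib]
  {V : B → Type*} [TopologicalSpace (TotalSpace Fib V)]
  [∀ b, AddCommGroup (V b)] [∀ b, Module ℝ (V b)] [∀ b, TopologicalSpace (V b)]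
  [FiberBundle Fib V]

variable (EB) in
/-- The tangent space at a point of the total space. -/
abbrev TE (m : TotalSpace Fib V) : Type _ :=
  TangentSpace (𝓘(ℝ, EB).prod 𝓘(ℝ, Fib)) m

variable (EB) in
/-- The tangent space of the base at the foot point of `m`. -/
abbrev TB (m : TotalSpace Fib V) : Type _ :=
  TangentSpace 𝓘(ℝ, EB) m.proj

variable (EB) in
/-- The differential `dπ` of the bundle projection. -/
def dproj (m : TotalSpace Fib V) : TE EB m →L[ℝ] TB EB m :=
  mfderiv (𝓘(ℝ, EB).prod 𝓘(ℝ, Fib)) 𝓘(ℝ, EB) (fun x : TotalSpace Fib V => x.proj) m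

variable (EB) in
/-- The vertical space `𝕍 = ker dπ`. -/
def vert (m : TotalSpace Fib V) : Submodule ℝ (TE EB m) :=
  LinearMap.ker (dproj EB m).toLinearMap

variable (EB) in
/-- The annihilator `𝕍⁰` of the vertical space. -/
def vertAnn (m : TotalSpace Fib V) : Submodule ℝ (TE EB m →L[ℝ] ℝ) where
  carrier := {α | ∀ v ∈ vert EB m, α v = 0}
  zero_mem' := by intro v _; rfl
  add_mem' := by
    intro α β hα hβ v hv
    rw [add_apply, hα v hv, hβ v hv, add_zero]
  smul_mem' := by
    intro c α hα v hv
    rw [smul_apply, hα v hv, smul_zero]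

variable (Fib V) in
/-- The base, identified with the image of the zero section. -/
def zeroSec : Set (TotalSpace Fib V) := range (zeroSection Fib V)

/-- The space `ℍ = Π♯(𝕍⁰)`. -/
def horSpace (P : BivectorField (𝓘(ℝ, EB).prod 𝓘(ℝ, Fib)) (TotalSpace Fib V))
    (m : TotalSpace Fib V) : Submodule ℝ (TE EB m) :=
  (vertAnn EB m).map (P.sharp m).toLinearMap

/-- A coupling Poisson tensor on `N`: a Poisson tensor that is horizontally nondegenerate, i.e.
`Π♯(𝕍⁰)` is a complement of `𝕍` at every point of `N`. -/
structure IsCouplingOn (P : BivectorField (𝓘(ℝ, EB).prod 𝓘(ℝ, Fib)) (TotalSpace Fib V))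
    (N : Set (TotalSpace Fib V)) : Prop where
  poisson : P.IsPoissonOn N
  nondegenerate : ∀ m ∈ N, IsCompl (horSpace P m) (vert EB m)

/-- `(B, σ)`, as the zero section, is a symplectic leaf of `Π`: along the zero section the
characteristic distribution of `Π` is the tangent space of the zero section, and the induced form
on the leaf is `σ`. (As `B` is connected and the zero section is closed in the total space, it is
then a whole leaf.) -/
structure IsSymplecticLeaf
    (P : BivectorField (𝓘(ℝ, EB).prod 𝓘(ℝ, Fib)) (TotalSpace Fib V))
    (σ : ∀ b : B, TangentSpace 𝓘(ℝ, EB) b →L[ℝ] TangentSpace 𝓘(ℝ, EB) b →L[ℝ] ℝ) : Prop where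
  range_eq : ∀ b : B,
    LinearMap.range (P.sharp (zeroSection Fib V b)).toLinearMap =
      LinearMap.range (mfderiv 𝓘(ℝ, EB) (𝓘(ℝ, EB).prod 𝓘(ℝ, Fib))
        (zeroSection Fib V) b).toLinearMap
  form_eq : ∀ (b : B) (α β : TE EB (zeroSection Fib V b) →L[ℝ] ℝ)
    (u v : TangentSpace 𝓘(ℝ, EB) b),
    mfderiv 𝓘(ℝ, EB) (𝓘(ℝ, EB).prod 𝓘(ℝ, Fib)) (zeroSection Fib V) b u =
      P.sharp (zeroSection Fib V b) α →
    mfderiv 𝓘(ℝ, EB) (𝓘(ℝ, EB).prod 𝓘(ℝ, Fib)) (zeroSection Fib V) b v =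
      P.sharp (zeroSection Fib V b) β →
    P.pair (zeroSection Fib V b) α β = σ b u v

variable (EB Fib V) in
/-- A horizontal lift at every point of the total space (a connection). -/
abbrev HorLift : Type _ := ∀ m : TotalSpace Fib V, TB EB m →L[ℝ] TE EB m

variable (EB Fib V) in
/-- `1`-forms on `B` with values in functions on the total space. -/
abbrev Form1 : Type _ := ∀ m : TotalSpace Fib V, TB EB m →L[ℝ] ℝ

variable (EB Fib V) in
/-- `2`-forms on `B` with values in functions on the total space. -/
abbrev Form2 : Type _ := ∀ m : TotalSpace Fib V, TB EB m →L[ℝ] TB EB m →L[ℝ] ℝ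

/-- `(Υ, Γ, F)` is the geometric data of `Π` on `N`; the connection `Γ` is given by its horizontal
lift `hor`, so the projection onto `𝕍` along `ℍ` is `id - hor ∘ dπ`. -/
structure IsGeometricDataOn
    (P Ups : BivectorField (𝓘(ℝ, EB).prod 𝓘(ℝ, Fib)) (TotalSpace Fib V))
    (hor : HorLift EB Fib V) (F : Form2 EB Fib V) (N : Set (TotalSpace Fib V)) : Prop where
  /-- `hor` lifts tangent vectors of the base. -/
  lift : ∀ m ∈ N, ∀ u : TB EB m, dproj EB m (hor m u) = u
  /-- the horizontal space is `ℍ = Π♯(𝕍⁰)`. -/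
  horizontal : ∀ m ∈ N, LinearMap.range (hor m).toLinearMap = horSpace P m
  /-- `Υ` is the vertical part of `Π`. -/
  vertical : ∀ m ∈ N, ∀ α β : TE EB m →L[ℝ] ℝ,
    Ups.pair m α β =
      P.pair m (α.comp (ContinuousLinearMap.id ℝ (TE EB m) - (hor m).comp (dproj EB m)))
        (β.comp (ContinuousLinearMap.id ℝ (TE EB m) - (hor m).comp (dproj EB m)))
  /-- `F` is the coupling form. -/
  form : ∀ m ∈ N, ∀ β₁ ∈ vertAnn EB m, ∀ β₂ ∈ vertAnn EB m,
    P.pair m β₁ β₂ = F m (dproj EB m (P.sharp m β₁)) (dproj EB m (P.sharp m β₂))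

/-- The function `Q(u)` on the total space, for a vector field `u` on `B`. -/
def Form1.eval (Q : Form1 EB Fib V) (u : ∀ b : B, TangentSpace 𝓘(ℝ, EB) b)
    (m : TotalSpace Fib V) : ℝ :=
  Q m (u m.proj)

/-- Smoothness of a `1`-form on `B` with values in functions on `N`. -/
def Form1.SmoothOn [IsManifold 𝓘(ℝ, EB) 1 B] (Q : Form1 EB Fib V)
    (N : Set (TotalSpace Fib V)) : Prop :=
  ∀ W : Set B, IsOpen W → ∀ u : ∀ b : B, TangentSpace 𝓘(ℝ, EB) b,
    SmoothVFOn 𝓘(ℝ, EB) u W →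
      ContMDiffOn (𝓘(ℝ, EB).prod 𝓘(ℝ, Fib)) 𝓘(ℝ, ℝ) ∞ (Q.eval u)
        (N ∩ {m | m.proj ∈ W})

/-- The values of the form are functions vanishing on the zero section. -/
def Form1.VanishesOnBase (Q : Form1 EB Fib V) : Prop :=
  ∀ m ∈ zeroSec Fib V, Q m = 0

/-- The covariant exterior derivative of a `1`-form,
`(∂Q)(u₀, u₁) = L_{hor u₀} Q(u₁) - L_{hor u₁} Q(u₀) - Q([u₀, u₁])`. -/
def covDeriv (hor : HorLift EB Fib V) (Q : Form1 EB Fib V)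
    (u₀ u₁ : ∀ b : B, TangentSpace 𝓘(ℝ, EB) b) (m : TotalSpace Fib V) : ℝ :=
  mvfderiv (𝓘(ℝ, EB).prod 𝓘(ℝ, Fib)) (Q.eval u₁) m (hor m (u₀ m.proj))
    - mvfderiv (𝓘(ℝ, EB).prod 𝓘(ℝ, Fib)) (Q.eval u₀) m (hor m (u₁ m.proj))
    - Q.eval (VectorField.mlieBracket 𝓘(ℝ, EB) u₀ u₁) m

/-- `{Q ∧ Θ}_Υ (u₀, u₁) = {Q(u₀), Θ(u₁)}_Υ - {Q(u₁), Θ(u₀)}_Υ` for `1`-forms. -/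
def wedgeBracket (Ups : BivectorField (𝓘(ℝ, EB).prod 𝓘(ℝ, Fib)) (TotalSpace Fib V))
    (Q Θ : Form1 EB Fib V)
    (u₀ u₁ : ∀ b : B, TangentSpace 𝓘(ℝ, EB) b) (m : TotalSpace Fib V) : ℝ :=
  Ups.bracket (Q.eval u₀) (Θ.eval u₁) m - Ups.bracket (Q.eval u₁) (Θ.eval u₀) m

/-- `Π' ∼_Q Π` on `N`, in terms of the horizontal lifts of `Π'` and `Π`: `Q` is a smooth `1`-form
with values in functions vanishing on the zero section, and
`hor'(u) = hor(u) + Υ♯ dQ(u)` for every vector field `u` on `B`. -/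
structure RelatedOn [IsManifold 𝓘(ℝ, EB) 1 B]
    (Ups : BivectorField (𝓘(ℝ, EB).prod 𝓘(ℝ, Fib)) (TotalSpace Fib V))
    (hor' hor : HorLift EB Fib V) (Q : Form1 EB Fib V) (N : Set (TotalSpace Fib V)) : Prop where
  smooth : Q.SmoothOn N
  vanishes : Q.VanishesOnBase
  hor_eq : ∀ u : ∀ b : B, TangentSpace 𝓘(ℝ, EB) b, SmoothVFOn 𝓘(ℝ, EB) u univ →
    ∀ m ∈ N, hor' m (u m.proj) = hor m (u m.proj) + Ups.ham (Q.eval u) m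

/-- The relative Casimir `2`-cocycle
`C = F' - F + (∂Q + ½ {Q ∧ Q}_Υ)`, evaluated on two vector fields on `B`. -/
def casimirCocycle
    (Ups : BivectorField (𝓘(ℝ, EB).prod 𝓘(ℝ, Fib)) (TotalSpace Fib V))
    (hor : HorLift EB Fib V) (F' F : Form2 EB Fib V) (Q : Form1 EB Fib V)
    (u₀ u₁ : ∀ b : B, TangentSpace 𝓘(ℝ, EB) b) (m : TotalSpace Fib V) : ℝ :=
  F' m (u₀ m.proj) (u₁ m.proj) - F m (u₀ m.proj) (u₁ m.proj)
    + (covDeriv hor Q u₀ u₁ m + (1 / 2 : ℝ) * wedgeBracket Ups Q Q u₀ u₁ m)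

/-- `K` is a smooth `1`-form on `B` whose values are Casimir functions of `Υ` on `N` that vanish on
the zero section. -/
structure IsCasimirForm1On [IsManifold 𝓘(ℝ, EB) 1 B]
    (Ups : BivectorField (𝓘(ℝ, EB).prod 𝓘(ℝ, Fib)) (TotalSpace Fib V))
    (K : Form1 EB Fib V) (N : Set (TotalSpace Fib V)) : Prop where
  smooth : K.SmoothOn N
  vanishes : K.VanishesOnBase
  casimir : ∀ u : ∀ b : B, TangentSpace 𝓘(ℝ, EB) b, SmoothVFOn 𝓘(ℝ, EB) u univ →
    ∀ m ∈ N, Ups.ham (K.eval u) m = 0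

/-- The class of the relative Casimir cocycle is zero: as germs at the zero section, `C = ∂K` for a
`1`-form `K` with values in Casimir functions vanishing on the zero section. -/
def CasimirClassZero [IsManifold 𝓘(ℝ, EB) 1 B]
    (Ups : BivectorField (𝓘(ℝ, EB).prod 𝓘(ℝ, Fib)) (TotalSpace Fib V))
    (hor : HorLift EB Fib V) (F' F : Form2 EB Fib V) (Q : Form1 EB Fib V)
    (N : Set (TotalSpace Fib V)) : Prop :=
  ∃ (N' : Set (TotalSpace Fib V)) (K : Form1 EB Fib V),
    IsOpen N' ∧ zeroSec Fib V ⊆ N' ∧ N' ⊆ N ∧ IsCasimirForm1On Ups K N' ∧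
    ∀ u₀ u₁ : ∀ b : B, TangentSpace 𝓘(ℝ, EB) b,
      SmoothVFOn 𝓘(ℝ, EB) u₀ univ → SmoothVFOn 𝓘(ℝ, EB) u₁ univ →
      ∀ m ∈ N', casimirCocycle Ups hor F' F Q u₀ u₁ m = covDeriv hor K u₀ u₁ m

/-- `Q` is adapted on `N`: `Π' ∼_Q Π` and the Casimir cocycle computed with `Q` is zero, that is,
`F' = F - (∂Q + ½ {Q ∧ Q}_Υ)`. -/
structure IsAdaptedOn [IsManifold 𝓘(ℝ, EB) 1 B]
    (Ups : BivectorField (𝓘(ℝ, EB).prod 𝓘(ℝ, Fib)) (TotalSpace Fib V))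
    (hor' hor : HorLift EB Fib V) (F' F : Form2 EB Fib V) (Q : Form1 EB Fib V)
    (N : Set (TotalSpace Fib V)) : Prop where
  related : RelatedOn Ups hor' hor Q N
  cocycle_eq_zero : ∀ u₀ u₁ : ∀ b : B, TangentSpace 𝓘(ℝ, EB) b,
    SmoothVFOn 𝓘(ℝ, EB) u₀ univ → SmoothVFOn 𝓘(ℝ, EB) u₁ univ →
    ∀ m ∈ N, casimirCocycle Ups hor F' F Q u₀ u₁ m = 0

/-- On `W` and for `t ∈ [0, 1]`: `horₜ = hor + t Υ♯ dQ`, `Fₜ = F - (t ∂Q + t²/2 {Q ∧ Q}_Υ)` is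
nondegenerate, and `Xₜ` is the horizontal vector field for `horₜ` with `i_{Xₜ} Fₜ = Q`. -/
structure IsHomotopyFieldOn [IsManifold 𝓘(ℝ, EB) 1 B]
    (Ups : BivectorField (𝓘(ℝ, EB).prod 𝓘(ℝ, Fib)) (TotalSpace Fib V))
    (hor : HorLift EB Fib V) (F : Form2 EB Fib V) (Q : Form1 EB Fib V)
    (hort : ℝ → HorLift EB Fib V) (Ft : ℝ → Form2 EB Fib V)
    (X : ℝ → ∀ m : TotalSpace Fib V, TE EB m) (W : Set (TotalSpace Fib V)) : Prop where
  hor_eq : ∀ t ∈ Icc (0 : ℝ) 1, ∀ u : ∀ b : B, TangentSpace 𝓘(ℝ, EB) b,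
    SmoothVFOn 𝓘(ℝ, EB) u univ → ∀ m ∈ W,
      hort t m (u m.proj) = hor m (u m.proj) + t • Ups.ham (Q.eval u) m
  form_eq : ∀ t ∈ Icc (0 : ℝ) 1, ∀ u₀ u₁ : ∀ b : B, TangentSpace 𝓘(ℝ, EB) b,
    SmoothVFOn 𝓘(ℝ, EB) u₀ univ → SmoothVFOn 𝓘(ℝ, EB) u₁ univ → ∀ m ∈ W,
      Ft t m (u₀ m.proj) (u₁ m.proj) = F m (u₀ m.proj) (u₁ m.proj)
        - (t * covDeriv hor Q u₀ u₁ m + t ^ 2 / 2 * wedgeBracket Ups Q Q u₀ u₁ m)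
  nondegenerate : ∀ t ∈ Icc (0 : ℝ) 1, ∀ m ∈ W, ∀ v : TB EB m,
    (∀ w : TB EB m, Ft t m v w = 0) → v = 0
  horizontal : ∀ t ∈ Icc (0 : ℝ) 1, ∀ m ∈ W, X t m ∈ LinearMap.range (hort t m).toLinearMap
  contraction : ∀ t ∈ Icc (0 : ℝ) 1, ∀ m ∈ W, ∀ w : TB EB m,
    Ft t m (dproj EB m (X t m)) w = Q m w

/-- `φ` is a diffeomorphism from one neighbourhood of the zero section onto another one. -/
structure IsDiffeoNearBase
    (φ : OpenPartialHomeomorph (TotalSpace Fib V) (TotalSpace Fib V)) : Prop where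
  source_nhd : zeroSec Fib V ⊆ φ.source
  target_nhd : zeroSec Fib V ⊆ φ.target
  smooth : ContMDiffOn (𝓘(ℝ, EB).prod 𝓘(ℝ, Fib)) (𝓘(ℝ, EB).prod 𝓘(ℝ, Fib)) ∞ φ φ.source
  smooth_symm :
    ContMDiffOn (𝓘(ℝ, EB).prod 𝓘(ℝ, Fib)) (𝓘(ℝ, EB).prod 𝓘(ℝ, Fib)) ∞ φ.symm φ.target

/-- `φ` is the time-`1` flow of the time-dependent vector field `Zₜ`, `t ∈ [0, 1]`, which is smooth
on the neighbourhood `W` of the zero section and vanishes on the zero section; the flow starting on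
the source of `φ` is defined for all `t ∈ [0, 1]` and stays in `W`. -/
structure IsTimeOneFlow [IsManifold (𝓘(ℝ, EB).prod 𝓘(ℝ, Fib)) 1 (TotalSpace Fib V)]
    (Z : ℝ → ∀ m : TotalSpace Fib V, TE EB m) (W : Set (TotalSpace Fib V))
    (φ : OpenPartialHomeomorph (TotalSpace Fib V) (TotalSpace Fib V)) : Prop where
  isOpen : IsOpen W
  nhd : zeroSec Fib V ⊆ W
  smooth : SmoothTimeVFOn (𝓘(ℝ, EB).prod 𝓘(ℝ, Fib)) Z W
  vanishes : ∀ t ∈ Icc (0 : ℝ) 1, ∀ m ∈ zeroSec Fib V, Z t m = 0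
  diffeo : IsDiffeoNearBase (EB := EB) φ
  flow : ∃ Φ : ℝ → TotalSpace Fib V → TotalSpace Fib V,
    (∀ m ∈ φ.source, Φ 0 m = m) ∧ (∀ m ∈ φ.source, Φ 1 m = φ m) ∧
    ∀ m ∈ φ.source, ∀ t ∈ Icc (0 : ℝ) 1, Φ t m ∈ W ∧
      HasMFDerivWithinAt 𝓘(ℝ, ℝ) (𝓘(ℝ, EB).prod 𝓘(ℝ, Fib)) (fun s => Φ s m) (Icc (0 : ℝ) 1) t
        ((ContinuousLinearMap.id ℝ ℝ).smulRight (Z t (Φ t m)))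

variable (EB) in
/-- (The germ of) `φ` belongs to `𝔇𝔦𝔣𝔣⁰_B(E)`. -/
def IsDiffB0 [IsManifold (𝓘(ℝ, EB).prod 𝓘(ℝ, Fib)) 1 (TotalSpace Fib V)]
    (φ : OpenPartialHomeomorph (TotalSpace Fib V) (TotalSpace Fib V)) : Prop :=
  ∃ (Z : ℝ → ∀ m : TotalSpace Fib V, TE EB m) (W : Set (TotalSpace Fib V)), IsTimeOneFlow Z W φ

end Coupling

end

end CouplingPoisson

/-!
# Equivalence of coupling Poisson tensors with the same vertical part

The equivalence is a Moser argument, carried out for gauge transformations of Poisson tensors. Let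
`θ = Q ∘ dπ`, a `1`-form on the total space, and let `Πₜ = Π (1 + t dθ Π)⁻¹` be the gauge transform
of `Π` by the closed form `t dθ`.

* *Linear algebra.* For a coupling tensor `Π` with data `(Υ, hor, F)` and a `2`-form `D` that
  vanishes on pairs of vertical vectors, the gauge transform of `Π` by `D` has the data
  `(Υ, hor', F - D(hor' ·, hor ·))` with `hor' = hor - Υ D hor` (`gaugeHor`, `gaugeForm`).
  For `D = t dθ` these are `hor + t Υ♯dQ` and `Fₜ = F - (t ∂Q + t²/2 {Q ∧ Q})`, because Cartan's
  formula (`dForm_apply`) expresses `∂Q`, `{Q ∧ Q}` and `Υ♯dQ(u)` through `dθ`. A coupling tensor is determined by its data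
  (`IsLinearCoupling.eq_sharp`), so the relation between the lifts and the vanishing of the Casimir
  cocycle say together that `Π₁ = Π̃` (`gaugeAt_one_eq_sharp`). The same algebra shows that `Fₜ` is
  nondegenerate where the gauge transformation is defined, and that `Xₜ = -Πₜ♯θ` is horizontal with
  `i_{Xₜ} Fₜ = Q` (`isHomotopyFieldOn_homotopyField`).
* *The Moser identity.* The Jacobi identity for `Π` and `d(dθ) = 0` give `∂ₜΠₜ + L_{Xₜ} Πₜ = 0`
  (`fderiv_gaugePath_moserField`). Along a trajectory of `Xₜ`, the push-forward of `Π` and `Πₜ`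
  therefore solve the same linear differential equation, so that they agree
  (`gaugePath_eq_pushforward`).
* *The flow.* Along the zero section `Q = 0`, hence `Xₜ = 0`. Moreover the characteristic
  distribution of `Π` is tangent to the zero section, where `dθ` vanishes; so the gauge
  transformation is defined near the zero section for all `t ∈ [0, 1]`. The time-one flow near a set
  of stationary points is a smooth diffeomorphism (`exists_flow_near_zeros`). Smooth dependence on
  the initial value comes from the implicit function theorem for the integral equation on the space
  of curves `C([0, 1], E)`, whose linearization is `1 - V` with a Volterra operator `V`
  (`exists_contDiffOn_solution`); the flow near the zero section is glued from such local flows by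
  uniqueness of solutions.

Finally, a cocycle of the form `∂K`, with `K` Casimir-valued, is removed by replacing `Q` with
`Q - K`: this changes neither the Hamiltonian fields of the values of `Q` nor their brackets
(`isAdaptedOn_sub`).

Points of the manifold are treated in charts throughout: `chartDeriv` identifies tangent spaces with
the model space, `chartSharp` and `chartForm` are the coordinate expressions of `Π` and `θ`.
-/

namespace CouplingPoisson

noncomputable section

open Filter Topology MeasureTheory

/-! ### The superposition operator on spaces of continuous functions -/

section Superposition

universe u

variable {K : Type*} [TopologicalSpace K]

/-- The superposition operator `γ ↦ f ∘ γ` between spaces of continuous functions. -/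
def superpose {E F : Type*} [TopologicalSpace E] [TopologicalSpace F] (f : C(E, F))
    (γ : C(K, E)) : C(K, F) :=
  f.comp γ

@[simp] lemma superpose_apply {E F : Type*} [TopologicalSpace E] [TopologicalSpace F] (f : C(E, F))
    (γ : C(K, E)) (t : K) : superpose f γ t = f (γ t) := rfl

variable [CompactSpace K]

/-- A continuous family of continuous linear maps acts pointwise on continuous functions. The family
takes values in an auxiliary space `G` that acts by the bilinear map `b`. -/
def pointwiseApply {E F G : Type*} [NormedAddCommGroup E] [NormedSpace ℝ E]
    [NormedAddCommGroup F] [NormedSpace ℝ F] [NormedAddCommGroup G] [NormedSpace ℝ G]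
    (b : G →L[ℝ] E →L[ℝ] F) : C(K, G) →L[ℝ] C(K, E) →L[ℝ] C(K, F) :=
  LinearMap.mkContinuous₂
    (LinearMap.mk₂ ℝ (fun (A : C(K, G)) (γ : C(K, E)) =>
        (⟨fun t => b (A t) (γ t), by fun_prop⟩ : C(K, F)))
      (by intros; ext; simp) (by intros; ext; simp) (by intros; ext; simp) (by intros; ext; simp))
    ‖b‖ (by
      intro A γ
      refine (ContinuousMap.norm_le _ (by positivity)).2 fun t => ?_
      exact (b.le_opNorm₂ _ _).trans
        (mul_le_mul (mul_le_mul_of_nonneg_left (A.norm_coe_le_norm t) b.opNorm_nonneg)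
          (γ.norm_coe_le_norm t) (norm_nonneg _) (by positivity)))

@[simp] lemma pointwiseApply_apply {E F G : Type*} [NormedAddCommGroup E] [NormedSpace ℝ E]
    [NormedAddCommGroup F] [NormedSpace ℝ F] [NormedAddCommGroup G] [NormedSpace ℝ G]
    (b : G →L[ℝ] E →L[ℝ] F) (A : C(K, G)) (γ : C(K, E)) (t : K) :
    pointwiseApply b A γ t = b (A t) (γ t) := rfl

lemma hasFDerivAt_superpose {E F G : Type*} [NormedAddCommGroup E] [NormedSpace ℝ E]
    [NormedAddCommGroup F] [NormedSpace ℝ F] [NormedAddCommGroup G] [NormedSpace ℝ G]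
    (b : G →L[ℝ] E →L[ℝ] F) (f : C(E, F)) (f' : C(E, G))
    (hf : ∀ x, HasFDerivAt f (b (f' x)) x) (γ : C(K, E)) :
    HasFDerivAt (superpose (K := K) f) (pointwiseApply b (superpose f' γ)) γ := by
  rw [hasFDerivAt_iff_isLittleO_nhds_zero, Asymptotics.isLittleO_iff]
  intro ε hε
  have hc : Continuous (superpose (K := K) f') := ContinuousMap.continuous_postcomp f'
  have hb : 0 < ‖b‖ + 1 := by positivity
  obtain ⟨δ, hδ, hδ'⟩ := Metric.continuousAt_iff.1 (hc.continuousAt (x := γ)) (ε / (‖b‖ + 1))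
    (by positivity)
  filter_upwards [Metric.ball_mem_nhds (0 : C(K, E)) hδ] with h hh
  refine (ContinuousMap.norm_le _ (by positivity)).2 fun t => ?_
  -- the mean value inequality on the segment from `γ t` to `γ t + h t`; the scalings of `h` stay
  -- in the ball on which `f' ∘ ·` varies little
  have key := (convex_segment (𝕜 := ℝ) (γ t)
    (γ t + h t)).norm_image_sub_le_of_norm_hasFDerivWithin_le'
    (f := f) (f' := fun x => b (f' x)) (φ := b (f' (γ t))) (C := ε)
    (fun x _ => (hf x).hasFDerivWithinAt) (by
      intro x hx
      rw [segment_eq_image'] at hx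
      obtain ⟨s, hs, rfl⟩ := hx
      have h1 : dist (γ + s • h) γ < δ := by
        rw [dist_eq_norm, add_sub_cancel_left, norm_smul, Real.norm_of_nonneg hs.1]
        have : ‖h‖ < δ := by simpa using hh
        nlinarith [norm_nonneg h, hs.2]
      have h2 := (hδ' h1).le
      rw [dist_eq_norm] at h2
      have h3 := ((superpose f' (γ + s • h) - superpose f' γ).norm_coe_le_norm t).trans h2
      have h4 : ‖f' (γ t + s • h t) - f' (γ t)‖ ≤ ε / (‖b‖ + 1) := h3
      rw [add_sub_cancel_left, ← map_sub]
      refine (b.le_opNorm _).trans ?_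
      calc ‖b‖ * _ ≤ (‖b‖ + 1) * (ε / (‖b‖ + 1)) :=
            mul_le_mul (by linarith) h4 (norm_nonneg _) hb.le
        _ = ε := by field_simp)
    (left_mem_segment ℝ _ _) (right_mem_segment ℝ _ _)
  simp only [add_sub_cancel_left] at key
  calc _ = ‖f (γ t + h t) - f (γ t) - b (f' (γ t)) (h t)‖ := rfl
    _ ≤ ε * ‖h t‖ := key
    _ ≤ ε * ‖h‖ := by gcongr; exact h.norm_coe_le_norm t

lemma contDiff_succ_superpose {E F G : Type*} [NormedAddCommGroup E] [NormedSpace ℝ E]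
    [NormedAddCommGroup F] [NormedSpace ℝ F] [NormedAddCommGroup G] [NormedSpace ℝ G]
    (b : G →L[ℝ] E →L[ℝ] F) (f : C(E, F)) (f' : C(E, G))
    (hf : ∀ x, HasFDerivAt f (b (f' x)) x) {n : ℕ} (hf' : ContDiff ℝ n (superpose (K := K) f')) :
    ContDiff ℝ (n + 1) (superpose (K := K) f) := by
  rw [contDiff_succ_iff_hasFDerivAt]
  exact ⟨fun γ => pointwiseApply b (superpose f' γ),
    (pointwiseApply (K := K) b).contDiff.comp hf',
    hasFDerivAt_superpose b f f' hf⟩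

/-- Superposition with a smooth map is a smooth operator: its derivative is built from the
superposition with the derivative of the map, so that one can induct on the order. -/
lemma contDiff_superpose {E F : Type u} [NormedAddCommGroup E] [NormedSpace ℝ E]
    [NormedAddCommGroup F] [NormedSpace ℝ F] (f : C(E, F)) (hf : ContDiff ℝ ∞ f) :
    ContDiff ℝ ∞ (superpose (K := K) f) := by
  rw [contDiff_infty]
  intro n
  induction n generalizing F with
  | zero =>
    rw [Nat.cast_zero, contDiff_zero]
    exact ContinuousMap.continuous_postcomp f
  | succ n ih =>
    have hf' : ContDiff ℝ ∞ (fderiv ℝ f) := hf.fderiv_right (by simp)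
    rw [Nat.cast_succ]
    exact contDiff_succ_superpose (ContinuousLinearMap.id ℝ (E →L[ℝ] F)) f
      ⟨fderiv ℝ f, hf'.continuous⟩ (fun x => (hf.differentiable (by simp) x).hasFDerivAt)
      (ih ⟨fderiv ℝ f, hf'.continuous⟩ hf')

end Superposition

/-! ### Volterra operators -/

section Volterra

variable {E : Type*} [NormedAddCommGroup E] [NormedSpace ℝ E]

open unitInterval

/-- The function `s ↦ γ s`, extended to the line by constants. -/
abbrev extendIcc (γ : C(I, E)) (s : ℝ) : E := γ (projIcc 0 1 zero_le_one s)

omit [NormedSpace ℝ E] in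
lemma continuous_extendIcc (γ : C(I, E)) : Continuous (extendIcc γ) :=
  γ.continuous.comp continuous_projIcc

variable (E) in
/-- Integration `γ ↦ (t ↦ ∫₀ᵗ γ)` on continuous functions on the unit interval. -/
def primitive : C(I, E) →L[ℝ] C(I, E) :=
  LinearMap.mkContinuous
    { toFun := fun γ => ⟨fun t => ∫ s in (0 : ℝ)..t, extendIcc γ s,
        (intervalIntegral.continuous_primitive
          (fun a b => (continuous_extendIcc γ).intervalIntegrable a b) 0).comp
            continuous_subtype_val⟩
      map_add' := fun γ γ' => by
        ext t
        exact intervalIntegral.integral_add ((continuous_extendIcc γ).intervalIntegrable _ _)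
          ((continuous_extendIcc γ').intervalIntegrable _ _)
      map_smul' := fun c γ => by
        ext t
        exact intervalIntegral.integral_smul c _ }
    1 (by
      intro γ
      rw [one_mul]
      refine (ContinuousMap.norm_le _ (by positivity)).2 fun t => ?_
      have := intervalIntegral.norm_integral_le_of_norm_le_const (a := 0) (b := (t : ℝ))
        (f := extendIcc γ) (C := ‖γ‖) (fun s _ => γ.norm_coe_le_norm _)
      refine this.trans ?_
      rw [sub_zero, abs_of_nonneg t.2.1]
      exact mul_le_of_le_one_right (norm_nonneg _) t.2.2)

lemma primitive_apply (γ : C(I, E)) (t : I) :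
    primitive E γ t = ∫ s in (0 : ℝ)..t, extendIcc γ s := rfl

lemma hasDerivAt_primitive [CompleteSpace E] (γ : C(I, E)) (t : ℝ) :
    HasDerivAt (fun t : ℝ => ∫ s in (0 : ℝ)..t, extendIcc γ s) (extendIcc γ t) t :=
  intervalIntegral.integral_hasDerivAt_right
    ((continuous_extendIcc γ).intervalIntegrable _ _)
    ((continuous_extendIcc γ).stronglyMeasurableAtFilter _ _)
    (continuous_extendIcc γ).continuousAt

variable {G : Type*} [NormedAddCommGroup G] [NormedSpace ℝ G] (b : G →L[ℝ] E →L[ℝ] E)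

/-- The Volterra operator `h ↦ (t ↦ ∫₀ᵗ A(s) h(s) ds)`. -/
def volterra (A : C(I, G)) : C(I, E) →L[ℝ] C(I, E) :=
  (primitive E).comp (pointwiseApply b A)

lemma norm_volterra_pow_le (A : C(I, G)) (n : ℕ) (h : C(I, E)) (t : I) :
    ‖((volterra b A) ^ n) h t‖ ≤ (‖b‖ * ‖A‖ * t) ^ n / n.factorial * ‖h‖ := by
  induction n generalizing t with
  | zero => simpa using h.norm_coe_le_norm t
  | succ n ih =>
    rw [pow_succ', mul_apply_eq_comp, volterra, ContinuousLinearMap.comp_apply, primitive_apply]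
    set k := ((volterra b A) ^ n) h with hk
    have h1 : ‖∫ s in (0 : ℝ)..t, extendIcc (pointwiseApply b A k) s‖ ≤
        ∫ s in (0 : ℝ)..t, ‖b‖ * ‖A‖ * ((‖b‖ * ‖A‖ * s) ^ n / n.factorial * ‖h‖) := by
      refine intervalIntegral.norm_integral_le_of_norm_le t.2.1
        (Eventually.of_forall fun s hs => ?_) ((by fun_prop : Continuous _).intervalIntegrable _ _)
      have hs' : s ∈ Icc (0 : ℝ) 1 := ⟨hs.1.le, hs.2.trans t.2.2⟩
      rw [extendIcc, projIcc_of_mem _ hs', pointwiseApply_apply]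
      refine (b.le_opNorm₂ _ _).trans ?_
      exact mul_le_mul (mul_le_mul_of_nonneg_left (A.norm_coe_le_norm _) b.opNorm_nonneg)
        (ih ⟨s, hs'⟩) (norm_nonneg _) (by positivity)
    refine h1.trans_eq ?_
    have h2 : ∀ s : ℝ, ‖b‖ * ‖A‖ * ((‖b‖ * ‖A‖ * s) ^ n / n.factorial * ‖h‖) =
        ((‖b‖ * ‖A‖) ^ (n + 1) / n.factorial * ‖h‖) * s ^ n := by intro s; ring
    simp_rw [h2]
    rw [intervalIntegral.integral_const_mul, integral_pow, Nat.factorial_succ]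
    push_cast
    field_simp
    ring

/-- `1 - V` is invertible for a Volterra operator `V`, as a power of `V` has norm less than `1`. -/
lemma isUnit_one_sub_volterra [CompleteSpace E] (A : C(I, G)) :
    IsUnit (1 - volterra b A) := by
  set V := volterra b A with hV
  obtain ⟨n, hn⟩ := ((FloorSemiring.tendsto_pow_div_factorial_atTop (‖b‖ * ‖A‖)).eventually
    (gt_mem_nhds one_pos)).exists
  have hVn : ‖V ^ n‖ < 1 := by
    refine lt_of_le_of_lt (ContinuousLinearMap.opNorm_le_bound _ (by positivity) fun h => ?_) hn
    refine (ContinuousMap.norm_le _ (by positivity)).2 fun t => ?_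
    refine (norm_volterra_pow_le b A n h t).trans ?_
    have h0 : 0 ≤ ‖b‖ * ‖A‖ := by positivity
    have h1 : ‖b‖ * ‖A‖ * t ≤ ‖b‖ * ‖A‖ := mul_le_of_le_one_right h0 t.2.2
    have h2 : 0 ≤ ‖b‖ * ‖A‖ * t := mul_nonneg h0 t.2.1
    gcongr
  have h1 : IsUnit (1 - V ^ n) := by
    have := isUnit_one_sub_of_norm_lt_one (R := C(I, E) →L[ℝ] C(I, E)) hVn
    exact this
  have h2 : (1 - V) * ∑ i ∈ Finset.range n, V ^ i = 1 - V ^ n := mul_neg_geom_sum V n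
  have h3 : (∑ i ∈ Finset.range n, V ^ i) * (1 - V) = 1 - V ^ n := geom_sum_mul_neg V n
  have hc : Commute (1 - V) (∑ i ∈ Finset.range n, V ^ i) := h2.trans h3.symm
  exact (hc.isUnit_mul_iff.1 (h2 ▸ h1)).1

end Volterra

/-! ### The flow near a stationary point -/

section Flow

universe u

open unitInterval

variable {E : Type u} [NormedAddCommGroup E] [NormedSpace ℝ E]

variable (E) in
/-- The constant curves. -/
def constCurve : E →L[ℝ] C(I, E) :=
  LinearMap.mkContinuous
    { toFun := fun x => ContinuousMap.const I x
      map_add' := fun _ _ => rfl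
      map_smul' := fun _ _ => rfl } 1
    (fun x => by
      rw [one_mul]
      exact (ContinuousMap.norm_le _ (norm_nonneg _)).2 fun _ => le_rfl)

@[simp] lemma constCurve_apply (x : E) (t : I) : constCurve E x t = x := rfl

/-- The graph `t ↦ (t, γ t)` of a curve. -/
def graphCurve (γ : C(I, E)) : C(I, ℝ × E) :=
  ⟨fun t => ((t : ℝ), (0 : E)), by fun_prop⟩ +
    (ContinuousLinearMap.inr ℝ ℝ E).compLeftContinuous ℝ I γ

@[simp] lemma graphCurve_apply (γ : C(I, E)) (t : I) : graphCurve γ t = ((t : ℝ), γ t) := by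
  simp [graphCurve]

lemma hasFDerivAt_graphCurve (γ : C(I, E)) :
    HasFDerivAt graphCurve ((ContinuousLinearMap.inr ℝ ℝ E).compLeftContinuous ℝ I) γ :=
  ((ContinuousLinearMap.inr ℝ ℝ E).compLeftContinuous ℝ I).hasFDerivAt.const_add _

lemma contDiff_graphCurve : ContDiff ℝ ∞ (graphCurve (E := E)) :=
  contDiff_const.add ((ContinuousLinearMap.inr ℝ ℝ E).compLeftContinuous ℝ I).contDiff

variable (f : C(ℝ × E, E))

/-- The defect `γ - x - ∫ f(s, γ(s)) ds` of a curve as a solution of `γ' = f(t, γ)`, `γ(0) = x`. -/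
def odeDefect (p : E × C(I, E)) : C(I, E) :=
  p.2 - constCurve E p.1 - primitive E (superpose f (graphCurve p.2))

lemma contDiff_odeDefect (hf : ContDiff ℝ ∞ f) : ContDiff ℝ ∞ (odeDefect f) := by
  unfold odeDefect
  exact (contDiff_snd.sub ((constCurve E).contDiff.comp contDiff_fst)).sub
    ((primitive E).contDiff.comp ((contDiff_superpose f hf).comp
      (contDiff_graphCurve.comp contDiff_snd)))

/-- The linearization of `γ' = f(t, γ)` along a curve, as a Volterra operator. -/
def linVolterra {f : C(ℝ × E, E)} (hf : ContDiff ℝ ∞ f) (γ : C(I, E)) : C(I, E) →L[ℝ] C(I, E) :=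
  volterra ((ContinuousLinearMap.compL ℝ E (ℝ × E) E).flip (ContinuousLinearMap.inr ℝ ℝ E))
    (superpose ⟨fderiv ℝ f, (hf.fderiv_right (m := ∞) (by simp)).continuous⟩ (graphCurve γ))

lemma linVolterra_apply {f : C(ℝ × E, E)} (hf : ContDiff ℝ ∞ f) (γ h : C(I, E)) (t : I) :
    linVolterra hf γ h t = ∫ s in (0 : ℝ)..t,
      fderiv ℝ f ((projIcc 0 1 zero_le_one s : I), extendIcc γ s) (0, extendIcc h s) := by
  rw [linVolterra, volterra, ContinuousLinearMap.comp_apply, primitive_apply]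
  simp [extendIcc]

variable {f}

lemma hasFDerivAt_primitive_superpose (hf : ContDiff ℝ ∞ f) (γ : C(I, E)) :
    HasFDerivAt (fun γ => primitive E (superpose f (graphCurve γ))) (linVolterra hf γ) γ := by
  have h1 := hasFDerivAt_superpose (K := I) (ContinuousLinearMap.id ℝ (ℝ × E →L[ℝ] E)) f
    ⟨fderiv ℝ f, (hf.fderiv_right (m := ∞) (by simp)).continuous⟩
    (fun x => (hf.differentiable (by simp) x).hasFDerivAt) (graphCurve γ)
  have h2 := ((primitive E).hasFDerivAt.comp γ (h1.comp γ (hasFDerivAt_graphCurve γ)))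
  refine h2.congr_fderiv ?_
  rfl

/-- The derivative of `(x, γ) ↦ (x, odeDefect (x, γ))` is invertible, because `1 - V` is invertible
for a Volterra operator `V`. -/
lemma exists_equiv_hasFDerivAt [CompleteSpace E] (hf : ContDiff ℝ ∞ f) (p : E × C(I, E)) :
    ∃ e : (E × C(I, E)) ≃L[ℝ] (E × C(I, E)),
      HasFDerivAt (fun q : E × C(I, E) => (q.1, odeDefect f q))
        (e : (E × C(I, E)) →L[ℝ] (E × C(I, E))) p := by
  obtain ⟨U, hU⟩ : IsUnit (1 - linVolterra hf p.2) := isUnit_one_sub_volterra _ _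
  have hU1 : ∀ h, (U : C(I, E) →L[ℝ] C(I, E)) ((↑U⁻¹ : C(I, E) →L[ℝ] C(I, E)) h) = h := fun h => by
    rw [← mul_apply_eq_comp, U.mul_inv]; rfl
  have hU2 : ∀ h, (↑U⁻¹ : C(I, E) →L[ℝ] C(I, E)) ((U : C(I, E) →L[ℝ] C(I, E)) h) = h := fun h => by
    rw [← mul_apply_eq_comp, U.inv_mul]; rfl
  refine ⟨ContinuousLinearEquiv.equivOfInverse
    ((ContinuousLinearMap.fst ℝ E C(I, E)).prod
      ((U : C(I, E) →L[ℝ] C(I, E)).comp (ContinuousLinearMap.snd ℝ E C(I, E)) -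
        (constCurve E).comp (ContinuousLinearMap.fst ℝ E C(I, E))))
    ((ContinuousLinearMap.fst ℝ E C(I, E)).prod
      ((↑U⁻¹ : C(I, E) →L[ℝ] C(I, E)).comp (ContinuousLinearMap.snd ℝ E C(I, E) +
        (constCurve E).comp (ContinuousLinearMap.fst ℝ E C(I, E))))) ?_ ?_, ?_⟩
  · rintro ⟨v, h⟩
    simp [hU2]
  · rintro ⟨v, h⟩
    simp [hU1, ← map_add]
  · have h1 : HasFDerivAt (fun q : E × C(I, E) => q.2 - constCurve E q.1 -
        primitive E (superpose f (graphCurve q.2)))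
        (ContinuousLinearMap.snd ℝ E C(I, E) - (constCurve E).comp (ContinuousLinearMap.fst ℝ _ _) -
          (linVolterra hf p.2).comp (ContinuousLinearMap.snd ℝ E C(I, E))) p :=
      (hasFDerivAt_snd.sub ((constCurve E).hasFDerivAt.comp p hasFDerivAt_fst)).sub
        ((hasFDerivAt_primitive_superpose hf p.2).comp p hasFDerivAt_snd)
    refine (hasFDerivAt_fst.prodMk h1).congr_fderiv ?_
    refine ContinuousLinearMap.ext fun q => Prod.ext rfl ?_
    change q.2 - constCurve E q.1 - linVolterra hf p.2 q.2 =
      (U : C(I, E) →L[ℝ] C(I, E)) q.2 - constCurve E q.1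
    rw [hU]
    exact sub_right_comm _ _ _

/-- Near a stationary point `z₀` of `y' = f(t, y)`, the solutions exist for `t ∈ [0, 1]` and form a
curve in `C([0, 1], E)` depending smoothly on the initial value: this is the implicit function
theorem for the equation `odeDefect f (x, γ) = 0`. -/
lemma exists_contDiffOn_solution [CompleteSpace E] (hf : ContDiff ℝ ∞ f) {z₀ : E}
    (h0 : ∀ t ∈ Icc (0 : ℝ) 1, f (t, z₀) = 0) {O : Set E} (hO : IsOpen O) (hz₀ : z₀ ∈ O) :
    ∃ (U : Set E) (Γ : E → C(I, E)), IsOpen U ∧ z₀ ∈ U ∧ ContDiffOn ℝ ∞ Γ U ∧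
      ∀ x ∈ U, (∀ t, Γ x t ∈ O) ∧
        Γ x = constCurve E x + primitive E (superpose f (graphCurve (Γ x))) := by
  have hH : ContDiff ℝ ∞ (fun q : E × C(I, E) => (q.1, odeDefect f q)) :=
    contDiff_fst.prodMk (contDiff_odeDefect f hf)
  choose e he using exists_equiv_hasFDerivAt hf
  set p₀ : E × C(I, E) := (z₀, constCurve E z₀) with hp₀
  set φ := (hH.contDiffAt (x := p₀)).toOpenPartialHomeomorph _ (he p₀) (by simp) with hφ
  have hφc : ∀ q, φ q = (q.1, odeDefect f q) := fun q => by
    rw [hφ, ContDiffAt.toOpenPartialHomeomorph_coe]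
  have hsrc : p₀ ∈ φ.source := ContDiffAt.mem_toOpenPartialHomeomorph_source _ (he p₀) _
  have hp₀' : φ p₀ = (z₀, 0) := by
    rw [hφc]
    refine Prod.ext rfl ?_
    ext t
    have : ∀ s, extendIcc (superpose f (graphCurve (constCurve E z₀))) s = 0 := fun s => by
      simp [extendIcc, h0 _ (projIcc (0 : ℝ) 1 zero_le_one s).2]
    simp [odeDefect, hp₀, primitive_apply, this]
  have htgt : (z₀, (0 : C(I, E))) ∈ φ.target := hp₀' ▸ φ.map_source hsrc
  set Γ : E → C(I, E) := fun x => (φ.symm (x, 0)).2 with hΓ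
  have hcont : Continuous fun x : E => (x, (0 : C(I, E))) := by fun_prop
  set U₀ : Set E := (fun x : E => (x, (0 : C(I, E)))) ⁻¹' φ.target with hU₀
  have hU₀o : IsOpen U₀ := φ.open_target.preimage hcont
  have hsymm : ∀ x ∈ U₀, φ.symm (x, 0) = (x, Γ x) ∧ odeDefect f (x, Γ x) = 0 := by
    intro x hx
    have h1 := φ.right_inv hx
    rw [hφc] at h1
    have h2 : (φ.symm (x, 0)).1 = x := congrArg Prod.fst h1
    have h3 : φ.symm (x, 0) = (x, Γ x) := Prod.ext h2 rfl
    exact ⟨h3, by rw [← h3]; exact congrArg Prod.snd h1⟩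
  have hΓs : ContDiffOn ℝ ∞ Γ U₀ := by
    intro x hx
    have h1 : ContDiffAt ℝ ∞ φ.symm (x, 0) := by
      refine φ.contDiffAt_symm (f₀' := e (φ.symm (x, 0))) hx ?_ ?_
      · have := he (φ.symm (x, 0))
        exact this
      · exact hH.contDiffAt
    have h2 : ContDiffAt ℝ ∞ (fun x : E => (x, (0 : C(I, E)))) x :=
      contDiffAt_id.prodMk contDiffAt_const
    exact ((contDiffAt_snd.comp x (h1.comp x h2))).contDiffWithinAt
  have hO' : IsOpen {γ : C(I, E) | MapsTo γ univ O} :=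
    ContinuousMap.isOpen_setOfPred_mapsTo isCompact_univ hO
  refine ⟨U₀ ∩ Γ ⁻¹' {γ : C(I, E) | MapsTo γ univ O}, Γ,
    hΓs.continuousOn.isOpen_inter_preimage hU₀o hO', ⟨htgt, ?_⟩, hΓs.mono inter_subset_left, ?_⟩
  · have : Γ z₀ = constCurve E z₀ := by
      rw [hΓ]
      simp only
      rw [← hp₀', φ.left_inv hsrc]
    intro t _
    rw [this]
    exact hz₀
  · rintro x ⟨hx, hxO⟩
    refine ⟨fun t => hxO (mem_univ t), ?_⟩
    have := (hsymm x hx).2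
    simp only [odeDefect] at this
    rw [sub_sub, sub_eq_zero] at this
    exact this

/-- A curve that satisfies the integral equation satisfies the differential equation. -/
lemma hasDerivWithinAt_of_eq_integral [CompleteSpace E] {γ k : C(I, E)} {x : E}
    (h : γ = constCurve E x + primitive E k) {t : ℝ} (ht : t ∈ Icc (0 : ℝ) 1) :
    HasDerivWithinAt (extendIcc γ) (extendIcc k t) (Icc (0 : ℝ) 1) t := by
  have h1 := ((hasDerivAt_primitive k t).const_add x).hasDerivWithinAt (s := Icc (0 : ℝ) 1)
  refine h1.congr_of_mem (fun s hs => ?_) ht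
  conv_lhs => rw [h]
  simp [extendIcc, projIcc_of_mem _ hs, primitive_apply]

/-- **The flow near a stationary point.** Solutions exist on `[0, 1]`, and the derivative `A` of the
flow in the initial value solves the linearized equation. -/
theorem exists_flow [FiniteDimensional ℝ E] {f : ℝ × E → E} (hf : ContDiff ℝ ∞ f) {z₀ : E}
    (h0 : ∀ t ∈ Icc (0 : ℝ) 1, f (t, z₀) = 0) {O : Set E} (hO : IsOpen O) (hz₀ : z₀ ∈ O) :
    ∃ (U : Set E) (Φ : ℝ → E → E), IsOpen U ∧ z₀ ∈ U ∧ (∀ z ∈ U, Φ 0 z = z) ∧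
      (∀ z ∈ U, ∀ t ∈ Icc (0 : ℝ) 1, Φ t z ∈ O ∧
        HasDerivWithinAt (fun s => Φ s z) (f (t, Φ t z)) (Icc (0 : ℝ) 1) t) ∧
      ContDiffOn ℝ ∞ (Φ 1) U ∧
      ∀ z ∈ U, ∃ A : ℝ → E →L[ℝ] E, A 0 = ContinuousLinearMap.id ℝ E ∧
        HasFDerivAt (Φ 1) (A 1) z ∧ ∀ t ∈ Icc (0 : ℝ) 1,
          HasDerivWithinAt A ((fderiv ℝ (fun y => f (t, y)) (Φ t z)).comp (A t))
            (Icc (0 : ℝ) 1) t := by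
  have : CompleteSpace E := FiniteDimensional.complete ℝ E
  set fc : C(ℝ × E, E) := ⟨f, hf.continuous⟩ with hfc
  have hfc' : ContDiff ℝ ∞ fc := hf
  obtain ⟨U, Γ, hU, hzU, hΓ, hsol⟩ := exists_contDiffOn_solution hfc' h0 hO hz₀
  set ev : I → C(I, E) →L[ℝ] E := fun s => ContinuousMap.evalCLM ℝ s with hev
  refine ⟨U, fun t x => extendIcc (Γ x) t, hU, hzU, ?_, ?_, ?_, ?_⟩
  · intro z hz
    simp only [extendIcc]
    rw [(hsol z hz).2]
    simp [primitive_apply]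
  · intro z hz t ht
    refine ⟨(hsol z hz).1 _, ?_⟩
    have := hasDerivWithinAt_of_eq_integral (hsol z hz).2 ht
    convert this using 1
    simp [extendIcc, hfc, projIcc_of_mem _ ht]
  · exact (ev _).contDiff.comp_contDiffOn hΓ
  · intro z hz
    have hd : HasFDerivAt Γ (fderiv ℝ Γ z) z :=
      ((hΓ.contDiffAt (hU.mem_nhds hz)).differentiableAt (by simp)).hasFDerivAt
    set B := fderiv ℝ Γ z with hB
    -- the integral equation for the derivative of the solution curve in the initial value
    have heq : ∀ v, B v = constCurve E v + linVolterra hfc' (Γ z) (B v) := by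
      have h1 : HasFDerivAt Γ (constCurve E + (linVolterra hfc' (Γ z)).comp B) z := by
        refine ((constCurve E).hasFDerivAt.add
          ((hasFDerivAt_primitive_superpose hfc' (Γ z)).comp z hd)).congr_of_eventuallyEq ?_
        filter_upwards [hU.mem_nhds hz] with x hx using (hsol x hx).2
      intro v
      exact congrArg (fun L : E →L[ℝ] C(I, E) => L v) (hd.unique h1)
    set A : ℝ → E →L[ℝ] E := fun t => (ev (projIcc 0 1 zero_le_one t)).comp B with hA
    have hAc : Continuous A := by
      rw [continuous_clm_apply]
      intro v
      exact continuous_extendIcc (B v)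
    set k : ℝ → E →L[ℝ] E := fun s =>
      ((fderiv ℝ f ((projIcc 0 1 zero_le_one s : I), extendIcc (Γ z) s)).comp
        (ContinuousLinearMap.inr ℝ ℝ E)).comp (A s) with hk
    have hkc : Continuous k := by
      refine Continuous.clm_comp (Continuous.clm_comp ?_ continuous_const) hAc
      exact (hf.fderiv_right (m := ∞) (by simp)).continuous.comp
        ((continuous_subtype_val.comp continuous_projIcc).prodMk (continuous_extendIcc (Γ z)))
    have hint : ∀ t ∈ Icc (0 : ℝ) 1, A t = ContinuousLinearMap.id ℝ E + ∫ s in (0 : ℝ)..t, k s := by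
      intro t ht
      ext v
      have h1 : A t v = B v ⟨t, ht⟩ := by simp [hA, hev, projIcc_of_mem _ ht]
      have h2 : (∫ s in (0 : ℝ)..t, k s) v = ∫ s in (0 : ℝ)..t, k s v :=
        ContinuousLinearMap.intervalIntegral_apply (hkc.intervalIntegrable _ _) v
      rw [h1, heq v, ContinuousMap.add_apply, linVolterra_apply, add_apply, h2]
      rfl
    refine ⟨A, ?_, ?_, fun t ht => ?_⟩
    · rw [hint 0 (by simp)]
      simp
    · exact (ev _).hasFDerivAt.comp z hd
    · have h1 : HasDerivAt (fun t : ℝ => ContinuousLinearMap.id ℝ E + ∫ s in (0 : ℝ)..t, k s)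
          (k t) t :=
        (intervalIntegral.integral_hasDerivAt_right (hkc.intervalIntegrable _ _)
          (hkc.stronglyMeasurableAtFilter _ _) hkc.continuousAt).const_add _
      have h2 := h1.hasDerivWithinAt (s := Icc (0 : ℝ) 1) |>.congr_of_mem hint ht
      have h3 : k t = (fderiv ℝ (fun y => f (t, y)) (extendIcc (Γ z) t)).comp (A t) := by
        have h4 : HasFDerivAt (fun y => f (t, y))
            ((fderiv ℝ f (t, extendIcc (Γ z) t)).comp (ContinuousLinearMap.inr ℝ ℝ E))
            (extendIcc (Γ z) t) :=
          (hf.differentiable (by simp) _).hasFDerivAt.comp _ (hasFDerivAt_prodMk_right t _)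
        rw [h4.fderiv]
        simp [hk, projIcc_of_mem _ ht]
      rwa [h3] at h2

end Flow

set_option maxSynthPendingDepth 3

/-! ### Gauge transformations of bivectors -/

section Gauge

variable {E : Type*} [NormedAddCommGroup E] [NormedSpace ℝ E]

/-- The endomorphism `α ↦ α + t D(Λ α, ·)` of the dual space, for a bivector with sharp map `Λ` and
a `2`-form `D`. -/
def gaugeOp (Λ : (E →L[ℝ] ℝ) →L[ℝ] E) (D : E →L[ℝ] E →L[ℝ] ℝ) (t : ℝ) :
    (E →L[ℝ] ℝ) →L[ℝ] (E →L[ℝ] ℝ) :=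
  1 + t • D.comp Λ

/-- The sharp map `Λ ∘ (1 + t D Λ)⁻¹` of the gauge transform of the bivector `Λ` by the `2`-form
`t D`. The value is meaningful when `gaugeOp Λ D t` is invertible, and zero otherwise. -/
def gauge (Λ : (E →L[ℝ] ℝ) →L[ℝ] E) (D : E →L[ℝ] E →L[ℝ] ℝ) (t : ℝ) : (E →L[ℝ] ℝ) →L[ℝ] E :=
  Λ.comp (Ring.inverse (gaugeOp Λ D t))

/-- The transpose of an endomorphism. -/
def transpose : (E →L[ℝ] E) →L[ℝ] ((E →L[ℝ] ℝ) →L[ℝ] (E →L[ℝ] ℝ)) :=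
  (ContinuousLinearMap.compL ℝ E E ℝ).flip

@[simp] lemma transpose_apply (L : E →L[ℝ] E) (α : E →L[ℝ] ℝ) (v : E) :
    transpose L α v = α (L v) := rfl

lemma gaugeOp_apply (Λ : (E →L[ℝ] ℝ) →L[ℝ] E) (D : E →L[ℝ] E →L[ℝ] ℝ) (t : ℝ) (α : E →L[ℝ] ℝ) :
    gaugeOp Λ D t α = α + t • D (Λ α) := rfl

variable {Λ : (E →L[ℝ] ℝ) →L[ℝ] E} {D : E →L[ℝ] E →L[ℝ] ℝ} {t : ℝ}

lemma gauge_comp_gaugeOp (h : IsUnit (gaugeOp Λ D t)) : (gauge Λ D t).comp (gaugeOp Λ D t) = Λ := by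
  have h1 := Ring.inverse_mul_cancel _ h
  rw [gauge, ContinuousLinearMap.comp_assoc]
  change Λ.comp (Ring.inverse (gaugeOp Λ D t) * gaugeOp Λ D t) = Λ
  rw [h1]
  rfl

lemma gauge_gaugeOp_apply (h : IsUnit (gaugeOp Λ D t)) (α : E →L[ℝ] ℝ) :
    gauge Λ D t (gaugeOp Λ D t α) = Λ α :=
  congrArg (fun L : (E →L[ℝ] ℝ) →L[ℝ] E => L α) (gauge_comp_gaugeOp h)

lemma exists_gaugeOp_eq (h : IsUnit (gaugeOp Λ D t)) (α : E →L[ℝ] ℝ) :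
    ∃ a, gaugeOp Λ D t a = α := by
  refine ⟨Ring.inverse (gaugeOp Λ D t) α, ?_⟩
  rw [← mul_apply_eq_comp, Ring.mul_inverse_cancel _ h]
  rfl

lemma gauge_zero : gauge Λ D 0 = Λ := by
  rw [gauge, gaugeOp, zero_smul, add_zero, Ring.inverse_one]
  rfl

lemma gauge_skew (h : IsUnit (gaugeOp Λ D t)) (hΛ : ∀ α β : E →L[ℝ] ℝ, β (Λ α) = -α (Λ β))
    (hD : ∀ x y, D x y = -D y x) (α β : E →L[ℝ] ℝ) :
    β (gauge Λ D t α) = -α (gauge Λ D t β) := by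
  obtain ⟨a, rfl⟩ := exists_gaugeOp_eq h α
  obtain ⟨b, rfl⟩ := exists_gaugeOp_eq h β
  rw [gauge_gaugeOp_apply h, gauge_gaugeOp_apply h, gaugeOp_apply, gaugeOp_apply]
  simp only [add_apply, smul_apply, smul_eq_mul]
  rw [hΛ a b, hD (Λ b) (Λ a)]
  ring

/-- The derivative of a gauge transform along a curve: the contribution of the derivative of the
inverse cancels against that of the bivector, and the remaining terms involve `a` and `b` only. -/
lemma gauge_deriv {Λ Λ' : ℝ → (E →L[ℝ] ℝ) →L[ℝ] E} {D D' : ℝ → E →L[ℝ] E →L[ℝ] ℝ} {c : ℝ → ℝ}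
    {P : ℝ → (E →L[ℝ] ℝ) →L[ℝ] E} {c' : ℝ} {P' : (E →L[ℝ] ℝ) →L[ℝ] E} {s : ℝ}
    (hΛ' : HasDerivAt Λ (Λ' s) s) (hD' : HasDerivAt D (D' s) s) (hc' : HasDerivAt c c' s)
    (hP' : HasDerivAt P P' s)
    (hP : ∀ᶠ r in 𝓝 s, (P r).comp (gaugeOp (Λ r) (D r) (c r)) = Λ r)
    (hskew : ∀ α β : E →L[ℝ] ℝ, β (P s α) = -α (P s β))
    (hD : ∀ x y, D s x y = -D s y x) (a b : E →L[ℝ] ℝ) :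
    gaugeOp (Λ s) (D s) (c s) b (P' (gaugeOp (Λ s) (D s) (c s) a)) =
      b (Λ' s a) + c' * D s (Λ s a) (Λ s b) + c s * D' s (Λ s a) (Λ s b) := by
  have hM : HasDerivAt (fun r => gaugeOp (Λ r) (D r) (c r))
      (c s • ((D s).comp (Λ' s) + (D' s).comp (Λ s)) + c' • (D s).comp (Λ s)) s := by
    have := (hc'.smul (hD'.clm_comp hΛ')).const_add (1 : (E →L[ℝ] ℝ) →L[ℝ] (E →L[ℝ] ℝ))
    rw [add_comm ((D s).comp (Λ' s))]
    exact this
  have h1 : HasDerivAt Λ (P'.comp (gaugeOp (Λ s) (D s) (c s)) + (P s).comp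
      (c s • ((D s).comp (Λ' s) + (D' s).comp (Λ s)) + c' • (D s).comp (Λ s))) s :=
    (hP'.clm_comp hM).congr_of_eventuallyEq (hP.mono fun r hr => hr.symm)
  have h2 := hΛ'.unique h1
  have hPs : ∀ b, P s (gaugeOp (Λ s) (D s) (c s) b) = Λ s b := fun b =>
    congrArg (fun L : (E →L[ℝ] ℝ) →L[ℝ] E => L b) hP.self_of_nhds
  have h3 : P' (gaugeOp (Λ s) (D s) (c s) a) = Λ' s a -
      P s (c s • (D s (Λ' s a) + D' s (Λ s a)) + c' • D s (Λ s a)) := by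
    rw [eq_sub_iff_add_eq]
    exact (congrArg (fun L : (E →L[ℝ] ℝ) →L[ℝ] E => L a) h2).symm
  rw [h3, map_sub, hskew, hPs, gaugeOp_apply]
  simp only [add_apply, smul_apply, smul_eq_mul]
  rw [hD (Λ s b) (Λ' s a)]
  ring

end Gauge

/-! ### The Moser argument in a vector space -/

section Moser

variable {E : Type*} [NormedAddCommGroup E] [NormedSpace ℝ E]

/-- The exterior derivative `dθ(a, c) = Dθ[a](c) - Dθ[c](a)` of a `1`-form on a vector space. -/
def extD (θ : E → E →L[ℝ] ℝ) (z : E) : E →L[ℝ] E →L[ℝ] ℝ :=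
  fderiv ℝ θ z - (fderiv ℝ θ z).flip

lemma extD_apply (θ : E → E →L[ℝ] ℝ) (z a c : E) :
    extD θ z a c = fderiv ℝ θ z a c - fderiv ℝ θ z c a := rfl

lemma extD_skew (θ : E → E →L[ℝ] ℝ) (z a c : E) : extD θ z a c = -extD θ z c a := by
  rw [extD_apply, extD_apply]; ring

lemma contDiffAt_extD {θ : E → E →L[ℝ] ℝ} {z : E} (h : ContDiffAt ℝ ∞ θ z) :
    ContDiffAt ℝ ∞ (extD θ) z := by
  have h1 : ContDiffAt ℝ ∞ (fderiv ℝ θ) z := h.fderiv_right (by simp)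
  exact h1.sub
    ((ContinuousLinearMap.flipₗᵢ ℝ E E ℝ).toContinuousLinearEquiv.contDiff.contDiffAt.comp z h1)

/-- An exact `2`-form is closed. -/
lemma extD_closed {θ : E → E →L[ℝ] ℝ} {z : E} (h : ContDiffAt ℝ ∞ θ z) (x y w : E) :
    fderiv ℝ (extD θ) z x y w + fderiv ℝ (extD θ) z y w x + fderiv ℝ (extD θ) z w x y = 0 := by
  have h1 : DifferentiableAt ℝ (fderiv ℝ θ) z :=
    (h.fderiv_right (m := ∞) (by simp)).differentiableAt (by simp)
  have h2 : HasFDerivAt (extD θ) (fderiv ℝ (fderiv ℝ θ) z -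
      ((ContinuousLinearMap.flipₗᵢ ℝ E E ℝ).toContinuousLinearEquiv :
        (E →L[ℝ] E →L[ℝ] ℝ) →L[ℝ] (E →L[ℝ] E →L[ℝ] ℝ)).comp (fderiv ℝ (fderiv ℝ θ) z)) z :=
    h1.hasFDerivAt.sub
      (((ContinuousLinearMap.flipₗᵢ ℝ E E ℝ).toContinuousLinearEquiv.hasFDerivAt).comp z
        h1.hasFDerivAt)
  have hs : IsSymmSndFDerivAt ℝ θ z :=
    h.isSymmSndFDerivAt (by rw [minSmoothness_of_isRCLikeNormedField]; exact ENat.LEInfty.out)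
  have key : ∀ a b c, fderiv ℝ (extD θ) z a b c =
      fderiv ℝ (fderiv ℝ θ) z a b c - fderiv ℝ (fderiv ℝ θ) z a c b := by
    intro a b c
    rw [h2.fderiv]
    rfl
  rw [key, key, key, hs.eq x y, hs.eq x w, hs.eq y w]
  ring

variable (Λ : E → (E →L[ℝ] ℝ) →L[ℝ] E) (θ : E → E →L[ℝ] ℝ)

/-- The path of gauge transforms of `Λ` by `t dθ`, as a function of `(t, z)`. -/
def gaugePath (p : ℝ × E) : (E →L[ℝ] ℝ) →L[ℝ] E :=
  gauge (Λ p.2) (extD θ p.2) p.1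

/-- The vector field `-Λₜ(θ)` whose flow carries `Λ` to its gauge transform. -/
def moserField (p : ℝ × E) : E :=
  -gaugePath Λ θ p (θ p.2)

variable {Λ θ}

lemma contDiffAt_gaugeOp {p : ℝ × E} (hΛ : ContDiffAt ℝ ∞ Λ p.2) (hθ : ContDiffAt ℝ ∞ θ p.2) :
    ContDiffAt ℝ ∞ (fun p : ℝ × E => gaugeOp (Λ p.2) (extD θ p.2) p.1) p := by
  have h1 : ContDiffAt ℝ ∞ (fun p : ℝ × E => Λ p.2) p := hΛ.comp p contDiffAt_snd
  have h2 : ContDiffAt ℝ ∞ (fun p : ℝ × E => extD θ p.2) p :=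
    (contDiffAt_extD hθ).comp p contDiffAt_snd
  exact contDiffAt_const.add (contDiffAt_fst.smul (h2.clm_comp h1))

lemma contDiffAt_gaugePath [FiniteDimensional ℝ E] {p : ℝ × E} (hΛ : ContDiffAt ℝ ∞ Λ p.2)
    (hθ : ContDiffAt ℝ ∞ θ p.2) (hu : IsUnit (gaugeOp (Λ p.2) (extD θ p.2) p.1)) :
    ContDiffAt ℝ ∞ (gaugePath Λ θ) p := by
  have h1 : ContDiffAt ℝ ∞ (fun p : ℝ × E => Λ p.2) p := hΛ.comp p contDiffAt_snd
  obtain ⟨u, hu⟩ := hu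
  have h2 : ContDiffAt ℝ ∞ Ring.inverse (gaugeOp (Λ p.2) (extD θ p.2) p.1) := by
    rw [← hu]
    exact contDiffAt_ringInverse ℝ u
  exact h1.clm_comp (ContDiffAt.comp (g := Ring.inverse) p h2 (contDiffAt_gaugeOp hΛ hθ))

lemma contDiffAt_moserField [FiniteDimensional ℝ E] {p : ℝ × E} (hΛ : ContDiffAt ℝ ∞ Λ p.2)
    (hθ : ContDiffAt ℝ ∞ θ p.2) (hu : IsUnit (gaugeOp (Λ p.2) (extD θ p.2) p.1)) :
    ContDiffAt ℝ ∞ (moserField Λ θ) p :=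
  ((contDiffAt_gaugePath hΛ hθ hu).clm_apply (hθ.comp p contDiffAt_snd)).neg

/-- The derivative of the gauge path in the direction `(τ, w)`, evaluated on covectors of the form
`gaugeOp a`, which clears the inverses. -/
lemma fderiv_gaugePath [FiniteDimensional ℝ E] {p : ℝ × E} (hΛ : ContDiffAt ℝ ∞ Λ p.2)
    (hskew : ∀ α β : E →L[ℝ] ℝ, β (Λ p.2 α) = -α (Λ p.2 β))
    (hθ : ContDiffAt ℝ ∞ θ p.2) (hu : IsUnit (gaugeOp (Λ p.2) (extD θ p.2) p.1))
    (τ : ℝ) (w : E) (a b : E →L[ℝ] ℝ) :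
    gaugeOp (Λ p.2) (extD θ p.2) p.1 b
        (fderiv ℝ (gaugePath Λ θ) p (τ, w) (gaugeOp (Λ p.2) (extD θ p.2) p.1 a)) =
      b (fderiv ℝ Λ p.2 w a) + τ * extD θ p.2 (Λ p.2 a) (Λ p.2 b) +
        p.1 * fderiv ℝ (extD θ) p.2 w (Λ p.2 a) (Λ p.2 b) := by
  obtain ⟨t, z⟩ := p
  simp only at *
  have hl : HasDerivAt (fun r : ℝ => (t, z) + r • (τ, w)) (τ, w) 0 := by
    simpa using ((hasDerivAt_id (0 : ℝ)).smul_const (τ, w)).const_add (t, z)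
  have hl2 : HasDerivAt (fun r : ℝ => z + r • w) w 0 := by
    simpa using ((hasDerivAt_id (0 : ℝ)).smul_const w).const_add z
  have hl1 : HasDerivAt (fun r : ℝ => t + r • τ) τ 0 := by
    simpa using ((hasDerivAt_id (0 : ℝ)).mul_const τ).const_add t
  have e0 : (t, z) + (0 : ℝ) • (τ, w) = (t, z) := by simp
  have e2 : z + (0 : ℝ) • w = z := by simp
  have e1 : t + (0 : ℝ) • τ = t := by simp
  have h1 : HasDerivAt (fun r : ℝ => Λ (z + r • w)) (fderiv ℝ Λ z w) 0 :=
    (hΛ.differentiableAt (by simp)).hasFDerivAt.comp_hasDerivAt_of_eq (0 : ℝ) hl2 e2.symm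
  have h2 : HasDerivAt (fun r : ℝ => extD θ (z + r • w)) (fderiv ℝ (extD θ) z w) 0 :=
    ((contDiffAt_extD hθ).differentiableAt (by simp)).hasFDerivAt.comp_hasDerivAt_of_eq (0 : ℝ)
      hl2 e2.symm
  have h3 : HasDerivAt (fun r : ℝ => gaugePath Λ θ ((t, z) + r • (τ, w)))
      (fderiv ℝ (gaugePath Λ θ) (t, z) (τ, w)) 0 :=
    ((contDiffAt_gaugePath (p := (t, z)) hΛ hθ hu).differentiableAt
      (by simp)).hasFDerivAt.comp_hasDerivAt_of_eq (0 : ℝ) hl e0.symm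
  have h4 : ∀ᶠ p in 𝓝 (t, z), IsUnit (gaugeOp (Λ p.2) (extD θ p.2) p.1) :=
    (contDiffAt_gaugeOp (p := (t, z)) hΛ hθ).continuousAt.eventually (Units.isOpen.mem_nhds hu)
  have h5 : ∀ᶠ r in 𝓝 (0 : ℝ), (gaugePath Λ θ ((t, z) + r • (τ, w))).comp
      (gaugeOp (Λ (z + r • w)) (extD θ (z + r • w)) (t + r • τ)) = Λ (z + r • w) := by
    have h6 : Tendsto (fun r : ℝ => (t, z) + r • (τ, w)) (𝓝 0) (𝓝 (t, z)) := by
      simpa only [e0] using hl.continuousAt.tendsto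
    filter_upwards [h6.eventually h4] with r hr
    exact gauge_comp_gaugeOp hr
  have := gauge_deriv (Λ := fun r : ℝ => Λ (z + r • w)) (Λ' := fun _ => fderiv ℝ Λ z w)
    (D := fun r : ℝ => extD θ (z + r • w)) (D' := fun _ => fderiv ℝ (extD θ) z w)
    (c := fun r => t + r • τ) h1 h2 hl1 h3 h5
    (by
      simp only [e0]
      exact gauge_skew hu hskew (extD_skew θ z))
    (by simp only [e2]; exact extD_skew θ z) a b
  simpa only [e1, e2] using this

/-- **The infinitesimal Moser identity** `∂ₜΛₜ + L_X Λₜ = 0` for the gauge transforms of a Poisson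
bivector `Λ` by `t dθ` and the vector field `X = -Λₜ(θ)`. It follows from the Jacobi identity for
`Λ` and from `d(dθ) = 0`. -/
lemma fderiv_gaugePath_moserField [FiniteDimensional ℝ E] {p : ℝ × E} (hΛ : ContDiffAt ℝ ∞ Λ p.2)
    (hskew : ∀ᶠ z in 𝓝 p.2, ∀ α β : E →L[ℝ] ℝ, β (Λ z α) = -α (Λ z β))
    (hjac : ∀ a b c : E →L[ℝ] ℝ, c (fderiv ℝ Λ p.2 (Λ p.2 a) b) + a (fderiv ℝ Λ p.2 (Λ p.2 b) c) +
      b (fderiv ℝ Λ p.2 (Λ p.2 c) a) = 0)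
    (hθ : ContDiffAt ℝ ∞ θ p.2) (hu : IsUnit (gaugeOp (Λ p.2) (extD θ p.2) p.1)) :
    fderiv ℝ (gaugePath Λ θ) p (1, moserField Λ θ p) =
      (fderiv ℝ (fun y => moserField Λ θ (p.1, y)) p.2).comp (gaugePath Λ θ p) +
        (gaugePath Λ θ p).comp (transpose (fderiv ℝ (fun y => moserField Λ θ (p.1, y)) p.2)) := by
  have hsk := hskew.self_of_nhds
  have hdskew : ∀ (w : E) (a b : E →L[ℝ] ℝ), b (fderiv ℝ Λ p.2 w a) = -a (fderiv ℝ Λ p.2 w b) := by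
    intro w a b
    have hd := (hΛ.differentiableAt (by simp)).hasFDerivAt
    have h1 : ∀ α β : E →L[ℝ] ℝ, HasFDerivAt (fun z => β (Λ z α))
        (β.comp ((ContinuousLinearMap.apply ℝ E α).comp (fderiv ℝ Λ p.2))) p.2 := fun α β =>
      β.hasFDerivAt.comp p.2 ((ContinuousLinearMap.apply ℝ E α).hasFDerivAt.comp p.2 hd)
    have h2 := ((h1 b a).neg).congr_of_eventuallyEq (f₁ := fun z => b (Λ z a))
      (hskew.mono fun z hz => hz a b)
    exact congrArg (fun L : E →L[ℝ] ℝ => L w) ((h1 a b).unique h2)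
  have hPd := (contDiffAt_gaugePath hΛ hθ hu).differentiableAt (by simp)
  have hPskew : ∀ α β : E →L[ℝ] ℝ, β (gaugePath Λ θ p α) = -α (gaugePath Λ θ p β) :=
    gauge_skew hu hsk (extD_skew θ p.2)
  -- the derivative of the Moser field in the space variable
  have hL : ∀ v, fderiv ℝ (fun y => moserField Λ θ (p.1, y)) p.2 v =
      -(fderiv ℝ (gaugePath Λ θ) p (0, v) (θ p.2) + gaugePath Λ θ p (fderiv ℝ θ p.2 v)) := by
    intro v
    have h1 : HasFDerivAt (fun y => gaugePath Λ θ (p.1, y))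
        ((fderiv ℝ (gaugePath Λ θ) p).comp (ContinuousLinearMap.inr ℝ ℝ E)) p.2 :=
      HasFDerivAt.comp (g := gaugePath Λ θ) p.2 hPd.hasFDerivAt (hasFDerivAt_prodMk_right p.1 p.2)
    have h2 := (h1.clm_apply (hθ.differentiableAt (by simp)).hasFDerivAt).neg
    have h3 : HasFDerivAt (fun y => moserField Λ θ (p.1, y)) _ p.2 := h2
    rw [h3.fderiv]
    simp only [neg_apply, add_apply, ContinuousLinearMap.comp_apply, ContinuousLinearMap.flip_apply,
      ContinuousLinearMap.inr_apply]
    rw [add_comm]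
  obtain ⟨c, hc⟩ := exists_gaugeOp_eq hu (θ p.2)
  have hX : moserField Λ θ p = -Λ p.2 c := by
    rw [moserField, ← hc]
    exact congrArg Neg.neg (gauge_gaugeOp_apply hu c)
  have hPa : ∀ a, gaugePath Λ θ p (gaugeOp (Λ p.2) (extD θ p.2) p.1 a) = Λ p.2 a :=
    gauge_gaugeOp_apply hu
  refine ContinuousLinearMap.ext fun α => ?_
  rw [SeparatingDual.eq_iff_forall_dual_eq (R := ℝ)]
  intro β
  obtain ⟨a, rfl⟩ := exists_gaugeOp_eq hu α
  obtain ⟨b, rfl⟩ := exists_gaugeOp_eq hu β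
  have e1 := fderiv_gaugePath hΛ hsk hθ hu 1 (moserField Λ θ p) a b
  have e2 := fderiv_gaugePath hΛ hsk hθ hu 0 (Λ p.2 a) c b
  have e3 := fderiv_gaugePath hΛ hsk hθ hu 0 (Λ p.2 b) c a
  have e4 := hPskew (fderiv ℝ θ p.2 (Λ p.2 a)) (gaugeOp (Λ p.2) (extD θ p.2) p.1 b)
  have e5 := hPskew (fderiv ℝ θ p.2 (Λ p.2 b)) (gaugeOp (Λ p.2) (extD θ p.2) p.1 a)
  have e6 := hPskew (transpose (fderiv ℝ (fun y => moserField Λ θ (p.1, y)) p.2)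
    (gaugeOp (Λ p.2) (extD θ p.2) p.1 a)) (gaugeOp (Λ p.2) (extD θ p.2) p.1 b)
  rw [hc] at e2 e3
  simp only [add_apply, ContinuousLinearMap.comp_apply, map_add, hPa, transpose_apply, hL,
    map_neg] at e4 e5 e6 ⊢
  rw [e1, e2, e4, e6, e3, e5, hX]
  simp only [map_neg, neg_apply]
  have j := hjac a b c
  have d := extD_closed hθ (Λ p.2 c) (Λ p.2 a) (Λ p.2 b)
  have s1 := hdskew (Λ p.2 a) b c
  have s2 : ∀ w x y, fderiv ℝ (extD θ) p.2 w x y = -fderiv ℝ (extD θ) p.2 w y x := by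
    intro w x y
    have hd := ((contDiffAt_extD hθ).differentiableAt (by simp)).hasFDerivAt
    have h1 : ∀ x y : E, HasFDerivAt (fun z => extD θ z x y)
        ((ContinuousLinearMap.apply ℝ ℝ y).comp
          ((ContinuousLinearMap.apply ℝ (E →L[ℝ] ℝ) x).comp (fderiv ℝ (extD θ) p.2))) p.2 :=
      fun x y => (ContinuousLinearMap.apply ℝ ℝ y).hasFDerivAt.comp p.2
        ((ContinuousLinearMap.apply ℝ (E →L[ℝ] ℝ) x).hasFDerivAt.comp p.2 hd)
    have h2 := ((h1 y x).neg).congr_of_eventuallyEq (f₁ := fun z => extD θ z x y)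
      (Eventually.of_forall fun z => extD_skew θ z x y)
    exact congrArg (fun L : E →L[ℝ] ℝ => L w) ((h1 x y).unique h2)
  have s3 := s2 (Λ p.2 a) (Λ p.2 b) (Λ p.2 c)
  rw [extD_apply]
  linear_combination (-1 : ℝ) * j + s1 - p.1 * d + p.1 * s3

/-- **The Moser argument.** Let `γ` be an integral curve of `X = -Λₜ(θ)` and `A` the solution of the
linearized equation along `γ`, that is, the derivative of the flow. Then `A` carries `Λ` at `γ 0` to
`Λ₁` at `γ 1`, because `A Λ Aᵀ` and `Λₜ(γ t)` solve the same linear equation `Y' = L Y + Y Lᵀ`. -/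
theorem gaugePath_eq_pushforward [FiniteDimensional ℝ E] {γ : ℝ → E} {A : ℝ → E →L[ℝ] E}
    (hΛ : ∀ t ∈ Icc (0 : ℝ) 1, ContDiffAt ℝ ∞ Λ (γ t))
    (hskew : ∀ t ∈ Icc (0 : ℝ) 1, ∀ᶠ z in 𝓝 (γ t), ∀ α β : E →L[ℝ] ℝ, β (Λ z α) = -α (Λ z β))
    (hjac : ∀ t ∈ Icc (0 : ℝ) 1, ∀ a b c : E →L[ℝ] ℝ,
      c (fderiv ℝ Λ (γ t) (Λ (γ t) a) b) + a (fderiv ℝ Λ (γ t) (Λ (γ t) b) c) +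
        b (fderiv ℝ Λ (γ t) (Λ (γ t) c) a) = 0)
    (hθ : ∀ t ∈ Icc (0 : ℝ) 1, ContDiffAt ℝ ∞ θ (γ t))
    (hu : ∀ t ∈ Icc (0 : ℝ) 1, IsUnit (gaugeOp (Λ (γ t)) (extD θ (γ t)) t))
    (hγ : ∀ t ∈ Icc (0 : ℝ) 1,
      HasDerivWithinAt γ (moserField Λ θ (t, γ t)) (Icc (0 : ℝ) 1) t)
    (hA0 : A 0 = ContinuousLinearMap.id ℝ E)
    (hA : ∀ t ∈ Icc (0 : ℝ) 1, HasDerivWithinAt A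
      ((fderiv ℝ (fun y => moserField Λ θ (t, y)) (γ t)).comp (A t)) (Icc (0 : ℝ) 1) t)
    (hL : ContinuousOn (fun t => fderiv ℝ (fun y => moserField Λ θ (t, y)) (γ t))
      (Icc (0 : ℝ) 1)) :
    (A 1).comp ((Λ (γ 0)).comp (transpose (A 1))) = gaugePath Λ θ (1, γ 1) := by
  set L : ℝ → E →L[ℝ] E := fun t => fderiv ℝ (fun y => moserField Λ θ (t, y)) (γ t) with hLdef
  set v : ℝ → ((E →L[ℝ] ℝ) →L[ℝ] E) → ((E →L[ℝ] ℝ) →L[ℝ] E) := fun t Y =>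
    (L t).comp Y + Y.comp (transpose (L t)) with hv
  have h1 : ∀ t ∈ Icc (0 : ℝ) 1, HasDerivWithinAt
      (fun t => (A t).comp ((Λ (γ 0)).comp (transpose (A t))))
      (v t ((A t).comp ((Λ (γ 0)).comp (transpose (A t))))) (Icc (0 : ℝ) 1) t := by
    intro t ht
    have hT : HasDerivWithinAt (fun t => transpose (A t)) (transpose ((L t).comp (A t)))
        (Icc (0 : ℝ) 1) t :=
      (transpose (E := E)).hasFDerivAt.comp_hasDerivWithinAt t (hA t ht)
    have h2 := (hA t ht).clm_comp ((hasDerivWithinAt_const t _ (Λ (γ 0))).clm_comp hT)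
    refine h2.congr_deriv ?_
    ext α
    simp [hv]
    rfl
  have h2 : ∀ t ∈ Icc (0 : ℝ) 1, HasDerivWithinAt (fun t => gaugePath Λ θ (t, γ t))
      (v t (gaugePath Λ θ (t, γ t))) (Icc (0 : ℝ) 1) t := by
    intro t ht
    have hd := ((contDiffAt_gaugePath (p := (t, γ t)) (hΛ t ht) (hθ t ht)
      (hu t ht)).differentiableAt (by simp)).hasFDerivAt
    have h3 := hd.comp_hasDerivWithinAt (f := fun t => (t, γ t)) t
      ((hasDerivWithinAt_id t _).prodMk (hγ t ht))
    rw [fderiv_gaugePath_moserField (p := (t, γ t)) (hΛ t ht) (hskew t ht) (hjac t ht) (hθ t ht)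
      (hu t ht)] at h3
    exact h3
  obtain ⟨K, hK⟩ := isCompact_Icc.exists_bound_of_continuousOn hL
  have hK0 : 0 ≤ K := (norm_nonneg _).trans (hK 0 (by simp))
  set T := ‖(transpose : (E →L[ℝ] E) →L[ℝ] ((E →L[ℝ] ℝ) →L[ℝ] (E →L[ℝ] ℝ)))‖
  have hlip : ∀ t ∈ Ico (0 : ℝ) 1, LipschitzOnWith (K + T * K).toNNReal (v t) univ := by
    intro t ht
    rw [lipschitzOnWith_univ]
    refine LipschitzWith.of_dist_le_mul fun Y Z => ?_
    rw [Real.coe_toNNReal _ (by positivity), dist_eq_norm, dist_eq_norm]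
    have e : v t Y - v t Z = (L t).comp (Y - Z) + (Y - Z).comp (transpose (L t)) := by
      ext α
      simp [hv]
      abel
    have hKt := hK t (Ico_subset_Icc_self ht)
    rw [e]
    calc _ ≤ ‖L t‖ * ‖Y - Z‖ + ‖Y - Z‖ * (T * ‖L t‖) := by
          refine (norm_add_le _ _).trans (add_le_add (ContinuousLinearMap.opNorm_comp_le _ _) ?_)
          refine (ContinuousLinearMap.opNorm_comp_le _ _).trans ?_
          gcongr
          exact ContinuousLinearMap.le_opNorm _ _
      _ ≤ K * ‖Y - Z‖ + ‖Y - Z‖ * (T * K) := by gcongr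
      _ = _ := by ring
  have hmono : ∀ {g g' : ℝ → (E →L[ℝ] ℝ) →L[ℝ] E},
      (∀ t ∈ Icc (0 : ℝ) 1, HasDerivWithinAt g (g' t) (Icc (0 : ℝ) 1) t) →
      ∀ t ∈ Ico (0 : ℝ) 1, HasDerivWithinAt g (g' t) (Ici t) t := fun h t ht =>
    (h t (Ico_subset_Icc_self ht)).mono_of_mem_nhdsWithin (Icc_mem_nhdsGE_of_mem ht)
  have := ODE_solution_unique_of_mem_Icc_right (s := fun _ => univ) hlip
    (fun t ht => (h1 t ht).continuousWithinAt) (hmono h1) (fun _ _ => mem_univ _)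
    (fun t ht => (h2 t ht).continuousWithinAt) (hmono h2) (fun _ _ => mem_univ _) ?_
    (right_mem_Icc.2 zero_le_one)
  · exact this
  · have : gaugePath Λ θ (0, γ 0) = Λ (γ 0) := gauge_zero
    simp only [this, hA0]
    rfl

end Moser

/-! ### Coupling bivectors on a vector space -/

section LinearCoupling

variable {E B : Type*} [NormedAddCommGroup E] [NormedSpace ℝ E]
  [NormedAddCommGroup B] [NormedSpace ℝ B]

/-- The pointwise content of "`Λ` is a coupling bivector with geometric data `(Υ, hor, F)`", for the
projection `p` of a tangent space of the total space onto one of the base. -/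
structure IsLinearCoupling (p : E →L[ℝ] B) (Λ Υ : (E →L[ℝ] ℝ) →L[ℝ] E) (hor : B →L[ℝ] E)
    (F : B →L[ℝ] B →L[ℝ] ℝ) : Prop where
  skew : ∀ α β : E →L[ℝ] ℝ, β (Λ α) = -α (Λ β)
  lift : ∀ u, p (hor u) = u
  exists_hor_eq : ∀ u, ∃ β : E →L[ℝ] ℝ, (∀ v, p v = 0 → β v = 0) ∧ Λ β = hor u
  exists_eq_hor : ∀ β : E →L[ℝ] ℝ, (∀ v, p v = 0 → β v = 0) → ∃ u, hor u = Λ β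
  vertical : ∀ α β : E →L[ℝ] ℝ, β (Υ α) =
    (β.comp (ContinuousLinearMap.id ℝ E - hor.comp p))
      (Λ (α.comp (ContinuousLinearMap.id ℝ E - hor.comp p)))
  form : ∀ β₁ : E →L[ℝ] ℝ, (∀ v, p v = 0 → β₁ v = 0) → ∀ β₂ : E →L[ℝ] ℝ,
    (∀ v, p v = 0 → β₂ v = 0) → β₂ (Λ β₁) = F (p (Λ β₁)) (p (Λ β₂))

namespace IsLinearCoupling

variable {p : E →L[ℝ] B} {Λ Υ : (E →L[ℝ] ℝ) →L[ℝ] E} {hor : B →L[ℝ] E}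
  {F : B →L[ℝ] B →L[ℝ] ℝ}

lemma form_skew (h : IsLinearCoupling p Λ Υ hor F) (u v : B) : F u v = -F v u := by
  obtain ⟨β₁, h₁, e₁⟩ := h.exists_hor_eq u
  obtain ⟨β₂, h₂, e₂⟩ := h.exists_hor_eq v
  have a := h.form β₁ h₁ β₂ h₂
  have b := h.form β₂ h₂ β₁ h₁
  rw [e₁, e₂, h.lift, h.lift] at a b
  rw [← a, ← b, ← e₁, ← e₂, h.skew]

lemma comp_proj_eq_zero {q : B →L[ℝ] ℝ} {v : E} (hv : p v = 0) : (q.comp p) v = 0 := by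
  rw [ContinuousLinearMap.comp_apply, hv, map_zero]

/-- The horizontal lift of `v` is the value of `Λ` on the covector `-F(v, p ·)`. -/
lemma sharp_form (h : IsLinearCoupling p Λ Υ hor F) (v : B) :
    Λ (-(F v).comp p) = hor v := by
  obtain ⟨β, hβ, e⟩ := h.exists_hor_eq v
  have : β = -(F v).comp p := by
    ext x
    -- `β` is determined by its values on horizontal vectors, where the coupling form computes it
    obtain ⟨β₂, h₂, e₂⟩ := h.exists_hor_eq (p x)
    have h1 : β x = β (hor (p x)) := by
      rw [← sub_eq_zero, ← map_sub]
      exact hβ _ (by rw [map_sub, h.lift, sub_self])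
    have h2 := h.form β hβ β₂ h₂
    rw [e, e₂, h.lift, h.lift] at h2
    rw [h1, ← e₂, h.skew, e, h2]
    simp
  rw [← this, e]

lemma form_apply_sharp (h : IsLinearCoupling p Λ Υ hor F) (v : B) (α : E →L[ℝ] ℝ) :
    F v (p (Λ α)) = α (hor v) := by
  rw [← h.sharp_form v, h.skew]
  simp

lemma vert_annihilator (h : IsLinearCoupling p Λ Υ hor F) {α : E →L[ℝ] ℝ}
    (hα : ∀ v, p v = 0 → α v = 0) : Υ α = 0 := by
  rw [SeparatingDual.eq_iff_forall_dual_eq (R := ℝ)]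
  intro β
  have : α.comp (ContinuousLinearMap.id ℝ E - hor.comp p) = 0 := by
    ext x
    exact hα _ (by simp [h.lift])
  rw [h.vertical, this]
  simp

lemma vert_skew (h : IsLinearCoupling p Λ Υ hor F) (α β : E →L[ℝ] ℝ) :
    β (Υ α) = -α (Υ β) := by
  rw [h.vertical, h.vertical, h.skew]

lemma proj_vert (h : IsLinearCoupling p Λ Υ hor F) (α : E →L[ℝ] ℝ) : p (Υ α) = 0 := by
  rw [SeparatingDual.eq_iff_forall_dual_eq (R := ℝ)]
  intro q
  have h1 := h.vert_skew α (q.comp p)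
  rw [h.vert_annihilator fun v hv => comp_proj_eq_zero hv] at h1
  simpa using h1

/-- The vertical component of `Λ α` is `Υ α`. -/
lemma sharp_sub_hor (h : IsLinearCoupling p Λ Υ hor F) (α : E →L[ℝ] ℝ) :
    Λ α - hor (p (Λ α)) = Υ α := by
  rw [SeparatingDual.eq_iff_forall_dual_eq (R := ℝ)]
  intro β
  have e : α = α.comp (ContinuousLinearMap.id ℝ E - hor.comp p) + (α.comp hor).comp p := by
    ext x; simp
  obtain ⟨u, hu⟩ := h.exists_eq_hor ((α.comp hor).comp p) fun v hv => comp_proj_eq_zero hv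
  have h1 : Λ α = Λ (α.comp (ContinuousLinearMap.id ℝ E - hor.comp p)) + hor u := by
    conv_lhs => rw [e]
    rw [map_add, hu]
  rw [h.vertical, h1]
  simp [h.lift]

/-- The form of a coupling bivector is nondegenerate. -/
lemma eq_zero_of_form (h : IsLinearCoupling p Λ Υ hor F) {y : B} (hy : ∀ v, F v y = 0) :
    y = 0 := by
  have h1 : F y = 0 := by
    ext v
    rw [h.form_skew, hy]
    simp
  have h2 := h.sharp_form y
  rw [h1] at h2
  simp only [ContinuousLinearMap.zero_comp, neg_zero, map_zero] at h2
  rw [← h.lift y, ← h2, map_zero]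

/-- A coupling bivector is determined by its geometric data. -/
lemma eq_sharp (h : IsLinearCoupling p Λ Υ hor F) {x : E} {α : E →L[ℝ] ℝ}
    (h1 : ∀ v, F v (p x) = α (hor v)) (h2 : x - hor (p x) = Υ α) : x = Λ α := by
  have hp : p x = p (Λ α) := by
    rw [← sub_eq_zero]
    refine h.eq_zero_of_form fun v => ?_
    rw [map_sub, h1, h.form_apply_sharp, sub_self]
  rw [← h.sharp_sub_hor, ← hp] at h2
  exact sub_left_injective h2

end IsLinearCoupling

/-- The horizontal lift `hor - Υ D hor` of the gauge transform of a coupling bivector by `D`. -/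
def gaugeHor (Υ : (E →L[ℝ] ℝ) →L[ℝ] E) (hor : B →L[ℝ] E) (D : E →L[ℝ] E →L[ℝ] ℝ) : B →L[ℝ] E :=
  hor - Υ.comp (D.comp hor)

/-- The coupling form of the gauge transform of a coupling bivector by `D`. -/
def gaugeForm (Υ : (E →L[ℝ] ℝ) →L[ℝ] E) (hor : B →L[ℝ] E) (F : B →L[ℝ] B →L[ℝ] ℝ)
    (D : E →L[ℝ] E →L[ℝ] ℝ) : B →L[ℝ] B →L[ℝ] ℝ :=
  F - ((ContinuousLinearMap.compL ℝ B E ℝ).flip hor).comp (D.comp (gaugeHor Υ hor D))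

lemma gaugeHor_apply (Υ : (E →L[ℝ] ℝ) →L[ℝ] E) (hor : B →L[ℝ] E) (D : E →L[ℝ] E →L[ℝ] ℝ) (u : B) :
    gaugeHor Υ hor D u = hor u - Υ (D (hor u)) := rfl

lemma gaugeForm_apply (Υ : (E →L[ℝ] ℝ) →L[ℝ] E) (hor : B →L[ℝ] E) (F : B →L[ℝ] B →L[ℝ] ℝ)
    (D : E →L[ℝ] E →L[ℝ] ℝ) (u v : B) :
    gaugeForm Υ hor F D u v = F u v - D (gaugeHor Υ hor D u) (hor v) := rfl

namespace IsLinearCoupling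

variable {p : E →L[ℝ] B} {Λ Υ : (E →L[ℝ] ℝ) →L[ℝ] E} {hor : B →L[ℝ] E}
  {F : B →L[ℝ] B →L[ℝ] ℝ} {D : E →L[ℝ] E →L[ℝ] ℝ}

lemma gaugeForm_eq (hD : ∀ x y, D x y = -D y x) (u v : B) :
    gaugeForm Υ hor F D u v = F u v - (D (hor u) (hor v) + D (hor v) (Υ (D (hor u)))) := by
  rw [gaugeForm_apply, gaugeHor_apply, map_sub, sub_apply, hD (Υ _) (hor v)]
  ring

lemma gaugeForm_skew (h : IsLinearCoupling p Λ Υ hor F) (hD : ∀ x y, D x y = -D y x) (u v : B) :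
    gaugeForm Υ hor F D u v = -gaugeForm Υ hor F D v u := by
  rw [gaugeForm_eq hD, gaugeForm_eq hD, h.form_skew u v, hD (hor u) (hor v),
    h.vert_skew (D (hor u)) (D (hor v))]
  ring

lemma proj_gaugeHor (h : IsLinearCoupling p Λ Υ hor F) (u : B) :
    p (gaugeHor Υ hor D u) = u := by
  rw [gaugeHor_apply, map_sub, h.lift, h.proj_vert, sub_zero]

variable (hD : ∀ x y, D x y = -D y x) (hDv : ∀ x y, p x = 0 → p y = 0 → D x y = 0)
include hDv

/-- The vertical component of the gauge transform, for the transformed connection, is still `Υ`: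
the gauge transform takes the value `Λ α` at the covector `α + D(Λ α)`. -/
lemma vert_gauge (h : IsLinearCoupling p Λ Υ hor F) (α : E →L[ℝ] ℝ) :
    Λ α - gaugeHor Υ hor D (p (Λ α)) = Υ (α + D (Λ α)) := by
  have h1 : Υ (D (Λ α - hor (p (Λ α)))) = 0 :=
    h.vert_annihilator fun v hv => hDv _ _ (by rw [map_sub, h.lift, sub_self]) hv
  rw [map_sub, map_sub, sub_eq_zero] at h1
  rw [gaugeHor_apply, map_add, h1, ← h.sharp_sub_hor α]
  abel

include hD

/-- The transformed form is the coupling form of the gauge transform. -/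
lemma gaugeForm_sharp (h : IsLinearCoupling p Λ Υ hor F) (α : E →L[ℝ] ℝ) (v : B) :
    gaugeForm Υ hor F D v (p (Λ α)) = (α + D (Λ α)) (gaugeHor Υ hor D v) := by
  have h1 : D (gaugeHor Υ hor D v) (Υ α) = -α (Υ (D (hor v))) := by
    rw [gaugeHor_apply, map_sub, sub_apply, hDv _ _ (h.proj_vert _) (h.proj_vert _), sub_zero,
      h.vert_skew]
  have h2 : D (Λ α) (gaugeHor Υ hor D v) =
      -D (gaugeHor Υ hor D v) (hor (p (Λ α))) + α (Υ (D (hor v))) := by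
    rw [hD, ← neg_eq_iff_eq_neg.2 h1, ← h.sharp_sub_hor α, map_sub]
    ring
  have h3 : α (gaugeHor Υ hor D v) = α (hor v) - α (Υ (D (hor v))) := by
    rw [gaugeHor_apply, map_sub]
  rw [gaugeForm_apply, h.form_apply_sharp, add_apply, h2, h3]
  ring

/-- A coupling bivector whose data are the transformed ones is the gauge transform. -/
lemma sharp_gaugeOp {Λ' : (E →L[ℝ] ℝ) →L[ℝ] E} {hor' : B →L[ℝ] E} {F' : B →L[ℝ] B →L[ℝ] ℝ}
    (h : IsLinearCoupling p Λ Υ hor F) (h' : IsLinearCoupling p Λ' Υ hor' F')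
    (hh : ∀ u, hor' u = gaugeHor Υ hor D u) (hF : ∀ u v, F' u v = gaugeForm Υ hor F D u v)
    (α : E →L[ℝ] ℝ) : Λ' (α + D (Λ α)) = Λ α := by
  refine (h'.eq_sharp (fun v => ?_) ?_).symm
  · rw [hF, hh, h.gaugeForm_sharp hD hDv]
  · rw [hh, h.vert_gauge hDv]

/-- The transformed form is nondegenerate where the gauge transformation is defined. -/
lemma gaugeForm_nondegenerate (h : IsLinearCoupling p Λ Υ hor F)
    (hs : ∀ β : E →L[ℝ] ℝ, ∃ α, α + D (Λ α) = β) {v : B}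
    (hv : ∀ w, gaugeForm Υ hor F D v w = 0) : v = 0 := by
  rw [SeparatingDual.eq_iff_forall_dual_eq (R := ℝ)]
  intro q
  obtain ⟨α, hα⟩ := hs (q.comp p)
  have h1 := h.gaugeForm_sharp hD hDv α v
  rw [hv, hα, ContinuousLinearMap.comp_apply, h.proj_gaugeHor] at h1
  rw [← h1, map_zero]

/-- If `α + D(Λ α)` is the pullback of `-q`, then `Λ α` is the horizontal vector of the transformed
connection whose contraction with the transformed form is `q`. -/
lemma gauge_horizontal (h : IsLinearCoupling p Λ Υ hor F) {q : B →L[ℝ] ℝ} {α : E →L[ℝ] ℝ}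
    (hα : α + D (Λ α) = -q.comp p) :
    gaugeHor Υ hor D (p (Λ α)) = Λ α ∧ ∀ w, gaugeForm Υ hor F D (p (Λ α)) w = q w := by
  constructor
  · have h1 := h.vert_gauge hDv α
    rw [hα, map_neg, h.vert_annihilator fun v hv => comp_proj_eq_zero hv, neg_zero,
      sub_eq_zero] at h1
    exact h1.symm
  · intro w
    rw [h.gaugeForm_skew hD, h.gaugeForm_sharp hD hDv, hα, neg_apply, neg_neg,
      ContinuousLinearMap.comp_apply, h.proj_gaugeHor]

end IsLinearCoupling

end LinearCoupling

/-! ### Local solvability up to the end of the interval -/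

section LocalFlow

variable {E : Type*} [NormedAddCommGroup E] [NormedSpace ℝ E]

/-- Local uniqueness of solutions on `[0, 1]`, at the end points of the interval too. -/
theorem eventuallyEq_of_hasDerivWithinAt_Icc {f : ℝ × E → E} {x y : ℝ → E} {t₀ : ℝ}
    (ht₀ : t₀ ∈ Icc (0 : ℝ) 1)
    (hf : ContDiffAt ℝ 1 f (t₀, x t₀))
    (hx : ∀ᶠ t in 𝓝[Icc (0 : ℝ) 1] t₀, HasDerivWithinAt x (f (t, x t)) (Icc (0 : ℝ) 1) t)
    (hy : ∀ᶠ t in 𝓝[Icc (0 : ℝ) 1] t₀, HasDerivWithinAt y (f (t, y t)) (Icc (0 : ℝ) 1) t)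
    (h0 : x t₀ = y t₀) : ∀ᶠ t in 𝓝[Icc (0 : ℝ) 1] t₀, x t = y t := by
  obtain ⟨K, s, hs, hK⟩ := hf.exists_lipschitzOnWith
  have hcx : ContinuousWithinAt x (Icc (0 : ℝ) 1) t₀ :=
    (hx.self_of_nhdsWithin ht₀).continuousWithinAt
  have hcy : ContinuousWithinAt y (Icc (0 : ℝ) 1) t₀ :=
    (hy.self_of_nhdsWithin ht₀).continuousWithinAt
  have hsx : ∀ᶠ t in 𝓝[Icc (0 : ℝ) 1] t₀, (t, x t) ∈ s :=
    (continuousWithinAt_id.prodMk hcx).preimage_mem_nhdsWithin hs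
  have hsy : ∀ᶠ t in 𝓝[Icc (0 : ℝ) 1] t₀, (t, y t) ∈ s := by
    refine (continuousWithinAt_id.prodMk hcy).preimage_mem_nhdsWithin ?_
    simpa [← h0] using hs
  have hall := ((hx.and hy).and (hsx.and hsy))
  obtain ⟨δ, hδ, hP⟩ := Metric.mem_nhdsWithin_iff.1 hall
  have hP' : ∀ t ∈ Icc (0 : ℝ) 1, |t - t₀| < δ →
      (HasDerivWithinAt x (f (t, x t)) (Icc (0 : ℝ) 1) t ∧
        HasDerivWithinAt y (f (t, y t)) (Icc (0 : ℝ) 1) t) ∧ (t, x t) ∈ s ∧ (t, y t) ∈ s :=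
    fun t ht hd => hP ⟨by rwa [Metric.mem_ball, Real.dist_eq], ht⟩
  have hlip : ∀ t, LipschitzOnWith K (fun z => f (t, z)) {z | (t, z) ∈ s} := by
    intro t
    refine LipschitzOnWith.of_dist_le_mul fun a ha b hb => ?_
    have := hK.dist_le_mul _ ha _ hb
    rwa [Prod.dist_eq, dist_self, max_eq_right dist_nonneg] at this
  refine Metric.mem_nhdsWithin_iff.2 ⟨δ, hδ, ?_⟩
  rintro t ⟨htδ, ht⟩
  rw [Metric.mem_ball, Real.dist_eq] at htδ
  rcases le_total t₀ t with hle | hle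
  · have hsub : ∀ r ∈ Icc t₀ t, r ∈ Icc (0 : ℝ) 1 ∧ |r - t₀| < δ := fun r hr =>
      ⟨⟨ht₀.1.trans hr.1, hr.2.trans ht.2⟩, by
        rw [abs_of_nonneg (sub_nonneg.2 hr.1)]
        rw [abs_of_nonneg (sub_nonneg.2 hle)] at htδ
        linarith [hr.2]⟩
    have hIci : ∀ r ∈ Ico t₀ t, Icc (0 : ℝ) 1 ∈ 𝓝[Ici r] r := fun r hr =>
      mem_of_superset (Icc_mem_nhdsGE (lt_of_lt_of_le hr.2 ht.2))
        (Icc_subset_Icc_left (ht₀.1.trans hr.1))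
    exact ODE_solution_unique_of_mem_Icc_right (v := fun t z => f (t, z)) (fun r _ => hlip r)
      (fun r hr => ((hP' r (hsub r hr).1 (hsub r hr).2).1.1.continuousWithinAt).mono
        fun q hq => (hsub q hq).1)
      (fun r hr => (hP' r (hsub r (Ico_subset_Icc_self hr)).1
        (hsub r (Ico_subset_Icc_self hr)).2).1.1.mono_of_mem_nhdsWithin (hIci r hr))
      (fun r hr => (hP' r (hsub r (Ico_subset_Icc_self hr)).1
        (hsub r (Ico_subset_Icc_self hr)).2).2.1)
      (fun r hr => ((hP' r (hsub r hr).1 (hsub r hr).2).1.2.continuousWithinAt).mono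
        fun q hq => (hsub q hq).1)
      (fun r hr => (hP' r (hsub r (Ico_subset_Icc_self hr)).1
        (hsub r (Ico_subset_Icc_self hr)).2).1.2.mono_of_mem_nhdsWithin (hIci r hr))
      (fun r hr => (hP' r (hsub r (Ico_subset_Icc_self hr)).1
        (hsub r (Ico_subset_Icc_self hr)).2).2.2) h0 (right_mem_Icc.2 hle)
  · have hsub : ∀ r ∈ Icc t t₀, r ∈ Icc (0 : ℝ) 1 ∧ |r - t₀| < δ := fun r hr =>
      ⟨⟨ht.1.trans hr.1, hr.2.trans ht₀.2⟩, by
        rw [abs_sub_comm, abs_of_nonneg (sub_nonneg.2 hr.2)]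
        rw [abs_sub_comm, abs_of_nonneg (sub_nonneg.2 hle)] at htδ
        linarith [hr.1]⟩
    have hIic : ∀ r ∈ Ioc t t₀, Icc (0 : ℝ) 1 ∈ 𝓝[Iic r] r := fun r hr =>
      mem_of_superset (Icc_mem_nhdsLE (lt_of_le_of_lt ht.1 hr.1))
        (Icc_subset_Icc_right (hr.2.trans ht₀.2))
    exact ODE_solution_unique_of_mem_Icc_left (v := fun t z => f (t, z)) (fun r _ => hlip r)
      (fun r hr => ((hP' r (hsub r hr).1 (hsub r hr).2).1.1.continuousWithinAt).mono
        fun q hq => (hsub q hq).1)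
      (fun r hr => (hP' r (hsub r (Ioc_subset_Icc_self hr)).1
        (hsub r (Ioc_subset_Icc_self hr)).2).1.1.mono_of_mem_nhdsWithin (hIic r hr))
      (fun r hr => (hP' r (hsub r (Ioc_subset_Icc_self hr)).1
        (hsub r (Ioc_subset_Icc_self hr)).2).2.1)
      (fun r hr => ((hP' r (hsub r hr).1 (hsub r hr).2).1.2.continuousWithinAt).mono
        fun q hq => (hsub q hq).1)
      (fun r hr => (hP' r (hsub r (Ioc_subset_Icc_self hr)).1
        (hsub r (Ioc_subset_Icc_self hr)).2).1.2.mono_of_mem_nhdsWithin (hIic r hr))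
      (fun r hr => (hP' r (hsub r (Ioc_subset_Icc_self hr)).1
        (hsub r (Ioc_subset_Icc_self hr)).2).2.2) h0 (left_mem_Icc.2 hle)

/-- The value at time `1` of the solution of a linear equation `A' = L A` with `A 0 = 1` is
injective, by backward uniqueness. -/
theorem injective_of_linear_ode {A L : ℝ → E →L[ℝ] E} (h0 : A 0 = ContinuousLinearMap.id ℝ E)
    (hL : ContinuousOn L (Icc (0 : ℝ) 1))
    (hA : ∀ t ∈ Icc (0 : ℝ) 1, HasDerivWithinAt A ((L t).comp (A t)) (Icc (0 : ℝ) 1) t) :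
    Function.Injective (A 1) := by
  rw [injective_iff_map_eq_zero]
  intro v hv
  obtain ⟨C, hC⟩ := isCompact_Icc.exists_bound_of_continuousOn hL
  have hder : ∀ t ∈ Icc (0 : ℝ) 1,
      HasDerivWithinAt (fun t => A t v) (L t (A t v)) (Icc (0 : ℝ) 1) t := fun t ht => by
    simpa using (hA t ht).clm_apply (hasDerivWithinAt_const t (Icc (0 : ℝ) 1) v)
  have hIic : ∀ r ∈ Ioc (0 : ℝ) 1, Icc (0 : ℝ) 1 ∈ 𝓝[Iic r] r := fun r hr =>
      mem_of_superset (Icc_mem_nhdsLE hr.1) (Icc_subset_Icc_right hr.2)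
  have := ODE_solution_unique_of_mem_Icc_left (v := fun t z => L t z) (s := fun _ => univ)
    (K := C.toNNReal) (f := fun t => A t v) (g := fun _ => (0 : E)) (a := 0) (b := 1)
    (fun t ht => ((L t).lipschitzWith_of_opNorm_le (by
      rw [Real.coe_toNNReal']
      exact (hC t (Ioc_subset_Icc_self ht)).trans (le_max_left _ _))).lipschitzOnWith)
    (fun t ht => (hder t ht).continuousWithinAt)
    (fun t ht => (hder t (Ioc_subset_Icc_self ht)).mono_of_mem_nhdsWithin (hIic t ht))
    (fun _ _ => mem_univ _) continuousOn_const
    (fun t _ => by simpa using hasDerivWithinAt_const t (Iic t) (0 : E))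
    (fun _ _ => mem_univ _) hv (left_mem_Icc.2 zero_le_one)
  simpa [h0] using this

/-- A function which is smooth on a neighbourhood of a compact set agrees near that set with a
globally smooth function. -/
theorem exists_contDiff_eqOn [FiniteDimensional ℝ E] {G : Type*} [NormedAddCommGroup G]
    [NormedSpace ℝ G] {f : E → G} {K O : Set E} (hK : IsCompact K) (hO : IsOpen O) (hKO : K ⊆ O)
    (hf : ContDiffOn ℝ ∞ f O) :
    ∃ (g : E → G) (O' : Set E), ContDiff ℝ ∞ g ∧ IsOpen O' ∧ K ⊆ O' ∧ O' ⊆ O ∧ EqOn g f O' := by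
  have : ProperSpace E := FiniteDimensional.proper_real E
  obtain ⟨K₁, hK₁, hKK₁, hK₁O⟩ := exists_compact_between hK hO hKO
  obtain ⟨K₂, hK₂, hK₁₂, hK₂O⟩ := exists_compact_between hK₁ hO hK₁O
  obtain ⟨χ, h1, h2, -⟩ := exists_contMDiffMap_one_nhds_of_subset_interior (n := (⊤ : ℕ∞))
    𝓘(ℝ, E) hK₁.isClosed hK₁₂
  have hχ : ContDiff ℝ ∞ (χ : E → ℝ) := χ.contMDiff.contDiff
  refine ⟨fun z => χ z • f z, interior K₁, ?_, isOpen_interior, hKK₁,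
    interior_subset.trans hK₁O, fun z hz => ?_⟩
  · rw [contDiff_iff_contDiffAt]
    intro z
    by_cases hz : z ∈ O
    · exact hχ.contDiffAt.smul (hf.contDiffAt (hO.mem_nhds hz))
    · have hz2 : K₂ᶜ ∈ 𝓝 z := hK₂.isClosed.isOpen_compl.mem_nhds fun h => hz (hK₂O h)
      refine (contDiffAt_const (c := (0 : G))).congr_of_eventuallyEq ?_
      filter_upwards [hz2] with y hy
      rw [h2 y hy, zero_smul]
  · simp [h1.self_of_nhdsSet z (interior_subset hz)]

/-- The flow near a common zero `z₀` of a time-dependent vector field which is only defined near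
`[0, 1] × {z₀}`. -/
theorem exists_local_flow [FiniteDimensional ℝ E] {f : ℝ × E → E} {O : Set (ℝ × E)} (hO : IsOpen O)
    (hf : ContDiffOn ℝ ∞ f O) {z₀ : E} (hz₀ : ∀ t ∈ Icc (0 : ℝ) 1, (t, z₀) ∈ O)
    (h0 : ∀ t ∈ Icc (0 : ℝ) 1, f (t, z₀) = 0) {T : Set E} (hT : IsOpen T) (hzT : z₀ ∈ T) :
    ∃ (U : Set E) (Φ : ℝ → E → E), IsOpen U ∧ z₀ ∈ U ∧ (∀ z ∈ U, Φ 0 z = z) ∧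
      (∀ z ∈ U, ∀ t ∈ Icc (0 : ℝ) 1, Φ t z ∈ T ∧ (t, Φ t z) ∈ O ∧
        HasDerivWithinAt (fun s => Φ s z) (f (t, Φ t z)) (Icc (0 : ℝ) 1) t) ∧
      ContDiffOn ℝ ∞ (Φ 1) U ∧
      ∀ z ∈ U, ∃ A : ℝ → E →L[ℝ] E, A 0 = ContinuousLinearMap.id ℝ E ∧
        HasFDerivAt (Φ 1) (A 1) z ∧
        (∀ t ∈ Icc (0 : ℝ) 1,
          HasDerivWithinAt A ((fderiv ℝ (fun y => f (t, y)) (Φ t z)).comp (A t))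
            (Icc (0 : ℝ) 1) t) ∧
        ContinuousOn (fun t => fderiv ℝ (fun y => f (t, y)) (Φ t z)) (Icc (0 : ℝ) 1) ∧
        Function.Injective (A 1) := by
  have hK : IsCompact (Icc (0 : ℝ) 1 ×ˢ {z₀}) := isCompact_Icc.prod isCompact_singleton
  obtain ⟨g, O', hg, hO', hKO', hO'O, hgf⟩ := exists_contDiff_eqOn hK hO
    (by rintro ⟨t, z⟩ ⟨ht, rfl : z = z₀⟩; exact hz₀ t ht) hf
  obtain ⟨u, v, -, hv, hu1, hv1, huv⟩ := generalized_tube_lemma isCompact_Icc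
    (isCompact_singleton (x := z₀)) hO' hKO'
  have hg0 : ∀ t ∈ Icc (0 : ℝ) 1, g (t, z₀) = 0 := fun t ht => by
    rw [hgf (hKO' (mk_mem_prod ht rfl)), h0 t ht]
  obtain ⟨U, Φ, hU, hzU, hΦ0, hΦ, hΦ1, hA⟩ := exists_flow hg hg0 (hT.inter hv)
    ⟨hzT, hv1 rfl⟩
  have hmem : ∀ z ∈ U, ∀ t ∈ Icc (0 : ℝ) 1, (t, Φ t z) ∈ O' := fun z hz t ht =>
    huv ⟨hu1 ht, (hΦ z hz t ht).1.2⟩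
  have hfd : ∀ z ∈ U, ∀ t ∈ Icc (0 : ℝ) 1,
      fderiv ℝ (fun y => f (t, y)) (Φ t z) = fderiv ℝ (fun y => g (t, y)) (Φ t z) := by
    intro z hz t ht
    refine Filter.EventuallyEq.fderiv_eq ?_
    have : ∀ᶠ y in 𝓝 (Φ t z), (t, y) ∈ O' :=
      (Continuous.prodMk_right t).continuousAt.preimage_mem_nhds
        (hO'.mem_nhds (hmem z hz t ht))
    filter_upwards [this] with y hy using (hgf hy).symm
  refine ⟨U, Φ, hU, hzU, hΦ0, fun z hz t ht => ⟨(hΦ z hz t ht).1.1, hO'O (hmem z hz t ht), ?_⟩,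
    hΦ1, fun z hz => ?_⟩
  · rw [← hgf (hmem z hz t ht)]
    exact (hΦ z hz t ht).2
  obtain ⟨A, hA0, hA1, hA2⟩ := hA z hz
  have hcΦ : ContinuousOn (fun t => Φ t z) (Icc (0 : ℝ) 1) := fun t ht =>
    (hΦ z hz t ht).2.continuousWithinAt
  have hL : ContinuousOn (fun t => fderiv ℝ (fun y => g (t, y)) (Φ t z)) (Icc (0 : ℝ) 1) := by
    have h1 : ∀ p : ℝ × E, fderiv ℝ (fun y => g (p.1, y)) p.2 =
        (fderiv ℝ g p).comp (ContinuousLinearMap.inr ℝ ℝ E) := by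
      intro p
      exact (((hg.differentiable (by simp)).differentiableAt (x := p)).hasFDerivAt.comp p.2
        (hasFDerivAt_prodMk_right p.1 p.2)).fderiv
    have h2 : Continuous fun p : ℝ × E => fderiv ℝ (fun y => g (p.1, y)) p.2 := by
      simp_rw [h1]
      exact (hg.continuous_fderiv (by simp)).clm_comp continuous_const
    exact h2.comp_continuousOn (continuousOn_id.prodMk hcΦ)
  refine ⟨A, hA0, hA1, fun t ht => ?_, hL.congr fun t ht => hfd z hz t ht,
    injective_of_linear_ode hA0 hL hA2⟩
  rw [hfd z hz t ht]
  exact hA2 t ht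

end LocalFlow

/-! ### Local flows on a manifold -/

section ManifoldFlow

variable {E : Type*} [NormedAddCommGroup E] [NormedSpace ℝ E]
  {H : Type*} [TopologicalSpace H] {I : ModelWithCorners ℝ E H}
  {M : Type*} [TopologicalSpace M] [ChartedSpace H M]

variable (I) in
/-- The differential at `m` of the preferred chart at `m₀`. -/
def chartDeriv (m₀ m : M) : TangentSpace I m →L[ℝ] E :=
  mfderiv I 𝓘(ℝ, E) (extChartAt I m₀) m

theorem isInvertible_chartDeriv [IsManifold I 1 M] {m₀ m : M}
    (hm : m ∈ (extChartAt I m₀).source) : (chartDeriv I m₀ m).IsInvertible :=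
  isInvertible_mfderiv_extChartAt hm

theorem hasMFDerivAt_extChartAt' [IsManifold I 1 M] {m₀ m : M}
    (hm : m ∈ (extChartAt I m₀).source) :
    HasMFDerivAt I 𝓘(ℝ, E) (extChartAt I m₀) m (chartDeriv I m₀ m) :=
  (mdifferentiableAt_extChartAt (by rwa [extChartAt_source] at hm)).hasMFDerivAt

theorem hasMFDerivAt_extChartAt_symm [IsManifold I 1 M] [I.Boundaryless] {m₀ m : M}
    (hm : m ∈ (extChartAt I m₀).source) :
    HasMFDerivAt 𝓘(ℝ, E) I (extChartAt I m₀).symm (extChartAt I m₀ m)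
      (mfderiv 𝓘(ℝ, E) I (extChartAt I m₀).symm (extChartAt I m₀ m)) :=
  (((contMDiffOn_extChartAt_symm (n := 1) m₀).contMDiffAt
    ((isOpen_extChartAt_target m₀).mem_nhds ((extChartAt I m₀).map_source hm))).mdifferentiableAt
      one_ne_zero).hasMFDerivAt

theorem mfderiv_extChartAt_symm_chartDeriv [IsManifold I 1 M] [I.Boundaryless] {m₀ m : M}
    (hm : m ∈ (extChartAt I m₀).source) (v : TangentSpace I m) :
    mfderiv 𝓘(ℝ, E) I (extChartAt I m₀).symm (extChartAt I m₀ m) (chartDeriv I m₀ m v) = v := by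
  have := mfderivWithin_extChartAt_symm_comp_mfderiv_extChartAt' hm
  rw [I.range_eq_univ, mfderivWithin_univ] at this
  exact DFunLike.congr_fun this v

/-- `γ` is a solution on `[0, 1]`, inside `W`, of the equation `γ'(t) = Z t (γ t)`. -/
def IsSolution (I : ModelWithCorners ℝ E H) (Z : ℝ → ∀ m : M, TangentSpace I m) (W : Set M)
    (γ : ℝ → M) : Prop :=
  ∀ t ∈ Icc (0 : ℝ) 1, γ t ∈ W ∧
    HasMFDerivWithinAt 𝓘(ℝ, ℝ) I γ (Icc (0 : ℝ) 1) t
      ((ContinuousLinearMap.id ℝ ℝ).smulRight (Z t (γ t)))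

/-- On `W`, the time-dependent vector field `Z` is given in the chart at `m₀` by the function `f`,
which is smooth on the open set `O`. -/
structure IsChartRep (I : ModelWithCorners ℝ E H) (Z : ℝ → ∀ m : M, TangentSpace I m) (W : Set M)
    (m₀ : M) (f : ℝ × E → E) (O : Set (ℝ × E)) : Prop where
  isOpen : IsOpen O
  smooth : ContDiffOn ℝ ∞ f O
  mem : ∀ t ∈ Icc (0 : ℝ) 1, ∀ m ∈ (extChartAt I m₀).source, m ∈ W → (t, extChartAt I m₀ m) ∈ O
  eq : ∀ t ∈ Icc (0 : ℝ) 1, ∀ m ∈ (extChartAt I m₀).source, m ∈ W →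
    chartDeriv I m₀ m (Z t m) = f (t, extChartAt I m₀ m)

variable {Z : ℝ → ∀ m : M, TangentSpace I m} {W : Set M}

theorem IsSolution.hasDerivWithinAt_chart [IsManifold I 1 M] {m₀ : M} {f : ℝ × E → E}
    {O : Set (ℝ × E)} (hf : IsChartRep I Z W m₀ f O) {γ : ℝ → M} (hγ : IsSolution I Z W γ) {t : ℝ}
    (ht : t ∈ Icc (0 : ℝ) 1) (hs : γ t ∈ (extChartAt I m₀).source) :
    HasDerivWithinAt (fun s => extChartAt I m₀ (γ s)) (f (t, extChartAt I m₀ (γ t)))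
      (Icc (0 : ℝ) 1) t := by
  have h := (hasMFDerivAt_extChartAt' hs).comp_hasMFDerivWithinAt t (hγ t ht).2
  have h2 : HasFDerivWithinAt (fun s => extChartAt I m₀ (γ s))
      (show ℝ →L[ℝ] E from (chartDeriv I m₀ (γ t)).comp
        ((ContinuousLinearMap.id ℝ ℝ).smulRight (Z t (γ t)))) (Icc (0 : ℝ) 1) t :=
    hasMFDerivWithinAt_iff_hasFDerivWithinAt.1 h
  refine h2.hasDerivWithinAt.congr_deriv ?_
  rw [← hf.eq t ht _ hs (hγ t ht).1]
  change chartDeriv I m₀ (γ t) ((1 : ℝ) • Z t (γ t)) = _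
  rw [one_smul]

theorem isSolution_of_chart [IsManifold I 1 M] [I.Boundaryless] {m₀ : M} {f : ℝ × E → E}
    {O : Set (ℝ × E)} (hf : IsChartRep I Z W m₀ f O) {y : ℝ → E}
    (hy : ∀ t ∈ Icc (0 : ℝ) 1, y t ∈ (extChartAt I m₀).target ∧ (extChartAt I m₀).symm (y t) ∈ W ∧
      HasDerivWithinAt y (f (t, y t)) (Icc (0 : ℝ) 1) t) :
    IsSolution I Z W fun t => (extChartAt I m₀).symm (y t) := by
  intro t ht
  obtain ⟨h1, h2, h3⟩ := hy t ht
  refine ⟨h2, ?_⟩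
  set m := (extChartAt I m₀).symm (y t) with hm
  have hms : m ∈ (extChartAt I m₀).source := (extChartAt I m₀).map_target h1
  have hym : extChartAt I m₀ m = y t := (extChartAt I m₀).right_inv h1
  have h4 := hasMFDerivAt_extChartAt_symm hms
  rw [hym] at h4
  have h5 := h4.comp_hasMFDerivWithinAt t h3.hasFDerivWithinAt.hasMFDerivWithinAt
  refine h5.congr_mfderiv ?_
  ext
  have h6 : mfderiv 𝓘(ℝ, E) I (extChartAt I m₀).symm (y t) (f (t, y t)) = Z t m := by
    have h7 := hf.eq t ht m hms h2
    rw [hym] at h7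
    rw [← h7]
    have h8 := mfderiv_extChartAt_symm_chartDeriv hms (Z t m)
    rwa [hym] at h8
  change mfderiv 𝓘(ℝ, E) I (extChartAt I m₀).symm (y t) ((1 : ℝ) • f (t, y t)) = (1 : ℝ) • Z t m
  rw [one_smul, one_smul, h6]

theorem IsSolution.continuousWithinAt {γ : ℝ → M} (hγ : IsSolution I Z W γ) {t : ℝ}
    (ht : t ∈ Icc (0 : ℝ) 1) : ContinuousWithinAt γ (Icc (0 : ℝ) 1) t :=
  (hγ t ht).2.continuousWithinAt

/-- Solutions which agree at one time agree at all times. -/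
theorem IsSolution.eqOn [IsManifold I 1 M] [T2Space M] {f : M → ℝ × E → E} {O : M → Set (ℝ × E)}
    (hf : ∀ m₀, IsChartRep I Z W m₀ (f m₀) (O m₀)) {γ η : ℝ → M} (hγ : IsSolution I Z W γ)
    (hη : IsSolution I Z W η) {s : ℝ} (hs : s ∈ Icc (0 : ℝ) 1) (hsγ : γ s = η s) :
    EqOn γ η (Icc (0 : ℝ) 1) := by
  have hcγ : Continuous fun t : Icc (0 : ℝ) 1 => γ t :=
    continuousOn_iff_continuous_domRestrict.1 fun t ht => hγ.continuousWithinAt ht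
  have hcη : Continuous fun t : Icc (0 : ℝ) 1 => η t :=
    continuousOn_iff_continuous_domRestrict.1 fun t ht => hη.continuousWithinAt ht
  have hclopen : IsClopen {t : Icc (0 : ℝ) 1 | γ t = η t} := by
    refine ⟨isClosed_eq hcγ hcη, isOpen_iff_mem_nhds.2 ?_⟩
    rintro ⟨t, ht⟩ (hteq : γ t = η t)
    set m₀ := γ t with hm₀
    have hm₀s : m₀ ∈ (extChartAt I m₀).source := mem_extChartAt_source m₀
    have hγs : ∀ᶠ r in 𝓝[Icc (0 : ℝ) 1] t, γ r ∈ (extChartAt I m₀).source :=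
      (hγ.continuousWithinAt ht).preimage_mem_nhdsWithin
        ((isOpen_extChartAt_source m₀).mem_nhds hm₀s)
    have hηs : ∀ᶠ r in 𝓝[Icc (0 : ℝ) 1] t, η r ∈ (extChartAt I m₀).source :=
      (hη.continuousWithinAt ht).preimage_mem_nhdsWithin
        ((isOpen_extChartAt_source m₀).mem_nhds (by rw [← hteq]; exact hm₀s))
    have key : ∀ᶠ r in 𝓝[Icc (0 : ℝ) 1] t,
        extChartAt I m₀ (γ r) = extChartAt I m₀ (η r) := by
      refine eventuallyEq_of_hasDerivWithinAt_Icc (f := f m₀) ht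
        (((hf m₀).smooth.contDiffAt ((hf m₀).isOpen.mem_nhds
          ((hf m₀).mem t ht _ hm₀s (hγ t ht).1))).of_le (by exact_mod_cast le_top)) ?_ ?_
        (by rw [← hteq])
      · filter_upwards [hγs, self_mem_nhdsWithin] with r hr hrI
        exact hγ.hasDerivWithinAt_chart (hf m₀) hrI hr
      · filter_upwards [hηs, self_mem_nhdsWithin] with r hr hrI
        exact hη.hasDerivWithinAt_chart (hf m₀) hrI hr
    have : ∀ᶠ r in 𝓝[Icc (0 : ℝ) 1] t, γ r = η r := by
      filter_upwards [key, hγs, hηs] with r h1 h2 h3 using (extChartAt I m₀).injOn h2 h3 h1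
    rw [← map_nhds_subtype_val ⟨t, ht⟩] at this
    exact this
  have huniv := hclopen.eq_univ ⟨⟨s, hs⟩, hsγ⟩
  intro t ht
  exact (huniv ▸ mem_univ (⟨t, ht⟩ : Icc (0 : ℝ) 1) : _)

/-- The flow near a common zero `m₀`, together with the linearized equation along its
trajectories in the chart at `m₀`. -/
theorem exists_local_flow_manifold [FiniteDimensional ℝ E] [IsManifold I ∞ M] [I.Boundaryless]
    {m₀ : M} {f : ℝ × E → E} {O : Set (ℝ × E)} (hf : IsChartRep I Z W m₀ f O) (hW : IsOpen W)
    (hm₀ : m₀ ∈ W) (h0 : ∀ t ∈ Icc (0 : ℝ) 1, Z t m₀ = 0) :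
    ∃ (U : Set M) (Φ : ℝ → M → M), IsOpen U ∧ m₀ ∈ U ∧ (∀ m ∈ U, Φ 0 m = m) ∧
      (∀ m ∈ U, IsSolution I Z W fun t => Φ t m) ∧ ContMDiffOn I I ∞ (Φ 1) U ∧
      (∀ m ∈ U, ∃ h : M → M, ContMDiffAt I I ∞ h (Φ 1 m) ∧
        ∀ᶠ y in 𝓝 (Φ 1 m), h y ∈ U ∧ Φ 1 (h y) = y) ∧
      ∀ m ∈ U, m ∈ (extChartAt I m₀).source ∧ ∃ (γ : ℝ → E) (A : ℝ → E →L[ℝ] E),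
        γ 0 = extChartAt I m₀ m ∧ Φ 1 m ∈ (extChartAt I m₀).source ∧
        γ 1 = extChartAt I m₀ (Φ 1 m) ∧
        (∀ t ∈ Icc (0 : ℝ) 1, γ t ∈ (extChartAt I m₀).target ∧
          (extChartAt I m₀).symm (γ t) ∈ W ∧
          HasDerivWithinAt γ (f (t, γ t)) (Icc (0 : ℝ) 1) t) ∧
        A 0 = ContinuousLinearMap.id ℝ E ∧
        (∀ t ∈ Icc (0 : ℝ) 1,
          HasDerivWithinAt A ((fderiv ℝ (fun y => f (t, y)) (γ t)).comp (A t))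
            (Icc (0 : ℝ) 1) t) ∧
        ContinuousOn (fun t => fderiv ℝ (fun y => f (t, y)) (γ t)) (Icc (0 : ℝ) 1) ∧
        ∀ v : TangentSpace I m,
          chartDeriv I m₀ (Φ 1 m) (mfderiv I I (Φ 1) m v) = A 1 (chartDeriv I m₀ m v) := by
  have : IsManifold I 1 M := IsManifold.of_le (n := ∞) (by exact_mod_cast le_top)
  have : CompleteSpace E := FiniteDimensional.complete ℝ E
  set e := extChartAt I m₀ with he
  have hm₀s : m₀ ∈ e.source := mem_extChartAt_source m₀
  have hto : IsOpen e.target := isOpen_extChartAt_target m₀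
  have hT : IsOpen (e.target ∩ e.symm ⁻¹' W) :=
    (continuousOn_extChartAt_symm m₀).isOpen_inter_preimage hto hW
  obtain ⟨U, Φ, hU, hzU, hΦ0, hΦ, hΦ1, hA⟩ := exists_local_flow hf.isOpen hf.smooth
    (z₀ := e m₀) (fun t ht => hf.mem t ht _ hm₀s hm₀)
    (fun t ht => by rw [← hf.eq t ht _ hm₀s hm₀, h0 t ht, map_zero]) hT
    ⟨e.map_source hm₀s, by simpa [e.left_inv hm₀s] using hm₀⟩
  set U' : Set M := e.source ∩ e ⁻¹' U with hU'
  have hU'o : IsOpen U' :=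
    (continuousOn_extChartAt m₀).isOpen_inter_preimage (isOpen_extChartAt_source m₀) hU
  have h01 : (1 : ℝ) ∈ Icc (0 : ℝ) 1 := right_mem_Icc.2 zero_le_one
  have hsm : ContMDiffOn I I ∞ (fun m => e.symm (Φ 1 (e m))) U' := by
    refine (contMDiffOn_extChartAt_symm (n := ∞) m₀).comp (t := e.target)
      ((hΦ1.contMDiffOn).comp (t := U) ((contMDiffOn_extChartAt (n := ∞) (x := m₀)).mono ?_) ?_) ?_
    · rw [← extChartAt_source I m₀]
      exact inter_subset_left
    · exact fun m hm => hm.2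
    · exact fun m hm => (hΦ _ hm.2 1 h01).1.1
  refine ⟨U', fun t m => e.symm (Φ t (e m)), hU'o, ⟨hm₀s, hzU⟩, ?_, ?_, hsm, ?_, ?_⟩
  · intro m hm
    simp only [hΦ0 _ hm.2, e.left_inv hm.1]
  · intro m hm
    exact isSolution_of_chart hf fun t ht =>
      ⟨(hΦ _ hm.2 t ht).1.1, (hΦ _ hm.2 t ht).1.2, (hΦ _ hm.2 t ht).2.2⟩
  · intro m hm
    obtain ⟨A, hA0, hA1, -, -, hinj⟩ := hA _ hm.2
    set L : E ≃L[ℝ] E :=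
      (LinearEquiv.ofInjectiveEndo (A 1).toLinearMap hinj).toContinuousLinearEquiv with hL
    have hAL : (L : E →L[ℝ] E) = A 1 := by
      ext v; rfl
    have hcd : ContDiffAt ℝ ∞ (Φ 1) (e m) := hΦ1.contDiffAt (hU.mem_nhds hm.2)
    have hfd : HasFDerivAt (Φ 1) (L : E →L[ℝ] E) (e m) := by rwa [hAL]
    have hst := hcd.hasStrictFDerivAt' hfd (by simp)
    set g := hcd.localInverse hfd (by simp) with hg
    have hgs : ContDiffAt ℝ ∞ g (Φ 1 (e m)) := hcd.to_localInverse hfd (by simp)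
    have hgr : ∀ᶠ w in 𝓝 (Φ 1 (e m)), Φ 1 (g w) = w := hst.eventually_right_inverse
    have hgi : g (Φ 1 (e m)) = e m := hst.localInverse_apply_image
    have hgU : ∀ᶠ w in 𝓝 (Φ 1 (e m)), g w ∈ U ∩ e.target :=
      hgs.continuousAt.preimage_mem_nhds (by
        rw [hgi]; exact (hU.inter hto).mem_nhds ⟨hm.2, e.map_source hm.1⟩)
    have ht1 : Φ 1 (e m) ∈ e.target := (hΦ _ hm.2 1 h01).1.1
    have hys : e.symm (Φ 1 (e m)) ∈ e.source := e.map_target ht1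
    have hey : e (e.symm (Φ 1 (e m))) = Φ 1 (e m) := e.right_inv ht1
    have hce : ContinuousAt e (e.symm (Φ 1 (e m))) := continuousAt_extChartAt' hys
    refine ⟨fun y => e.symm (g (e y)), ?_, ?_⟩
    · have h1 : ContMDiffAt I 𝓘(ℝ, E) ∞ e (e.symm (Φ 1 (e m))) :=
        contMDiffAt_extChartAt' (by rwa [← extChartAt_source I])
      have h2 : ContMDiffAt 𝓘(ℝ, E) 𝓘(ℝ, E) ∞ g (e (e.symm (Φ 1 (e m)))) := by
        rw [hey]; exact hgs.contMDiffAt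
      have h3 : ContMDiffAt 𝓘(ℝ, E) I ∞ e.symm (g (e (e.symm (Φ 1 (e m))))) := by
        rw [hey, hgi]
        exact (contMDiffOn_extChartAt_symm (n := ∞) m₀).contMDiffAt
          (hto.mem_nhds (e.map_source hm.1))
      exact ContMDiffAt.comp (g := e.symm) _ h3 (ContMDiffAt.comp (g := g) _ h2 h1)
    · have h4 := hce.eventually (by rw [hey]; exact hgr.and hgU)
      filter_upwards [h4, (isOpen_extChartAt_source m₀).mem_nhds hys] with y hy hysrc
      have h5 : e (e.symm (g (e y))) = g (e y) := e.right_inv hy.2.2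
      refine ⟨⟨e.map_target hy.2.2, ?_⟩, ?_⟩
      · change e (e.symm (g (e y))) ∈ U
        rw [h5]; exact hy.2.1
      · simp only [h5, hy.1]
        exact e.left_inv hysrc
  · intro m hm
    obtain ⟨A, hA0, hA1, hA2, hA3, -⟩ := hA _ hm.2
    have ht1 : Φ 1 (e m) ∈ e.target := (hΦ _ hm.2 1 h01).1.1
    have hys : e.symm (Φ 1 (e m)) ∈ e.source := e.map_target ht1
    have hey : e (e.symm (Φ 1 (e m))) = Φ 1 (e m) := e.right_inv ht1
    refine ⟨hm.1, fun t => Φ t (e m), A, hΦ0 _ hm.2, hys, hey.symm, fun t ht =>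
      ⟨(hΦ _ hm.2 t ht).1.1, (hΦ _ hm.2 t ht).1.2, (hΦ _ hm.2 t ht).2.2⟩, hA0, hA2, hA3, ?_⟩
    intro v
    have h1 : HasMFDerivAt I I (fun m => e.symm (Φ 1 (e m))) m
        (mfderiv I I (fun m => e.symm (Φ 1 (e m))) m) :=
      ((hsm.contMDiffAt (hU'o.mem_nhds hm)).mdifferentiableAt (by simp)).hasMFDerivAt
    have h2 := HasMFDerivAt.comp (g := e) m (hasMFDerivAt_extChartAt' hys) h1
    have h3 : HasMFDerivAt I 𝓘(ℝ, E) (fun m => Φ 1 (e m)) m ((A 1).comp (chartDeriv I m₀ m)) :=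
      HasMFDerivAt.comp (g := Φ 1) m hA1.hasMFDerivAt (hasMFDerivAt_extChartAt' hm.1)
    have h4 : (e ∘ fun m => e.symm (Φ 1 (e m))) =ᶠ[𝓝 m] fun m => Φ 1 (e m) := by
      filter_upwards [hU'o.mem_nhds hm] with y hy
      exact e.right_inv (hΦ _ hy.2 1 h01).1.1
    have h5 := hasMFDerivAt_unique h2 (h3.congr_of_eventuallyEq h4)
    exact DFunLike.congr_fun h5 v

end ManifoldFlow

/-! ### The time-one flow near a set of common zeros -/

section GlobalFlow

variable {E : Type*} [NormedAddCommGroup E] [NormedSpace ℝ E]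
  {H : Type*} [TopologicalSpace H] {I : ModelWithCorners ℝ E H}
  {M : Type*} [TopologicalSpace M] [ChartedSpace H M]
  {Z : ℝ → ∀ m : M, TangentSpace I m} {W : Set M}

/-- The flow of a time-dependent vector field near a set `S` of common zeros. The last clause
describes each trajectory, and the differential of the time-one map along it, in a single chart. -/
theorem exists_flow_near_zeros [FiniteDimensional ℝ E] [IsManifold I ∞ M] [I.Boundaryless]
    [T2Space M] [Nonempty M] {f : M → ℝ × E → E} {O : M → Set (ℝ × E)}
    (hf : ∀ m₀, IsChartRep I Z W m₀ (f m₀) (O m₀)) (hW : IsOpen W) {S : Set M} (hS : S ⊆ W)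
    (h0 : ∀ t ∈ Icc (0 : ℝ) 1, ∀ m ∈ S, Z t m = 0) :
    ∃ (φ : OpenPartialHomeomorph M M) (Φ : ℝ → M → M), S ⊆ φ.source ∧ S ⊆ φ.target ∧
      ContMDiffOn I I ∞ φ φ.source ∧ ContMDiffOn I I ∞ φ.symm φ.target ∧
      (∀ m ∈ φ.source, Φ 0 m = m) ∧ (∀ m ∈ φ.source, Φ 1 m = φ m) ∧
      (∀ m ∈ φ.source, IsSolution I Z W fun t => Φ t m) ∧
      ∀ m ∈ φ.source, ∃ m₀ : M, m ∈ (extChartAt I m₀).source ∧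
        ∃ (γ : ℝ → E) (A : ℝ → E →L[ℝ] E),
        γ 0 = extChartAt I m₀ m ∧ φ m ∈ (extChartAt I m₀).source ∧
        γ 1 = extChartAt I m₀ (φ m) ∧
        (∀ t ∈ Icc (0 : ℝ) 1, γ t ∈ (extChartAt I m₀).target ∧
          (extChartAt I m₀).symm (γ t) ∈ W ∧
          HasDerivWithinAt γ (f m₀ (t, γ t)) (Icc (0 : ℝ) 1) t) ∧
        A 0 = ContinuousLinearMap.id ℝ E ∧
        (∀ t ∈ Icc (0 : ℝ) 1,
          HasDerivWithinAt A ((fderiv ℝ (fun y => f m₀ (t, y)) (γ t)).comp (A t))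
            (Icc (0 : ℝ) 1) t) ∧
        ContinuousOn (fun t => fderiv ℝ (fun y => f m₀ (t, y)) (γ t)) (Icc (0 : ℝ) 1) ∧
        ∀ v : TangentSpace I m,
          chartDeriv I m₀ (φ m) (mfderiv I I φ m v) = A 1 (chartDeriv I m₀ m v) := by
  have : IsManifold I 1 M := IsManifold.of_le (n := ∞) (by exact_mod_cast le_top)
  have h00 : (0 : ℝ) ∈ Icc (0 : ℝ) 1 := left_mem_Icc.2 zero_le_one
  have h11 : (1 : ℝ) ∈ Icc (0 : ℝ) 1 := right_mem_Icc.2 zero_le_one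
  have hloc := fun m₀ : S => exists_local_flow_manifold (hf m₀) hW (hS m₀.2)
    (fun t ht => h0 t ht m₀ m₀.2)
  choose U Φ hU hmU hΦ0 hsol hsm hinv hchart using hloc
  have hdom : ∀ m ∈ ⋃ m₀, U m₀, ∃ m₀, m ∈ U m₀ := fun m hm => mem_iUnion.1 hm
  classical
  set D : Set M := ⋃ m₀, U m₀ with hD
  have hDo : IsOpen D := isOpen_iUnion hU
  -- the local flows agree on overlaps, so that the choice of one at each point is harmless
  set Ψ : ℝ → M → M := fun t m => if hm : ∃ m₀, m ∈ U m₀ then Φ hm.choose t m else m with hΨ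
  have hΨs : ∀ m ∈ D, ∃ m₀, m ∈ U m₀ ∧ ∀ t, Ψ t m = Φ m₀ t m := by
    intro m hm
    have h := hdom m hm
    exact ⟨h.choose, h.choose_spec, fun t => by simp only [hΨ, dif_pos h]⟩
  have hΨ0 : ∀ m ∈ D, Ψ 0 m = m := by
    intro m hm
    obtain ⟨m₀, h1, h2⟩ := hΨs m hm
    rw [h2, hΦ0 m₀ m h1]
  have hΨsol : ∀ m ∈ D, IsSolution I Z W fun t => Ψ t m := by
    intro m hm
    obtain ⟨m₀, h1, h2⟩ := hΨs m hm
    simp only [h2]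
    exact hsol m₀ m h1
  have hΨU : ∀ m₀, ∀ m ∈ U m₀, ∀ t ∈ Icc (0 : ℝ) 1, Ψ t m = Φ m₀ t m := by
    intro m₀ m hm
    have hmD : m ∈ D := mem_iUnion.2 ⟨m₀, hm⟩
    exact IsSolution.eqOn hf (hΨsol m hmD) (hsol m₀ m hm) h00
      (by rw [hΨ0 m hmD, hΦ0 m₀ m hm])
  have hev : ∀ m₀, ∀ m ∈ U m₀, Ψ 1 =ᶠ[𝓝 m] Φ m₀ 1 := fun m₀ m hm => by
    filter_upwards [(hU m₀).mem_nhds hm] with y hy using hΨU m₀ y hy 1 h11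
  have hinj : InjOn (Ψ 1) D := by
    intro m hm m' hm' h
    have := IsSolution.eqOn hf (hΨsol m hm) (hΨsol m' hm') h11 h h00
    simpa only [hΨ0 m hm, hΨ0 m' hm'] using this
  have hcm : ContMDiffOn I I ∞ (Ψ 1) D := by
    intro m hm
    obtain ⟨m₀, h1⟩ := hdom m hm
    exact (((hsm m₀).contMDiffAt ((hU m₀).mem_nhds h1)).congr_of_eventuallyEq
      (hev m₀ m h1)).contMDiffWithinAt
  set pe : PartialEquiv M M := hinj.toPartialEquiv (Ψ 1) D with hpe
  have hpes : pe.source = D := rfl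
  have hpec : ∀ m, pe m = Ψ 1 m := fun m => rfl
  have hpet : pe.target = Ψ 1 '' D := rfl
  -- the inverse of the glued map is smooth, as it is given locally by the inverses of local flows
  have hlocinv : ∀ y ∈ pe.target, ∃ h : M → M, ContMDiffAt I I ∞ h y ∧
      ∀ᶠ z in 𝓝 y, z ∈ pe.target ∧ pe.symm z = h z := by
    rintro y ⟨m, hm, rfl⟩
    obtain ⟨m₀, h1⟩ := hdom m hm
    obtain ⟨h, hh, hhe⟩ := hinv m₀ m h1
    rw [← hΨU m₀ m h1 1 h11] at hh hhe
    refine ⟨h, hh, ?_⟩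
    filter_upwards [hhe] with z hz
    have hzD : h z ∈ pe.source := mem_iUnion.2 ⟨m₀, hz.1⟩
    have hz2 : pe (h z) = z := by rw [hpec, hΨU m₀ _ hz.1 1 h11, hz.2]
    refine ⟨hz2 ▸ pe.map_source hzD, ?_⟩
    conv_lhs => rw [← hz2]
    exact pe.left_inv hzD
  have hsymm : ContMDiffOn I I ∞ pe.symm pe.target := by
    intro y hy
    obtain ⟨h, hh, hhe⟩ := hlocinv y hy
    exact (hh.congr_of_eventuallyEq (hhe.mono fun z hz => hz.2)).contMDiffWithinAt
  have hto : IsOpen pe.target := isOpen_iff_mem_nhds.2 fun y hy => by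
    obtain ⟨h, hh, hhe⟩ := hlocinv y hy
    exact hhe.mono fun z hz => hz.1
  set φ : OpenPartialHomeomorph M M :=
    { toPartialEquiv := pe
      continuousOn_toFun := hcm.continuousOn
      continuousOn_invFun := hsymm.continuousOn
      open_source := hDo
      open_target := hto } with hφ
  have hSD : S ⊆ D := fun m hm => mem_iUnion.2 ⟨⟨m, hm⟩, hmU ⟨m, hm⟩⟩
  refine ⟨φ, Ψ, hSD, ?_, hcm, hsymm, hΨ0, fun m _ => rfl, hΨsol, ?_⟩
  · intro m hm
    have hconst : IsSolution I Z W fun _ => m := by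
      intro t ht
      refine ⟨hS hm, ?_⟩
      rw [h0 t ht m hm]
      exact (hasMFDerivWithinAt_const m (Icc (0 : ℝ) 1) t).congr_mfderiv
        (ContinuousLinearMap.smulRight_zero _).symm
    have h2 := IsSolution.eqOn hf (hΨsol m (hSD hm)) hconst h00 (hΨ0 m (hSD hm)) h11
    exact ⟨m, hSD hm, h2⟩
  · intro m hm
    obtain ⟨m₀, h1⟩ := hdom m hm
    obtain ⟨hms, γ, A, hγ0, hs1, hγ1, hγ, hA0, hA, hL, hd⟩ := hchart m₀ m h1
    have hφm : φ m = Φ m₀ 1 m := hΨU m₀ m h1 1 h11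
    have hdφ : mfderiv I I φ m = mfderiv I I (Φ m₀ 1) m := (hev m₀ m h1).mfderiv_eq
    refine ⟨m₀, hms, γ, A, hγ0, by rwa [hφm], by rw [hφm, hγ1], hγ, hA0, hA, hL, fun v => ?_⟩
    rw [hφm, ← hd v, ← hdφ]

end GlobalFlow

/-- The total space of a fibre bundle with Hausdorff base and Hausdorff fibre is Hausdorff. -/
theorem t2Space_totalSpace {B : Type*} [TopologicalSpace B] [T2Space B] {Fib : Type*}
    [TopologicalSpace Fib] [T2Space Fib] {V : B → Type*} [TopologicalSpace (TotalSpace Fib V)]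
    [∀ b, TopologicalSpace (V b)] [FiberBundle Fib V] : T2Space (TotalSpace Fib V) := by
  refine ⟨fun x y hxy => ?_⟩
  have hc : Continuous fun z : TotalSpace Fib V => z.proj := FiberBundle.continuous_proj Fib V
  by_cases hp : x.proj = y.proj
  · set e := trivializationAt Fib V x.proj with he
    have hx : x ∈ e.source := FiberBundle.mem_trivializationAt_proj_source
    have hy : y ∈ e.source := by
      rw [e.mem_source, ← hp, ← e.mem_source]; exact hx
    have hne : e x ≠ e y := fun h => hxy (e.injOn hx hy h)
    obtain ⟨u, v, hu, hv, hxu, hyv, huv⟩ := t2_separation hne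
    refine ⟨e.source ∩ e ⁻¹' u, e.source ∩ e ⁻¹' v, e.continuousOn.isOpen_inter_preimage
      e.open_source hu, e.continuousOn.isOpen_inter_preimage e.open_source hv, ⟨hx, hxu⟩,
      ⟨hy, hyv⟩, ?_⟩
    exact (huv.preimage e).mono inter_subset_right inter_subset_right
  · obtain ⟨u, v, hu, hv, hxu, hyv, huv⟩ := t2_separation hp
    exact ⟨_, _, hu.preimage hc, hv.preimage hc, hxu, hyv, huv.preimage _⟩

/-! ### Lie brackets and bivectors in a chart -/

section ChartCalculus

variable {E : Type*} [NormedAddCommGroup E] [NormedSpace ℝ E]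
  {H : Type*} [TopologicalSpace H] {I : ModelWithCorners ℝ E H}
  {M : Type*} [TopologicalSpace M] [ChartedSpace H M]

theorem contDiffOn_of_forall_dual {G : Type*} [NormedAddCommGroup G]
    [NormedSpace ℝ G] [FiniteDimensional ℝ G] {f : E → G} {s : Set E}
    (h : ∀ β : G →L[ℝ] ℝ, ContDiffOn ℝ ∞ (fun z => β (f z)) s) : ContDiffOn ℝ ∞ f s := by
  set b := (Module.finBasis ℝ G).equivFunL with hb
  rw [← b.comp_contDiffOn_iff, contDiffOn_pi]
  intro i
  set pr : (Fin (Module.finrank ℝ G) → ℝ) →L[ℝ] ℝ := ContinuousLinearMap.proj i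
  exact h (pr.comp (b : G →L[ℝ] (Fin (Module.finrank ℝ G) → ℝ)))

/-- The differential of a function given in the chart at `m₀`. -/
theorem mvfderiv_comp_extChartAt [IsManifold I 1 M] {G : Type*} [NormedAddCommGroup G]
    [NormedSpace ℝ G] {m₀ m : M} (hm : m ∈ (extChartAt I m₀).source) {g : E → G}
    (hg : DifferentiableAt ℝ g (extChartAt I m₀ m)) {f : M → G}
    (hf : f =ᶠ[𝓝 m] fun y => g (extChartAt I m₀ y)) (v : TangentSpace I m) :
    mvfderiv I f m v = fderiv ℝ g (extChartAt I m₀ m) (chartDeriv I m₀ m v) := by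
  have h1 : HasMFDerivAt I 𝓘(ℝ, G) (fun y => g (extChartAt I m₀ y)) m
      ((fderiv ℝ g (extChartAt I m₀ m)).comp (chartDeriv I m₀ m)) :=
    HasMFDerivAt.comp (g := g) m hg.hasFDerivAt.hasMFDerivAt (hasMFDerivAt_extChartAt' hm)
  have h2 := (h1.congr_of_eventuallyEq hf).mfderiv
  have h3 : mvfderiv I f m v = mfderiv I 𝓘(ℝ, G) f m v := rfl
  rw [h3, h2]
  rfl

/-- The sharp map of a bivector field in the chart at `m₀`, as a function of the coordinates. -/
def chartSharp (P : BivectorField I M) (m₀ : M) (z : E) : (E →L[ℝ] ℝ) →L[ℝ] E :=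
  (chartDeriv I m₀ ((extChartAt I m₀).symm z)).comp
    ((P.sharp ((extChartAt I m₀).symm z)).comp
      (ContinuousLinearMap.precomp ℝ (chartDeriv I m₀ ((extChartAt I m₀).symm z))))

theorem chartSharp_apply (P : BivectorField I M) {m₀ m : M}
    (hm : m ∈ (extChartAt I m₀).source) (α : E →L[ℝ] ℝ) :
    chartSharp P m₀ (extChartAt I m₀ m) α =
      chartDeriv I m₀ m (P.sharp m (α.comp (chartDeriv I m₀ m))) := by
  have h : (extChartAt I m₀).symm (extChartAt I m₀ m) = m := (extChartAt I m₀).left_inv hm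
  unfold chartSharp
  rw [h]
  rfl

theorem chartSharp_skew (P : BivectorField I M) (m₀ : M) (z : E) (α β : E →L[ℝ] ℝ) :
    β (chartSharp P m₀ z α) = -α (chartSharp P m₀ z β) :=
  P.skew _ (α.comp (chartDeriv I m₀ _)) (β.comp (chartDeriv I m₀ _))

theorem bracket_chart [IsManifold I 1 M] (P : BivectorField I M) {m₀ m : M}
    (hm : m ∈ (extChartAt I m₀).source) {f g : M → ℝ} {f' g' : E → ℝ}
    (hf' : DifferentiableAt ℝ f' (extChartAt I m₀ m))
    (hf : f =ᶠ[𝓝 m] fun y => f' (extChartAt I m₀ y))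
    (hg' : DifferentiableAt ℝ g' (extChartAt I m₀ m))
    (hg : g =ᶠ[𝓝 m] fun y => g' (extChartAt I m₀ y)) :
    P.bracket f g m = fderiv ℝ g' (extChartAt I m₀ m)
      (chartSharp P m₀ (extChartAt I m₀ m) (fderiv ℝ f' (extChartAt I m₀ m))) := by
  have h1 : mvfderiv I f m =
      (fderiv ℝ f' (extChartAt I m₀ m)).comp (chartDeriv I m₀ m) :=
    ContinuousLinearMap.ext (mvfderiv_comp_extChartAt hm hf' hf)
  have h2 : P.bracket f g m = mvfderiv I g m (P.sharp m (mvfderiv I f m)) := rfl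
  rw [h2, mvfderiv_comp_extChartAt hm hg' hg, chartSharp_apply P hm, h1]

theorem isOpen_chart_preimage [I.Boundaryless] {N : Set M} (hN : IsOpen N) (m₀ : M) :
    IsOpen ((extChartAt I m₀).target ∩ (extChartAt I m₀).symm ⁻¹' N) :=
  (continuousOn_extChartAt_symm m₀).isOpen_inter_preimage (isOpen_extChartAt_target m₀) hN

theorem contMDiffOn_comp_chart [IsManifold I ∞ M] {N : Set M} (m₀ : M) {g : E → ℝ}
    (hg : ContDiff ℝ ∞ g) :
    ContMDiffOn I 𝓘(ℝ, ℝ) ∞ (fun y => g (extChartAt I m₀ y)) ((extChartAt I m₀).source ∩ N) := by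
  refine hg.contMDiff.comp_contMDiffOn ((contMDiffOn_extChartAt (n := ∞) (x := m₀)).mono ?_)
  rw [← extChartAt_source I m₀]
  exact inter_subset_left

theorem contDiffOn_comp_chart_symm [IsManifold I ∞ M] {N : Set M} (m₀ : M) {f : M → ℝ}
    (hf : ContMDiffOn I 𝓘(ℝ, ℝ) ∞ f ((extChartAt I m₀).source ∩ N)) :
    ContDiffOn ℝ ∞ (fun z => f ((extChartAt I m₀).symm z))
      ((extChartAt I m₀).target ∩ (extChartAt I m₀).symm ⁻¹' N) := by
  have h := hf.comp ((contMDiffOn_extChartAt_symm (n := ∞) m₀).mono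
    (inter_subset_left (t := (extChartAt I m₀).symm ⁻¹' N)))
    (fun z hz => ⟨(extChartAt I m₀).map_target hz.1, hz.2⟩)
  exact h.contDiffOn

theorem contDiffOn_chartSharp [IsManifold I ∞ M] [FiniteDimensional ℝ E]
    {P : BivectorField I M} {N : Set M}
    (hN : IsOpen N) (hP : P.SmoothOn N) (m₀ : M) :
    ContDiffOn ℝ ∞ (chartSharp P m₀)
      ((extChartAt I m₀).target ∩ (extChartAt I m₀).symm ⁻¹' N) := by
  have : IsManifold I 1 M := IsManifold.of_le (n := ∞) (by exact_mod_cast le_top)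
  rw [contDiffOn_clm_apply]
  intro α
  refine contDiffOn_of_forall_dual fun β => ?_
  have h1 := hP ((extChartAt I m₀).source ∩ N) ((isOpen_extChartAt_source m₀).inter hN)
    inter_subset_right _ _ (contMDiffOn_comp_chart m₀ α.contDiff)
    (contMDiffOn_comp_chart m₀ β.contDiff)
  refine (contDiffOn_comp_chart_symm m₀ h1).congr fun z hz => ?_
  have hs := (extChartAt I m₀).map_target hz.1
  have h2 := bracket_chart P hs α.differentiableAt EventuallyEq.rfl β.differentiableAt
    EventuallyEq.rfl
  rw [(extChartAt I m₀).right_inv hz.1, α.fderiv, β.fderiv] at h2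
  exact h2.symm

/-- The Jacobi identity for the coordinate functions, in terms of the derivative of the sharp
map. -/
theorem chartSharp_jacobi [IsManifold I ∞ M] [I.Boundaryless] [FiniteDimensional ℝ E]
    {P : BivectorField I M} {N : Set M}
    (hN : IsOpen N) (hP : P.IsPoissonOn N) {m₀ : M} {z : E} (hz : z ∈ (extChartAt I m₀).target)
    (hzN : (extChartAt I m₀).symm z ∈ N) (a b c : E →L[ℝ] ℝ) :
    c (fderiv ℝ (chartSharp P m₀) z (chartSharp P m₀ z a) b) +
      a (fderiv ℝ (chartSharp P m₀) z (chartSharp P m₀ z b) c) +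
        b (fderiv ℝ (chartSharp P m₀) z (chartSharp P m₀ z c) a) = 0 := by
  have : IsManifold I 1 M := IsManifold.of_le (n := ∞) (by exact_mod_cast le_top)
  set e := extChartAt I m₀ with he
  have hs : e.symm z ∈ e.source := e.map_target hz
  have hU : IsOpen (e.source ∩ N) := (isOpen_extChartAt_source m₀).inter hN
  have hd : DifferentiableAt ℝ (chartSharp P m₀) z :=
    ((contDiffOn_chartSharp hN hP.smooth m₀).contDiffAt
      ((isOpen_chart_preimage hN m₀).mem_nhds ⟨hz, hzN⟩)).differentiableAt (by simp)
  have key : ∀ α β γ : E →L[ℝ] ℝ,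
      P.bracket (fun y => α (e y)) (P.bracket (fun y => β (e y)) fun y => γ (e y)) (e.symm z) =
        γ (fderiv ℝ (chartSharp P m₀) z (chartSharp P m₀ z α) β) := by
    intro α β γ
    have h1 : P.bracket (fun y => β (e y)) (fun y => γ (e y)) =ᶠ[𝓝 (e.symm z)]
        fun y => (fun w => γ (chartSharp P m₀ w β)) (e y) := by
      filter_upwards [(isOpen_extChartAt_source m₀).mem_nhds hs] with y hy
      have h2 := bracket_chart P hy β.differentiableAt EventuallyEq.rfl γ.differentiableAt
        EventuallyEq.rfl
      rwa [β.fderiv, γ.fderiv] at h2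
    have h3 : HasFDerivAt (fun w => γ (chartSharp P m₀ w β))
        (γ.comp ((ContinuousLinearMap.apply ℝ E β).comp (fderiv ℝ (chartSharp P m₀) z))) z :=
      γ.hasFDerivAt.comp z ((ContinuousLinearMap.apply ℝ E β).hasFDerivAt.comp z hd.hasFDerivAt)
    have hez : e (e.symm z) = z := e.right_inv hz
    have h4 := bracket_chart P hs α.differentiableAt (f := fun y => α (e y)) EventuallyEq.rfl
      (by rw [hez]; exact h3.differentiableAt) h1
    rw [α.fderiv, hez, h3.fderiv] at h4
    exact h4
  have hj := hP.jacobi _ hU inter_subset_right _ _ _ (contMDiffOn_comp_chart m₀ a.contDiff)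
    (contMDiffOn_comp_chart m₀ b.contDiff) (contMDiffOn_comp_chart m₀ c.contDiff) (e.symm z)
    ⟨hs, hzN⟩
  rw [key a b c, key b c a, key c a b] at hj
  exact hj

/-- A time-dependent vector field with smooth representations in all charts is smooth. -/
theorem smoothTimeVFOn_of_isChartRep {Z : ℝ → ∀ m : M, TangentSpace I m} {W : Set M}
    [IsManifold I 1 M] {f : M → ℝ × E → E} {O : M → Set (ℝ × E)}
    (hf : ∀ m₀, IsChartRep I Z W m₀ (f m₀) (O m₀)) : SmoothTimeVFOn I Z W := by
  rintro ⟨t, m⟩ ⟨ht, hm⟩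
  rw [contMDiffWithinAt_totalSpace]
  refine ⟨contMDiffWithinAt_snd, ?_⟩
  have hms : m ∈ (extChartAt I m).source := mem_extChartAt_source m
  have h1 : ContMDiffWithinAt (𝓘(ℝ, ℝ).prod I) 𝓘(ℝ, ℝ × E) ∞
      (fun p : ℝ × M => (p.1, extChartAt I m p.2)) (Icc (0 : ℝ) 1 ×ˢ W) (t, m) := by
    rw [contMDiffWithinAt_prod_module_iff]
    exact ⟨contMDiffWithinAt_fst,
      ContMDiffAt.comp_contMDiffWithinAt (g := extChartAt I m) (f := Prod.snd) (t, m)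
        (contMDiffAt_extChartAt (n := ∞) (x := m)) contMDiffWithinAt_snd⟩
  have h2 : ContMDiffAt 𝓘(ℝ, ℝ × E) 𝓘(ℝ, E) ∞ (f m) (t, extChartAt I m m) :=
    ((hf m).smooth.contDiffAt ((hf m).isOpen.mem_nhds ((hf m).mem t ht m hms hm))).contMDiffAt
  have h3 := ContMDiffAt.comp_contMDiffWithinAt (g := f m) (t, m) h2 h1
  have hev : ∀ p ∈ (Icc (0 : ℝ) 1 ×ˢ W) ∩ {p : ℝ × M | p.2 ∈ (extChartAt I m).source},
      ((trivializationAt E (TangentSpace I) m) ⟨p.2, Z p.1 p.2⟩).2 =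
        (f m ∘ fun p : ℝ × M => (p.1, extChartAt I m p.2)) p := by
    rintro ⟨s, y⟩ ⟨⟨hs, hy⟩, hys : y ∈ (extChartAt I m).source⟩
    have h4 := (hf m).eq s hs y hys hy
    have hyc : y ∈ (chartAt H m).source := by rwa [← extChartAt_source I]
    change _ = f m (s, extChartAt I m y)
    rw [← h4, chartDeriv, ← TangentBundle.continuousLinearMapAt_trivializationAt hyc]
    rw [Trivialization.continuousLinearMapAt_apply, Trivialization.linearMapAt_apply, if_pos]
    simpa using hyc
  refine h3.congr_of_eventuallyEq ?_ (hev (t, m) ⟨⟨ht, hm⟩, hms⟩)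
  have hopen : {p : ℝ × M | p.2 ∈ (extChartAt I m).source} ∈ 𝓝 (t, m) :=
    ((isOpen_extChartAt_source m).preimage continuous_snd).mem_nhds hms
  filter_upwards [self_mem_nhdsWithin, mem_nhdsWithin_of_mem_nhds hopen] with p h5 h6
    using hev p ⟨h5, h6⟩

end ChartCalculus

/-! ### Vector fields and functions on a manifold -/

section VectorFields

variable {E : Type*} [NormedAddCommGroup E] [NormedSpace ℝ E]
  {H : Type*} [TopologicalSpace H] {I : ModelWithCorners ℝ E H}
  {M : Type*} [TopologicalSpace M] [ChartedSpace H M]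

/-- The coordinates of a vector field in the chart at `m₀`. -/
def chartCoord (I : ModelWithCorners ℝ E H) (m₀ : M) (u : ∀ m : M, TangentSpace I m) (z : E) : E :=
  chartDeriv I m₀ ((extChartAt I m₀).symm z) (u ((extChartAt I m₀).symm z))

theorem chartCoord_apply {m₀ m : M} (hm : m ∈ (extChartAt I m₀).source)
    (u : ∀ m : M, TangentSpace I m) :
    chartCoord I m₀ u (extChartAt I m₀ m) = chartDeriv I m₀ m (u m) := by
  have h : (extChartAt I m₀).symm (extChartAt I m₀ m) = m := (extChartAt I m₀).left_inv hm
  unfold chartCoord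
  rw [h]

/-- The vector field with constant coordinates `w` in the chart at `m₀`. -/
def chartField (I : ModelWithCorners ℝ E H) (m₀ : M) (w : E) (m : M) : TangentSpace I m :=
  (chartDeriv I m₀ m).inverse w

theorem chartDeriv_chartField [IsManifold I 1 M] {m₀ m : M}
    (hm : m ∈ (extChartAt I m₀).source) (w : E) :
    chartDeriv I m₀ m (chartField I m₀ w m) = w :=
  (isInvertible_chartDeriv hm).self_apply_inverse w

theorem chartField_chartDeriv [IsManifold I 1 M] {m₀ m : M} (hm : m ∈ (extChartAt I m₀).source)
    (v : TangentSpace I m) : chartField I m₀ (chartDeriv I m₀ m v) m = v :=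
  (isInvertible_chartDeriv hm).inverse_apply_self v

variable [IsManifold I ∞ M] [IsManifold I 1 M]

theorem smoothVFOn_iff_chart {u : ∀ m : M, TangentSpace I m} {m₀ : M} {W : Set M}
    (hWo : IsOpen W) (hW : W ⊆ (extChartAt I m₀).source) :
    SmoothVFOn I u W ↔ ContMDiffOn I 𝓘(ℝ, E) ∞ (fun m => chartDeriv I m₀ m (u m)) W := by
  have h := (trivializationAt E (TangentSpace I) m₀).contMDiffOn_section_iff (IB := I) (n := ∞)
    (s := u) hWo (by simpa using hW)
  have h2 : ∀ m ∈ W, ((trivializationAt E (TangentSpace I) m₀) ⟨m, u m⟩).2 =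
      chartDeriv I m₀ m (u m) := by
    intro m hm
    have hmc : m ∈ (chartAt H m₀).source := by rw [← extChartAt_source I]; exact hW hm
    rw [chartDeriv, ← TangentBundle.continuousLinearMapAt_trivializationAt hmc,
      Trivialization.continuousLinearMapAt_apply, Trivialization.linearMapAt_apply, if_pos]
    simpa using hmc
  exact h.trans (contMDiffOn_congr h2)

theorem smoothVFOn_chartField (m₀ : M) (w : E) :
    SmoothVFOn I (chartField I m₀ w) (extChartAt I m₀).source := by
  rw [smoothVFOn_iff_chart (isOpen_extChartAt_source m₀) Subset.rfl]
  exact contMDiffOn_const.congr fun m hm => chartDeriv_chartField hm w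

/-- Every tangent vector is a value of a smooth vector field. -/
theorem exists_smoothVF_eq [FiniteDimensional ℝ E] [T2Space M] {m₀ : M} (v : TangentSpace I m₀) :
    ∃ u : ∀ m : M, TangentSpace I m, SmoothVFOn I u univ ∧ u m₀ = v := by
  obtain ⟨ρ⟩ : Nonempty (SmoothBumpFunction I m₀) := inferInstance
  refine ⟨(ρ : M → ℝ) • chartField I m₀ (chartDeriv I m₀ m₀ v), ?_, ?_⟩
  · exact (ContMDiffOn.smul_section_of_tsupport ρ.contMDiff.contMDiffOn
      (isOpen_extChartAt_source m₀) ρ.tsupport_subset_extChartAt_source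
      (smoothVFOn_chartField m₀ _)).contMDiffOn
  · rw [Pi.smul_apply', ρ.eq_one, one_smul,
      chartField_chartDeriv (mem_extChartAt_source m₀)]

theorem contDiffOn_chartCoord {u : ∀ m : M, TangentSpace I m} (hu : SmoothVFOn I u univ) (m₀ : M) :
    ContDiffOn ℝ ∞ (chartCoord I m₀ u) (extChartAt I m₀).target := by
  have h1 := (smoothVFOn_iff_chart (isOpen_extChartAt_source (I := I) m₀) Subset.rfl).1
    (ContMDiffOn.mono hu (subset_univ _))
  exact (h1.comp (contMDiffOn_extChartAt_symm (n := ∞) m₀) fun z hz =>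
    (extChartAt I m₀).map_target hz).contDiffOn

/-- The coordinate expression of the Lie bracket. -/
theorem chartDeriv_mlieBracket [I.Boundaryless] [CompleteSpace E]
    {u v : ∀ m : M, TangentSpace I m} (hu : SmoothVFOn I u univ) (hv : SmoothVFOn I v univ)
    {m₀ m : M} (hm : m ∈ (extChartAt I m₀).source) :
    chartDeriv I m₀ m (VectorField.mlieBracket I u v m) =
      fderiv ℝ (chartCoord I m₀ v) (extChartAt I m₀ m) (chartDeriv I m₀ m (u m)) -
        fderiv ℝ (chartCoord I m₀ u) (extChartAt I m₀ m) (chartDeriv I m₀ m (v m)) := by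
  have hz : extChartAt I m₀ m ∈ (extChartAt I m₀).target := (extChartAt I m₀).map_source hm
  have hinv : ∀ w : ∀ m : M, TangentSpace I m, ∀ z ∈ (extChartAt I m₀).target,
      VectorField.mpullback 𝓘(ℝ, E) I (extChartAt I m₀).symm w z = chartCoord I m₀ w z := by
    intro w z hz
    have hs := (extChartAt I m₀).map_target hz
    have h1 := mfderivWithin_extChartAt_symm_comp_mfderiv_extChartAt' hs
    have h2 := mfderiv_extChartAt_comp_mfderivWithin_extChartAt_symm' hs
    rw [I.range_eq_univ, mfderivWithin_univ, (extChartAt I m₀).right_inv hz] at h1 h2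
    rw [VectorField.mpullback_apply, ContinuousLinearMap.inverse_eq h1 h2]
    rfl
  have hdiff : ∀ w : ∀ m : M, TangentSpace I m, SmoothVFOn I w univ →
      MDifferentiableAt I I.tangent (fun m => (⟨m, w m⟩ : TangentBundle I M))
        ((extChartAt I m₀).symm (extChartAt I m₀ m)) := fun w hw =>
    (ContMDiffOn.contMDiffAt hw univ_mem).mdifferentiableAt (by simp)
  have : IsManifold I (minSmoothness ℝ 2) M := by
    rw [minSmoothness_of_isRCLikeNormedField]
    exact IsManifold.of_le (n := ∞) ENat.LEInfty.out
  have key := VectorField.mpullback_mlieBracket (I := 𝓘(ℝ, E)) (I' := I) (n := ∞)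
    (f := (extChartAt I m₀).symm) (x₀ := extChartAt I m₀ m) (hdiff u hu) (hdiff v hv)
    ((contMDiffOn_extChartAt_symm (n := ∞) m₀).contMDiffAt
      ((isOpen_extChartAt_target m₀).mem_nhds hz))
    (by rw [minSmoothness_of_isRCLikeNormedField]; exact ENat.LEInfty.out)
  have hev : ∀ w : ∀ m : M, TangentSpace I m,
      VectorField.mpullback 𝓘(ℝ, E) I (extChartAt I m₀).symm w =ᶠ[𝓝 (extChartAt I m₀ m)]
        chartCoord I m₀ w := fun w =>
    eventually_of_mem ((isOpen_extChartAt_target m₀).mem_nhds hz) fun z hz => hinv w z hz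
  rw [(hev u).mlieBracket_vectorField_eq (hev v), hinv _ _ hz, chartCoord_apply hm] at key
  have hflat : VectorField.mlieBracket 𝓘(ℝ, E) (chartCoord I m₀ u) (chartCoord I m₀ v) =
      VectorField.lieBracket ℝ (chartCoord I m₀ u) (chartCoord I m₀ v) :=
    VectorField.mlieBracketWithin_univ.symm.trans
      (VectorField.mlieBracketWithin_eq_lieBracketWithin.trans VectorField.lieBracketWithin_univ)
  refine key.trans ?_
  rw [hflat, VectorField.lieBracket_eq]
  simp only [chartCoord_apply hm]
  rfl

end VectorFields

/-! ### Adapted charts of the total space -/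

section TotalSpaceCharts

set_option linter.unusedSectionVars false

variable {EB : Type*} [NormedAddCommGroup EB] [NormedSpace ℝ EB]
  {B : Type*} [TopologicalSpace B] [ChartedSpace EB B]
  {Fib : Type*} [NormedAddCommGroup Fib] [NormedSpace ℝ Fib]
  {V : B → Type*} [TopologicalSpace (TotalSpace Fib V)]
  [∀ b, AddCommGroup (V b)] [∀ b, Module ℝ (V b)] [∀ b, TopologicalSpace (V b)]
  [FiberBundle Fib V]

theorem proj_mem_extChartAt_source {m₀ m : TotalSpace Fib V}
    (hm : m ∈ (extChartAt (𝓘(ℝ, EB).prod 𝓘(ℝ, Fib)) m₀).source) :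
    m.proj ∈ (extChartAt 𝓘(ℝ, EB) m₀.proj).source := by
  rw [FiberBundle.extChartAt, PartialEquiv.trans_source] at hm
  have h1 := hm.2.1
  have h2 : m ∈ (trivializationAt Fib V m₀.proj).source := hm.1
  have h3 := (trivializationAt Fib V m₀.proj).coe_fst h2
  change ((trivializationAt Fib V m₀.proj) m).1 ∈ _ at h1
  rwa [h3] at h1

theorem extChartAt_fst {m₀ m : TotalSpace Fib V}
    (hm : m ∈ (extChartAt (𝓘(ℝ, EB).prod 𝓘(ℝ, Fib)) m₀).source) :
    (extChartAt (𝓘(ℝ, EB).prod 𝓘(ℝ, Fib)) m₀ m).1 = extChartAt 𝓘(ℝ, EB) m₀.proj m.proj := by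
  rw [FiberBundle.extChartAt, PartialEquiv.trans_source] at hm
  have h2 : m ∈ (trivializationAt Fib V m₀.proj).source := hm.1
  have h3 := (trivializationAt Fib V m₀.proj).coe_fst h2
  rw [FiberBundle.extChartAt]
  change extChartAt 𝓘(ℝ, EB) m₀.proj ((trivializationAt Fib V m₀.proj) m).1 = _
  rw [h3]

variable [IsManifold 𝓘(ℝ, EB) ∞ B] [VectorBundle ℝ Fib V] [ContMDiffVectorBundle ∞ Fib V 𝓘(ℝ, EB)]

theorem hasMFDerivAt_proj (m : TotalSpace Fib V) :
    HasMFDerivAt (𝓘(ℝ, EB).prod 𝓘(ℝ, Fib)) 𝓘(ℝ, EB) (fun x : TotalSpace Fib V => x.proj) m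
      (dproj EB m) :=
  ((contMDiff_proj (n := ∞) V).contMDiffAt.mdifferentiableAt (by simp)).hasMFDerivAt

theorem chartDeriv_fst {m₀ m : TotalSpace Fib V}
    (hm : m ∈ (extChartAt (𝓘(ℝ, EB).prod 𝓘(ℝ, Fib)) m₀).source) (v : TE EB m) :
    (chartDeriv (𝓘(ℝ, EB).prod 𝓘(ℝ, Fib)) m₀ m v).1 =
      chartDeriv 𝓘(ℝ, EB) m₀.proj m.proj (dproj EB m v) := by
  have h1 := HasMFDerivAt.comp (g := (Prod.fst : EB × Fib → EB)) m
    (ContinuousLinearMap.fst ℝ EB Fib).hasFDerivAt.hasMFDerivAt (hasMFDerivAt_extChartAt' hm)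
  have h2 := HasMFDerivAt.comp (g := extChartAt 𝓘(ℝ, EB) m₀.proj) m
    (hasMFDerivAt_extChartAt' (proj_mem_extChartAt_source hm)) (hasMFDerivAt_proj m)
  have h3 : (Prod.fst ∘ extChartAt (𝓘(ℝ, EB).prod 𝓘(ℝ, Fib)) m₀) =ᶠ[𝓝 m]
      (extChartAt 𝓘(ℝ, EB) m₀.proj ∘ fun x : TotalSpace Fib V => x.proj) := by
    filter_upwards [(isOpen_extChartAt_source m₀).mem_nhds hm] with y hy
    exact extChartAt_fst hy
  exact DFunLike.congr_fun (hasMFDerivAt_unique h1 (h2.congr_of_eventuallyEq h3)) v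

theorem hasMFDerivAt_zeroSection (b : B) :
    HasMFDerivAt 𝓘(ℝ, EB) (𝓘(ℝ, EB).prod 𝓘(ℝ, Fib)) (zeroSection Fib V) b
      (mfderiv 𝓘(ℝ, EB) (𝓘(ℝ, EB).prod 𝓘(ℝ, Fib)) (zeroSection Fib V) b) :=
  ((contMDiff_zeroSection (n := ∞) ℝ V).contMDiffAt.mdifferentiableAt (by simp)).hasMFDerivAt

theorem dproj_mfderiv_zeroSection (b : B) (u : TangentSpace 𝓘(ℝ, EB) b) :
    dproj EB (zeroSection Fib V b)
      (mfderiv 𝓘(ℝ, EB) (𝓘(ℝ, EB).prod 𝓘(ℝ, Fib)) (zeroSection Fib V) b u) = u := by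
  have h1 := HasMFDerivAt.comp (g := fun x : TotalSpace Fib V => x.proj) b
    (hasMFDerivAt_proj (EB := EB) (zeroSection Fib V b)) (hasMFDerivAt_zeroSection b)
  exact DFunLike.congr_fun (hasMFDerivAt_unique h1 (hasMFDerivAt_id b)) u

/-- The `1`-form `Q ∘ dπ` on the total space, in the chart at `m₀`. -/
def chartForm (Q : Form1 EB Fib V) (m₀ : TotalSpace Fib V) (z : EB × Fib) : EB × Fib →L[ℝ] ℝ :=
  ((Q ((extChartAt (𝓘(ℝ, EB).prod 𝓘(ℝ, Fib)) m₀).symm z)).comp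
    (chartDeriv 𝓘(ℝ, EB) m₀.proj
      ((extChartAt (𝓘(ℝ, EB).prod 𝓘(ℝ, Fib)) m₀).symm z).proj).inverse).comp
    (ContinuousLinearMap.fst ℝ EB Fib)

theorem chartForm_apply (Q : Form1 EB Fib V) {m₀ m : TotalSpace Fib V}
    (hm : m ∈ (extChartAt (𝓘(ℝ, EB).prod 𝓘(ℝ, Fib)) m₀).source) (x : EB × Fib) :
    chartForm Q m₀ (extChartAt (𝓘(ℝ, EB).prod 𝓘(ℝ, Fib)) m₀ m) x =
      Q m (chartField 𝓘(ℝ, EB) m₀.proj x.1 m.proj) := by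
  have h : (extChartAt (𝓘(ℝ, EB).prod 𝓘(ℝ, Fib)) m₀).symm
      (extChartAt (𝓘(ℝ, EB).prod 𝓘(ℝ, Fib)) m₀ m) = m :=
    (extChartAt (𝓘(ℝ, EB).prod 𝓘(ℝ, Fib)) m₀).left_inv hm
  unfold chartForm
  rw [h]
  rfl

theorem chartForm_chartDeriv (Q : Form1 EB Fib V) {m₀ m : TotalSpace Fib V}
    (hm : m ∈ (extChartAt (𝓘(ℝ, EB).prod 𝓘(ℝ, Fib)) m₀).source) (v : TE EB m) :
    chartForm Q m₀ (extChartAt (𝓘(ℝ, EB).prod 𝓘(ℝ, Fib)) m₀ m)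
      (chartDeriv (𝓘(ℝ, EB).prod 𝓘(ℝ, Fib)) m₀ m v) = Q m (dproj EB m v) := by
  rw [chartForm_apply Q hm, chartDeriv_fst hm,
    chartField_chartDeriv (proj_mem_extChartAt_source hm)]

theorem contDiffOn_chartForm [FiniteDimensional ℝ EB] [FiniteDimensional ℝ Fib]
    {Q : Form1 EB Fib V} {N : Set (TotalSpace Fib V)} (hQ : Q.SmoothOn N)
    (m₀ : TotalSpace Fib V) :
    ContDiffOn ℝ ∞ (chartForm Q m₀)
      ((extChartAt (𝓘(ℝ, EB).prod 𝓘(ℝ, Fib)) m₀).target ∩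
        (extChartAt (𝓘(ℝ, EB).prod 𝓘(ℝ, Fib)) m₀).symm ⁻¹' N) := by
  rw [contDiffOn_clm_apply]
  intro x
  have h1 := hQ _ (isOpen_extChartAt_source (I := 𝓘(ℝ, EB)) m₀.proj) _
    (smoothVFOn_chartField (I := 𝓘(ℝ, EB)) m₀.proj x.1)
  have h2 : ContMDiffOn (𝓘(ℝ, EB).prod 𝓘(ℝ, Fib)) 𝓘(ℝ, ℝ) ∞
      (Q.eval (chartField 𝓘(ℝ, EB) m₀.proj x.1))
      ((extChartAt (𝓘(ℝ, EB).prod 𝓘(ℝ, Fib)) m₀).source ∩ N) :=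
    h1.mono fun m hm => ⟨hm.2, proj_mem_extChartAt_source hm.1⟩
  exact contDiffOn_comp_chart_symm m₀ h2

theorem eval_chart (Q : Form1 EB Fib V) {m₀ m : TotalSpace Fib V}
    (hm : m ∈ (extChartAt (𝓘(ℝ, EB).prod 𝓘(ℝ, Fib)) m₀).source)
    (u : ∀ b : B, TangentSpace 𝓘(ℝ, EB) b) :
    Q.eval u m = chartForm Q m₀ (extChartAt (𝓘(ℝ, EB).prod 𝓘(ℝ, Fib)) m₀ m)
      (chartCoord 𝓘(ℝ, EB) m₀.proj u (extChartAt (𝓘(ℝ, EB).prod 𝓘(ℝ, Fib)) m₀ m).1, 0) := by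
  have hp := proj_mem_extChartAt_source hm
  rw [chartForm_apply Q hm, extChartAt_fst hm, chartCoord_apply hp, chartField_chartDeriv hp]
  rfl

/-- Cartan's formula for the differential of the `1`-form `Q ∘ dπ`, evaluated on vectors that
project to the values of vector fields on the base. -/
theorem extD_chartForm [FiniteDimensional ℝ EB] [FiniteDimensional ℝ Fib]
    {Q : Form1 EB Fib V} {N : Set (TotalSpace Fib V)} (hN : IsOpen N) (hQ : Q.SmoothOn N)
    {m₀ m : TotalSpace Fib V} (hm : m ∈ (extChartAt (𝓘(ℝ, EB).prod 𝓘(ℝ, Fib)) m₀).source)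
    (hmN : m ∈ N) {u₀ u₁ : ∀ b : B, TangentSpace 𝓘(ℝ, EB) b}
    (hu₀ : SmoothVFOn 𝓘(ℝ, EB) u₀ univ) (hu₁ : SmoothVFOn 𝓘(ℝ, EB) u₁ univ) {v₀ v₁ : TE EB m}
    (hv₀ : dproj EB m v₀ = u₀ m.proj) (hv₁ : dproj EB m v₁ = u₁ m.proj) :
    extD (chartForm Q m₀) (extChartAt (𝓘(ℝ, EB).prod 𝓘(ℝ, Fib)) m₀ m)
        (chartDeriv (𝓘(ℝ, EB).prod 𝓘(ℝ, Fib)) m₀ m v₀)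
        (chartDeriv (𝓘(ℝ, EB).prod 𝓘(ℝ, Fib)) m₀ m v₁) =
      mvfderiv (𝓘(ℝ, EB).prod 𝓘(ℝ, Fib)) (Q.eval u₁) m v₀ -
        mvfderiv (𝓘(ℝ, EB).prod 𝓘(ℝ, Fib)) (Q.eval u₀) m v₁ -
        Q.eval (VectorField.mlieBracket 𝓘(ℝ, EB) u₀ u₁) m := by
  have : CompleteSpace EB := FiniteDimensional.complete ℝ EB
  set J := 𝓘(ℝ, EB).prod 𝓘(ℝ, Fib) with hJ
  set z := extChartAt J m₀ m with hz
  have hp := proj_mem_extChartAt_source hm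
  have hzt : z ∈ (extChartAt J m₀).target := (extChartAt J m₀).map_source hm
  have hzs : (extChartAt J m₀).symm z = m := (extChartAt J m₀).left_inv hm
  have hθ : DifferentiableAt ℝ (chartForm Q m₀) z :=
    ((contDiffOn_chartForm hQ m₀).contDiffAt ((isOpen_chart_preimage hN m₀).mem_nhds
      ⟨hzt, by rw [mem_preimage, hzs]; exact hmN⟩)).differentiableAt (by simp)
  have hz1 : z.1 = extChartAt 𝓘(ℝ, EB) m₀.proj m.proj := extChartAt_fst hm
  have hfst : ∀ v : TE EB m, (chartDeriv J m₀ m v).1 =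
      chartDeriv 𝓘(ℝ, EB) m₀.proj m.proj (dproj EB m v) := chartDeriv_fst hm
  have key : ∀ u : ∀ b : B, TangentSpace 𝓘(ℝ, EB) b, SmoothVFOn 𝓘(ℝ, EB) u univ →
      ∀ v w : TE EB m, dproj EB m w = u m.proj →
      mvfderiv J (Q.eval u) m v =
        fderiv ℝ (chartForm Q m₀) z (chartDeriv J m₀ m v) (chartDeriv J m₀ m w) +
          chartForm Q m₀ z (fderiv ℝ (chartCoord 𝓘(ℝ, EB) m₀.proj u) z.1
            (chartDeriv 𝓘(ℝ, EB) m₀.proj m.proj (dproj EB m v)), 0) := by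
    intro u hu v w hw
    have hc : DifferentiableAt ℝ (chartCoord 𝓘(ℝ, EB) m₀.proj u) z.1 := by
      rw [hz1]
      exact ((contDiffOn_chartCoord hu m₀.proj).contDiffAt
        ((isOpen_extChartAt_target m₀.proj).mem_nhds
          ((extChartAt 𝓘(ℝ, EB) m₀.proj).map_source hp))).differentiableAt (by simp)
    have h1 : HasFDerivAt (fun y : EB × Fib =>
        ((chartCoord 𝓘(ℝ, EB) m₀.proj u y.1, 0) : EB × Fib))
        (((fderiv ℝ (chartCoord 𝓘(ℝ, EB) m₀.proj u) z.1).comp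
          (ContinuousLinearMap.fst ℝ EB Fib)).prod (0 : EB × Fib →L[ℝ] Fib)) z :=
      (HasFDerivAt.comp (g := chartCoord 𝓘(ℝ, EB) m₀.proj u) z hc.hasFDerivAt
        (ContinuousLinearMap.fst ℝ EB Fib).hasFDerivAt).prodMk (hasFDerivAt_const _ _)
    have h2 := hθ.hasFDerivAt.clm_apply h1
    have h3 := mvfderiv_comp_extChartAt hm h2.differentiableAt (f := Q.eval u)
      (eventually_of_mem ((isOpen_extChartAt_source m₀).mem_nhds hm)
        fun y hy => eval_chart Q hy u) v
    have h4 : ∀ x : EB × Fib, chartForm Q m₀ z x = chartForm Q m₀ z (x.1, 0) := fun _ => rfl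
    have h5 : fderiv ℝ (chartForm Q m₀) z (chartDeriv J m₀ m v)
        (chartCoord 𝓘(ℝ, EB) m₀.proj u z.1, 0) =
        fderiv ℝ (chartForm Q m₀) z (chartDeriv J m₀ m v) (chartDeriv J m₀ m w) := by
      -- the form only involves the first component, hence so does its derivative
      have h6 : ∀ x y : EB × Fib, x.1 = y.1 → ∀ d, fderiv ℝ (chartForm Q m₀) z d x =
          fderiv ℝ (chartForm Q m₀) z d y := by
        intro x y hxy d
        have h7 : ∀ x, HasFDerivAt (fun z' => chartForm Q m₀ z' x)
            ((ContinuousLinearMap.apply ℝ ℝ x).comp (fderiv ℝ (chartForm Q m₀) z)) z := fun x =>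
          (ContinuousLinearMap.apply ℝ ℝ x).hasFDerivAt.comp z hθ.hasFDerivAt
        have h8 : (fun z' => chartForm Q m₀ z' x) = fun z' => chartForm Q m₀ z' y := by
          funext z'
          simp only [chartForm, ContinuousLinearMap.comp_apply, ContinuousLinearMap.coe_fst', hxy]
        have h9 := (h7 x).unique (h8 ▸ h7 y)
        exact DFunLike.congr_fun h9 d
      apply h6
      rw [hfst, hw, hz1, chartCoord_apply hp]
    rw [h3, h2.fderiv, ← h5]
    simp [hfst, add_comm]
  have hbr : Q.eval (VectorField.mlieBracket 𝓘(ℝ, EB) u₀ u₁) m =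
      chartForm Q m₀ z (fderiv ℝ (chartCoord 𝓘(ℝ, EB) m₀.proj u₁) z.1
          (chartDeriv 𝓘(ℝ, EB) m₀.proj m.proj (u₀ m.proj)), 0) -
        chartForm Q m₀ z (fderiv ℝ (chartCoord 𝓘(ℝ, EB) m₀.proj u₀) z.1
          (chartDeriv 𝓘(ℝ, EB) m₀.proj m.proj (u₁ m.proj)), 0) := by
    rw [eval_chart Q hm, ← hz, hz1, chartCoord_apply hp, chartDeriv_mlieBracket hu₀ hu₁ hp,
      ← map_sub, Prod.mk_sub_mk, sub_zero]
  rw [hbr, key u₁ hu₁ v₀ v₁ hv₁, key u₀ hu₀ v₁ v₀ hv₀, hv₀, hv₁, extD_apply]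
  ring

end TotalSpaceCharts

/-! ### The exact form attached to a 1-form with values in functions -/

section DForm

set_option linter.unusedSectionVars false

variable {EB : Type*} [NormedAddCommGroup EB] [NormedSpace ℝ EB] [FiniteDimensional ℝ EB]
  {B : Type*} [TopologicalSpace B] [ChartedSpace EB B] [IsManifold 𝓘(ℝ, EB) ∞ B] [T2Space B]
  {Fib : Type*} [NormedAddCommGroup Fib] [NormedSpace ℝ Fib] [FiniteDimensional ℝ Fib]
  {V : B → Type*} [TopologicalSpace (TotalSpace Fib V)]
  [∀ b, AddCommGroup (V b)] [∀ b, Module ℝ (V b)] [∀ b, TopologicalSpace (V b)]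
  [FiberBundle Fib V] [VectorBundle ℝ Fib V] [ContMDiffVectorBundle ∞ Fib V 𝓘(ℝ, EB)]

/-- The differential at `m` of the `1`-form `Q ∘ dπ` on the total space, computed in the chart
at `m`, which identifies the tangent space at `m` with the model space. -/
def dForm (Q : Form1 EB Fib V) (m : TotalSpace Fib V) : EB × Fib →L[ℝ] EB × Fib →L[ℝ] ℝ :=
  extD (chartForm Q m) (extChartAt (𝓘(ℝ, EB).prod 𝓘(ℝ, Fib)) m m)

theorem chartDeriv_self (m : TotalSpace Fib V) (v : TE EB m) :
    chartDeriv (𝓘(ℝ, EB).prod 𝓘(ℝ, Fib)) m m v = v := by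
  rw [chartDeriv, mfderiv_extChartAt_self]
  rfl

variable {Q : Form1 EB Fib V} {N : Set (TotalSpace Fib V)}

/-- Cartan's formula for `dForm Q`. -/
theorem dForm_apply (hN : IsOpen N) (hQ : Q.SmoothOn N) {m : TotalSpace Fib V} (hm : m ∈ N)
    {u₀ u₁ : ∀ b : B, TangentSpace 𝓘(ℝ, EB) b}
    (hu₀ : SmoothVFOn 𝓘(ℝ, EB) u₀ univ) (hu₁ : SmoothVFOn 𝓘(ℝ, EB) u₁ univ) {v₀ v₁ : TE EB m}
    (hv₀ : dproj EB m v₀ = u₀ m.proj) (hv₁ : dproj EB m v₁ = u₁ m.proj) :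
    dForm Q m v₀ v₁ =
      mvfderiv (𝓘(ℝ, EB).prod 𝓘(ℝ, Fib)) (Q.eval u₁) m v₀ -
        mvfderiv (𝓘(ℝ, EB).prod 𝓘(ℝ, Fib)) (Q.eval u₀) m v₁ -
        Q.eval (VectorField.mlieBracket 𝓘(ℝ, EB) u₀ u₁) m := by
  have h := extD_chartForm hN hQ (mem_extChartAt_source m) hm hu₀ hu₁ hv₀ hv₁
  rwa [chartDeriv_self, chartDeriv_self] at h

/-- The form `dForm Q m` does not depend on the chart. -/
theorem extD_chartForm_eq_dForm (hN : IsOpen N) (hQ : Q.SmoothOn N) {m₀ m : TotalSpace Fib V}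
    (hm : m ∈ (extChartAt (𝓘(ℝ, EB).prod 𝓘(ℝ, Fib)) m₀).source) (hmN : m ∈ N) (v w : TE EB m) :
    extD (chartForm Q m₀) (extChartAt (𝓘(ℝ, EB).prod 𝓘(ℝ, Fib)) m₀ m)
        (chartDeriv (𝓘(ℝ, EB).prod 𝓘(ℝ, Fib)) m₀ m v)
        (chartDeriv (𝓘(ℝ, EB).prod 𝓘(ℝ, Fib)) m₀ m w) = dForm Q m v w := by
  obtain ⟨u₀, hu₀, e₀⟩ := exists_smoothVF_eq (I := 𝓘(ℝ, EB)) (dproj EB m v)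
  obtain ⟨u₁, hu₁, e₁⟩ := exists_smoothVF_eq (I := 𝓘(ℝ, EB)) (dproj EB m w)
  rw [extD_chartForm hN hQ hm hmN hu₀ hu₁ e₀.symm e₁.symm,
    dForm_apply hN hQ hmN hu₀ hu₁ e₀.symm e₁.symm]

theorem dForm_skew (Q : Form1 EB Fib V) (m : TotalSpace Fib V) (x y : EB × Fib) :
    dForm Q m x y = -dForm Q m y x :=
  extD_skew _ _ _ _

theorem smoothVFOn_zero :
    SmoothVFOn 𝓘(ℝ, EB) (0 : ∀ b : B, TangentSpace 𝓘(ℝ, EB) b) univ :=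
  (contMDiff_zeroSection ℝ (TangentSpace 𝓘(ℝ, EB) : B → Type _)).contMDiffOn

theorem mvfderiv_eval_zero (Q : Form1 EB Fib V) (m : TotalSpace Fib V) (v : TE EB m) :
    mvfderiv (𝓘(ℝ, EB).prod 𝓘(ℝ, Fib)) (Q.eval 0) m v = 0 := by
  have h : Q.eval (0 : ∀ b : B, TangentSpace 𝓘(ℝ, EB) b) = fun _ => 0 := by
    funext m
    exact map_zero (Q m)
  rw [h]
  simp [mvfderiv_const]

/-- On vertical vectors, the differential of the function `Q(u)` is the contraction of `-dForm Q`
with any vector that projects to `u`. -/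
theorem mvfderiv_eval_vert (hN : IsOpen N) (hQ : Q.SmoothOn N) {m : TotalSpace Fib V} (hm : m ∈ N)
    {u : ∀ b : B, TangentSpace 𝓘(ℝ, EB) b} (hu : SmoothVFOn 𝓘(ℝ, EB) u univ) {v w : TE EB m}
    (hv : dproj EB m v = u m.proj) (hw : dproj EB m w = 0) :
    mvfderiv (𝓘(ℝ, EB).prod 𝓘(ℝ, Fib)) (Q.eval u) m w = -dForm Q m v w := by
  have h := dForm_apply hN hQ hm hu smoothVFOn_zero hv (v₁ := w) hw
  rw [mvfderiv_eval_zero, VectorField.mlieBracket_zero_right] at h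
  have h0 : Q.eval (0 : ∀ b : B, TangentSpace 𝓘(ℝ, EB) b) m = 0 := map_zero (Q m)
  rw [h0] at h
  rw [h]
  ring

theorem dForm_vert (hN : IsOpen N) (hQ : Q.SmoothOn N) {m : TotalSpace Fib V} (hm : m ∈ N)
    (v w : TE EB m) (hv : dproj EB m v = 0) (hw : dproj EB m w = 0) : dForm Q m v w = 0 := by
  have h := mvfderiv_eval_vert hN hQ hm smoothVFOn_zero (v := v) hv hw
  rw [mvfderiv_eval_zero] at h
  linarith

theorem covDeriv_eq_dForm (hN : IsOpen N) (hQ : Q.SmoothOn N) {m : TotalSpace Fib V} (hm : m ∈ N)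
    {hor : HorLift EB Fib V} (hlift : ∀ u : TB EB m, dproj EB m (hor m u) = u)
    {u₀ u₁ : ∀ b : B, TangentSpace 𝓘(ℝ, EB) b}
    (hu₀ : SmoothVFOn 𝓘(ℝ, EB) u₀ univ) (hu₁ : SmoothVFOn 𝓘(ℝ, EB) u₁ univ) :
    covDeriv hor Q u₀ u₁ m = dForm Q m (hor m (u₀ m.proj)) (hor m (u₁ m.proj)) :=
  (dForm_apply hN hQ hm hu₀ hu₁ (hlift _) (hlift _)).symm

/-- As `Q` vanishes along the zero section, `dForm Q` vanishes on its tangent vectors. -/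
theorem dForm_zeroSection (hN : IsOpen N) (hQ : Q.SmoothOn N) (hQ0 : Q.VanishesOnBase) {b : B}
    (hb : zeroSection Fib V b ∈ N) (u v : TangentSpace 𝓘(ℝ, EB) b) :
    dForm Q (zeroSection Fib V b)
      (mfderiv 𝓘(ℝ, EB) (𝓘(ℝ, EB).prod 𝓘(ℝ, Fib)) (zeroSection Fib V) b u)
      (mfderiv 𝓘(ℝ, EB) (𝓘(ℝ, EB).prod 𝓘(ℝ, Fib)) (zeroSection Fib V) b v) = 0 := by
  obtain ⟨u₀, hu₀, e₀⟩ := exists_smoothVF_eq (I := 𝓘(ℝ, EB)) u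
  obtain ⟨u₁, hu₁, e₁⟩ := exists_smoothVF_eq (I := 𝓘(ℝ, EB)) v
  have hz : ∀ c : B, Q (zeroSection Fib V c) = 0 := fun c => hQ0 _ (mem_range_self c)
  have key : ∀ w : ∀ b : B, TangentSpace 𝓘(ℝ, EB) b, SmoothVFOn 𝓘(ℝ, EB) w univ →
      ∀ x : TangentSpace 𝓘(ℝ, EB) b,
      mvfderiv (𝓘(ℝ, EB).prod 𝓘(ℝ, Fib)) (Q.eval w) (zeroSection Fib V b)
        (mfderiv 𝓘(ℝ, EB) (𝓘(ℝ, EB).prod 𝓘(ℝ, Fib)) (zeroSection Fib V) b x) = 0 := by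
    intro w hw x
    have h1 : MDifferentiableAt (𝓘(ℝ, EB).prod 𝓘(ℝ, Fib)) 𝓘(ℝ, ℝ) (Q.eval w)
        (zeroSection Fib V b) :=
      ((hQ univ isOpen_univ w hw).contMDiffAt (by
        simpa using hN.mem_nhds hb)).mdifferentiableAt (by simp)
    have h2 := HasMFDerivAt.comp (g := Q.eval w) b h1.hasMFDerivAt
      (hasMFDerivAt_zeroSection (EB := EB) b)
    have h3 : (Q.eval w ∘ zeroSection Fib V) = fun _ => (0 : ℝ) := by
      funext c
      change Q (zeroSection Fib V c) (w c) = 0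
      rw [hz]
      rfl
    rw [h3] at h2
    exact DFunLike.congr_fun (hasMFDerivAt_unique h2 (hasMFDerivAt_const (0 : ℝ) b)) x
  rw [dForm_apply hN hQ hb hu₀ hu₁ ((dproj_mfderiv_zeroSection b u).trans e₀.symm)
    ((dproj_mfderiv_zeroSection b v).trans e₁.symm), key u₁ hu₁, key u₀ hu₀]
  have h0 : Q.eval (VectorField.mlieBracket 𝓘(ℝ, EB) u₀ u₁) (zeroSection Fib V b) = 0 := by
    change Q (zeroSection Fib V b) _ = 0
    rw [hz]
    rfl
  rw [h0]
  ring

variable {P Ups : BivectorField (𝓘(ℝ, EB).prod 𝓘(ℝ, Fib)) (TotalSpace Fib V)}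
  {hor : HorLift EB Fib V} {F : Form2 EB Fib V} {S : Set (TotalSpace Fib V)}

/-- At each point, geometric data are linear data for the differential of the projection. -/
theorem IsGeometricDataOn.isLinearCoupling (h : IsGeometricDataOn P Ups hor F S)
    {m : TotalSpace Fib V} (hm : m ∈ S) :
    IsLinearCoupling (E := EB × Fib) (B := EB) (dproj EB m) (P.sharp m) (Ups.sharp m) (hor m)
      (F m) where
  skew := P.skew m
  lift := h.lift m hm
  exists_hor_eq u := by
    have h1 : hor m u ∈ horSpace P m := by
      rw [← h.horizontal m hm]
      exact LinearMap.mem_range_self (hor m).toLinearMap u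
    obtain ⟨β, hβ, e⟩ := Submodule.mem_map.1 h1
    exact ⟨β, hβ, e⟩
  exists_eq_hor β hβ := by
    have h1 : P.sharp m β ∈ horSpace P m := Submodule.mem_map_of_mem (f := (P.sharp m).toLinearMap)
      (show β ∈ vertAnn EB m from hβ)
    rw [← h.horizontal m hm] at h1
    exact h1
  vertical := h.vertical m hm
  form β₁ h₁ β₂ h₂ := h.form m hm β₁ h₁ β₂ h₂

/-- The Hamiltonian field of `Q(u)` only involves the vertical part of the differential of `Q(u)`,
which is a contraction of `dForm Q`. -/
theorem ham_eval (h : IsGeometricDataOn P Ups hor F N) (hN : IsOpen N) (hQ : Q.SmoothOn N)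
    {m : TotalSpace Fib V} (hm : m ∈ N)
    {u : ∀ b : B, TangentSpace 𝓘(ℝ, EB) b} (hu : SmoothVFOn 𝓘(ℝ, EB) u univ) :
    Ups.ham (Q.eval u) m = -Ups.sharp m (dForm Q m (hor m (u m.proj))) := by
  set α : EB × Fib →L[ℝ] ℝ := mvfderiv (𝓘(ℝ, EB).prod 𝓘(ℝ, Fib)) (Q.eval u) m with hα
  set β : EB × Fib →L[ℝ] ℝ := dForm Q m (hor m (u m.proj)) with hβ
  set L : (EB × Fib →L[ℝ] ℝ) →L[ℝ] EB × Fib := Ups.sharp m with hL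
  have h1 : L (α + β) = 0 := (h.isLinearCoupling hm).vert_annihilator fun w hw => by
    have h2 : α w = -β w := mvfderiv_eval_vert hN hQ hm hu (h.lift m hm (u m.proj)) (w := w) hw
    rw [add_apply, h2, neg_add_cancel]
  rw [map_add] at h1
  exact eq_neg_of_add_eq_zero_left h1

theorem bracket_eval (h : IsGeometricDataOn P Ups hor F N) (hN : IsOpen N) (hQ : Q.SmoothOn N)
    {m : TotalSpace Fib V} (hm : m ∈ N) {u₀ u₁ : ∀ b : B, TangentSpace 𝓘(ℝ, EB) b}
    (hu₀ : SmoothVFOn 𝓘(ℝ, EB) u₀ univ) (hu₁ : SmoothVFOn 𝓘(ℝ, EB) u₁ univ) :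
    Ups.bracket (Q.eval u₀) (Q.eval u₁) m =
      dForm Q m (hor m (u₁ m.proj)) (Ups.sharp m (dForm Q m (hor m (u₀ m.proj)))) := by
  have h2 := (h.isLinearCoupling hm).proj_vert (dForm Q m (hor m (u₀ m.proj)))
  have h3 : ∀ w : TE EB m, mvfderiv (𝓘(ℝ, EB).prod 𝓘(ℝ, Fib)) (Q.eval u₁) m (-w) =
      -mvfderiv (𝓘(ℝ, EB).prod 𝓘(ℝ, Fib)) (Q.eval u₁) m w := map_neg _
  have h4 : Ups.bracket (Q.eval u₀) (Q.eval u₁) m =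
      mvfderiv (𝓘(ℝ, EB).prod 𝓘(ℝ, Fib)) (Q.eval u₁) m
      (-Ups.sharp m (dForm Q m (hor m (u₀ m.proj)))) :=
    congrArg (mvfderiv (𝓘(ℝ, EB).prod 𝓘(ℝ, Fib)) (Q.eval u₁) m) (ham_eval h hN hQ hm hu₀)
  exact (h4.trans (h3 _)).trans (neg_eq_iff_eq_neg.2
    (mvfderiv_eval_vert hN hQ hm hu₁ (h.lift m hm (u₁ m.proj)) h2))

theorem wedgeBracket_eq_dForm (h : IsGeometricDataOn P Ups hor F N) (hN : IsOpen N)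
    (hQ : Q.SmoothOn N) {m : TotalSpace Fib V} (hm : m ∈ N)
    {u₀ u₁ : ∀ b : B, TangentSpace 𝓘(ℝ, EB) b}
    (hu₀ : SmoothVFOn 𝓘(ℝ, EB) u₀ univ) (hu₁ : SmoothVFOn 𝓘(ℝ, EB) u₁ univ) :
    wedgeBracket Ups Q Q u₀ u₁ m =
      2 * dForm Q m (hor m (u₁ m.proj)) (Ups.sharp m (dForm Q m (hor m (u₀ m.proj)))) := by
  have h1 := (h.isLinearCoupling hm).vert_skew (dForm Q m (hor m (u₀ m.proj)))
    (dForm Q m (hor m (u₁ m.proj)))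
  have h2 : ∀ x y : ℝ, x = -y → x - y = 2 * x := fun x y hxy => by rw [hxy]; ring
  exact (congrArg₂ (· - ·) (bracket_eval h hN hQ hm hu₀ hu₁)
    (bracket_eval h hN hQ hm hu₁ hu₀)).trans (h2 _ _ h1)

end DForm

/-! ### Conjugation and scaling of gauge transformations -/

section Conjugation

variable {E : Type*} [NormedAddCommGroup E] [NormedSpace ℝ E]
  {Λ Λ' : (E →L[ℝ] ℝ) →L[ℝ] E} {D D' : E →L[ℝ] E →L[ℝ] ℝ} {a : E →L[ℝ] E}

/-- Gauge operators of bivectors and forms that are related by `a` are related by its transpose. -/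
theorem gaugeOp_conj (hΛ : ∀ α : E →L[ℝ] ℝ, Λ' α = a (Λ (α.comp a)))
    (hD : ∀ v w, D' (a v) (a w) = D v w) (t : ℝ) (α : E →L[ℝ] ℝ) :
    (gaugeOp Λ' D' t α).comp a = gaugeOp Λ D t (α.comp a) := by
  ext v
  simp [gaugeOp_apply, hΛ, hD]

theorem isUnit_gaugeOp_conj (ha : a.IsInvertible)
    (hΛ : ∀ α : E →L[ℝ] ℝ, Λ' α = a (Λ (α.comp a))) (hD : ∀ v w, D' (a v) (a w) = D v w) (t : ℝ) :
    IsUnit (gaugeOp Λ' D' t) ↔ IsUnit (gaugeOp Λ D t) := by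
  obtain ⟨e, rfl⟩ := ha
  set T : ((E →L[ℝ] ℝ) →L[ℝ] (E →L[ℝ] ℝ))ˣ :=
    { val := transpose (e : E →L[ℝ] E)
      inv := transpose (e.symm : E →L[ℝ] E)
      val_inv := by ext α v; simp
      inv_val := by ext α v; simp } with hT
  have h : (T : (E →L[ℝ] ℝ) →L[ℝ] (E →L[ℝ] ℝ)) * gaugeOp Λ' D' t = gaugeOp Λ D t * T :=
    ContinuousLinearMap.ext fun α => gaugeOp_conj hΛ hD t α
  rw [← T.isUnit_units_mul, h, T.isUnit_mul_units]

theorem gauge_conj (hΛ : ∀ α : E →L[ℝ] ℝ, Λ' α = a (Λ (α.comp a)))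
    (hD : ∀ v w, D' (a v) (a w) = D v w) {t : ℝ} (h' : IsUnit (gaugeOp Λ' D' t))
    (h : IsUnit (gaugeOp Λ D t)) (α : E →L[ℝ] ℝ) :
    gauge Λ' D' t α = a (gauge Λ D t (α.comp a)) := by
  obtain ⟨β, rfl⟩ := exists_gaugeOp_eq h' α
  rw [gauge_gaugeOp_apply h', gaugeOp_conj hΛ hD, gauge_gaugeOp_apply h, hΛ]

/-- If `D` vanishes on the range of the bivector, the gauge transformation is defined. -/
theorem isUnit_gaugeOp_of_range [FiniteDimensional ℝ E]
    (hskew : ∀ α β : E →L[ℝ] ℝ, β (Λ α) = -α (Λ β)) (hD : ∀ α β, D (Λ α) (Λ β) = 0) (t : ℝ) :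
    IsUnit (gaugeOp Λ D t) := by
  have hinj : Function.Injective (gaugeOp Λ D t) := by
    rw [injective_iff_map_eq_zero]
    intro α hα
    rw [gaugeOp_apply] at hα
    have h1 : Λ α = 0 := by
      rw [SeparatingDual.eq_iff_forall_dual_eq (R := ℝ)]
      intro β
      have h2 := DFunLike.congr_fun hα (Λ β)
      simp only [add_apply, smul_apply, hD, smul_zero, add_zero, zero_apply] at h2
      rw [hskew, h2]
      simp
    simpa [h1] using hα
  set L := (LinearEquiv.ofInjectiveEndo (gaugeOp Λ D t).toLinearMap hinj).toContinuousLinearEquiv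
  have hL : (L : (E →L[ℝ] ℝ) →L[ℝ] (E →L[ℝ] ℝ)) = gaugeOp Λ D t := by
    ext; rfl
  rw [← hL]
  exact ⟨ContinuousLinearEquiv.toUnit L, rfl⟩

end Conjugation

namespace IsLinearCoupling

variable {E B : Type*} [NormedAddCommGroup E] [NormedSpace ℝ E] [NormedAddCommGroup B]
  [NormedSpace ℝ B] {p : E →L[ℝ] B} {Λ Υ : (E →L[ℝ] ℝ) →L[ℝ] E} {hor : B →L[ℝ] E}
  {F : B →L[ℝ] B →L[ℝ] ℝ} {D : E →L[ℝ] E →L[ℝ] ℝ}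

theorem gaugeHor_smul (t : ℝ) (u : B) :
    gaugeHor Υ hor (t • D) u = hor u + t • (-Υ (D (hor u))) := by
  rw [gaugeHor_apply, smul_apply, map_smul, smul_neg, sub_eq_add_neg]

theorem smul_skew (hD : ∀ x y, D x y = -D y x) (t : ℝ) (x y : E) :
    (t • D) x y = -(t • D) y x := by
  simp only [smul_apply, smul_eq_mul]
  rw [hD]
  ring

theorem smul_vert (hDv : ∀ x y, p x = 0 → p y = 0 → D x y = 0) (t : ℝ) (x y : E) (hx : p x = 0)
    (hy : p y = 0) : (t • D) x y = 0 := by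
  simp only [smul_apply, smul_eq_mul, hDv x y hx hy, mul_zero]

theorem gaugeForm_smul (hD : ∀ x y, D x y = -D y x) (t : ℝ) (u v : B) :
    gaugeForm Υ hor F (t • D) u v =
      F u v - (t * D (hor u) (hor v) + t ^ 2 / 2 * (2 * D (hor v) (Υ (D (hor u))))) := by
  rw [gaugeForm_eq (smul_skew hD t)]
  simp only [smul_apply, smul_eq_mul, map_smul]
  ring

/-- A coupling bivector whose data are the transformed ones is the gauge transform at time `1`. -/
theorem gauge_one_eq {Λ' : (E →L[ℝ] ℝ) →L[ℝ] E} {hor' : B →L[ℝ] E} {F' : B →L[ℝ] B →L[ℝ] ℝ}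
    (h : IsLinearCoupling p Λ Υ hor F) (h' : IsLinearCoupling p Λ' Υ hor' F')
    (hD : ∀ x y, D x y = -D y x) (hDv : ∀ x y, p x = 0 → p y = 0 → D x y = 0)
    (hu : IsUnit (gaugeOp Λ D 1)) (hh : ∀ u, hor' u = hor u - Υ (D (hor u)))
    (hF : ∀ u v, F' u v = F u v - (D (hor u) (hor v) + D (hor v) (Υ (D (hor u)))))
    (α : E →L[ℝ] ℝ) : gauge Λ D 1 α = Λ' α := by
  obtain ⟨β, rfl⟩ := exists_gaugeOp_eq hu α
  rw [gauge_gaugeOp_apply hu, gaugeOp_apply, one_smul]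
  exact (h.sharp_gaugeOp hD hDv h' hh (fun u v => (hF u v).trans (gaugeForm_eq hD u v).symm)
    β).symm

theorem gaugeForm_smul_nondegenerate (h : IsLinearCoupling p Λ Υ hor F)
    (hD : ∀ x y, D x y = -D y x) (hDv : ∀ x y, p x = 0 → p y = 0 → D x y = 0) {t : ℝ}
    (hu : IsUnit (gaugeOp Λ D t)) {v : B} (hv : ∀ w, gaugeForm Υ hor F (t • D) v w = 0) : v = 0 :=
  h.gaugeForm_nondegenerate (smul_skew hD t) (smul_vert hDv t) (exists_gaugeOp_eq hu) hv

/-- The vector `-Λₜ(q ∘ p)` is horizontal for the transformed connection, and its contraction with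
the transformed form is `q`. -/
theorem neg_gauge_horizontal (h : IsLinearCoupling p Λ Υ hor F)
    (hD : ∀ x y, D x y = -D y x) (hDv : ∀ x y, p x = 0 → p y = 0 → D x y = 0) {t : ℝ}
    (hu : IsUnit (gaugeOp Λ D t)) (q : B →L[ℝ] ℝ) :
    gaugeHor Υ hor (t • D) (p (-gauge Λ D t (q.comp p))) = -gauge Λ D t (q.comp p) ∧
      ∀ w, gaugeForm Υ hor F (t • D) (p (-gauge Λ D t (q.comp p))) w = q w := by
  obtain ⟨α, hα⟩ := exists_gaugeOp_eq hu (-(q.comp p))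
  have h1 : -gauge Λ D t (q.comp p) = Λ α := by
    rw [← map_neg, ← hα, gauge_gaugeOp_apply hu]
  rw [h1]
  exact h.gauge_horizontal (smul_skew hD t) (smul_vert hDv t) hα

end IsLinearCoupling

/-! ### The homotopy field -/

section HomotopyField

set_option linter.unusedSectionVars false

variable {EB : Type*} [NormedAddCommGroup EB] [NormedSpace ℝ EB] [FiniteDimensional ℝ EB]
  {B : Type*} [TopologicalSpace B] [ChartedSpace EB B] [IsManifold 𝓘(ℝ, EB) ∞ B] [T2Space B]
  {Fib : Type*} [NormedAddCommGroup Fib] [NormedSpace ℝ Fib] [FiniteDimensional ℝ Fib]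
  {V : B → Type*} [TopologicalSpace (TotalSpace Fib V)]
  [∀ b, AddCommGroup (V b)] [∀ b, Module ℝ (V b)] [∀ b, TopologicalSpace (V b)]
  [FiberBundle Fib V] [VectorBundle ℝ Fib V] [ContMDiffVectorBundle ∞ Fib V 𝓘(ℝ, EB)]
  (P : BivectorField (𝓘(ℝ, EB).prod 𝓘(ℝ, Fib)) (TotalSpace Fib V)) (Q : Form1 EB Fib V)

/-- The operator inverted by the gauge transformation of `P` by `t` times the differential of
`Q ∘ dπ`. -/
def gaugeOpAt (m : TotalSpace Fib V) (t : ℝ) : (EB × Fib →L[ℝ] ℝ) →L[ℝ] (EB × Fib →L[ℝ] ℝ) :=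
  gaugeOp (E := EB × Fib) (P.sharp m) (dForm Q m) t

/-- The gauge transform of `P` by `t` times the differential of `Q ∘ dπ`. -/
def gaugeAt (t : ℝ) (m : TotalSpace Fib V) : (EB × Fib →L[ℝ] ℝ) →L[ℝ] EB × Fib :=
  gauge (E := EB × Fib) (P.sharp m) (dForm Q m) t

/-- The points of `N` at which the gauge transformation is defined for all `t ∈ [0, 1]`. -/
def gaugeDomain (N : Set (TotalSpace Fib V)) : Set (TotalSpace Fib V) :=
  {m | m ∈ N ∧ ∀ t ∈ Icc (0 : ℝ) 1, IsUnit (gaugeOpAt P Q m t)}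

/-- The time-dependent vector field `Xₜ = -Πₜ♯(Q ∘ dπ)`, where `Πₜ` is the gauge transform. -/
def homotopyField (t : ℝ) (m : TotalSpace Fib V) : TE EB m :=
  -gaugeAt P Q t m ((Q m).comp (dproj EB m))

/-- The set on which the representation of `homotopyField` in the chart at `m₀` is smooth. -/
def chartDomain (N : Set (TotalSpace Fib V)) (m₀ : TotalSpace Fib V) : Set (ℝ × (EB × Fib)) :=
  {p | p.2 ∈ (extChartAt (𝓘(ℝ, EB).prod 𝓘(ℝ, Fib)) m₀).target ∩
      (extChartAt (𝓘(ℝ, EB).prod 𝓘(ℝ, Fib)) m₀).symm ⁻¹' N ∧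
    IsUnit (gaugeOp (chartSharp P m₀ p.2) (extD (chartForm Q m₀) p.2) p.1)}

variable {P Q} {N : Set (TotalSpace Fib V)}

theorem contDiffAt_chartSharp_chartForm (hN : IsOpen N) (hP : P.SmoothOn N) (hQ : Q.SmoothOn N)
    {m₀ : TotalSpace Fib V} {z : EB × Fib}
    (hz : z ∈ (extChartAt (𝓘(ℝ, EB).prod 𝓘(ℝ, Fib)) m₀).target ∩
      (extChartAt (𝓘(ℝ, EB).prod 𝓘(ℝ, Fib)) m₀).symm ⁻¹' N) :
    ContDiffAt ℝ ∞ (chartSharp P m₀) z ∧ ContDiffAt ℝ ∞ (chartForm Q m₀) z :=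
  ⟨(contDiffOn_chartSharp hN hP m₀).contDiffAt ((isOpen_chart_preimage hN m₀).mem_nhds hz),
    (contDiffOn_chartForm hQ m₀).contDiffAt ((isOpen_chart_preimage hN m₀).mem_nhds hz)⟩

theorem isOpen_chartDomain (hN : IsOpen N) (hP : P.SmoothOn N) (hQ : Q.SmoothOn N)
    (m₀ : TotalSpace Fib V) : IsOpen (chartDomain P Q N m₀) := by
  have h1 : IsOpen {p : ℝ × (EB × Fib) | p.2 ∈ (extChartAt (𝓘(ℝ, EB).prod 𝓘(ℝ, Fib)) m₀).target ∩
      (extChartAt (𝓘(ℝ, EB).prod 𝓘(ℝ, Fib)) m₀).symm ⁻¹' N} :=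
    (isOpen_chart_preimage hN m₀).preimage continuous_snd
  have h2 : ContinuousOn (fun p : ℝ × (EB × Fib) =>
      gaugeOp (chartSharp P m₀ p.2) (extD (chartForm Q m₀) p.2) p.1)
      {p : ℝ × (EB × Fib) | p.2 ∈ (extChartAt (𝓘(ℝ, EB).prod 𝓘(ℝ, Fib)) m₀).target ∩
      (extChartAt (𝓘(ℝ, EB).prod 𝓘(ℝ, Fib)) m₀).symm ⁻¹' N} := fun p hp => by
    obtain ⟨h3, h4⟩ := contDiffAt_chartSharp_chartForm hN hP hQ hp
    exact (contDiffAt_gaugeOp h3 h4).continuousAt.continuousWithinAt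
  exact h2.isOpen_inter_preimage h1 Units.isOpen

/-- The chart expressions of `P` and of `dForm Q` are conjugate to the pointwise ones by the
differential of the chart. -/
theorem chart_conj (hN : IsOpen N) (hQ : Q.SmoothOn N) {m₀ m : TotalSpace Fib V}
    (hm : m ∈ (extChartAt (𝓘(ℝ, EB).prod 𝓘(ℝ, Fib)) m₀).source) (hmN : m ∈ N) (t : ℝ) :
    (IsUnit (gaugeOp (chartSharp P m₀ (extChartAt (𝓘(ℝ, EB).prod 𝓘(ℝ, Fib)) m₀ m))
        (extD (chartForm Q m₀) (extChartAt (𝓘(ℝ, EB).prod 𝓘(ℝ, Fib)) m₀ m)) t) ↔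
      IsUnit (gaugeOpAt P Q m t)) ∧
    (IsUnit (gaugeOpAt P Q m t) → ∀ α : EB × Fib →L[ℝ] ℝ,
      gaugePath (chartSharp P m₀) (chartForm Q m₀)
          (t, extChartAt (𝓘(ℝ, EB).prod 𝓘(ℝ, Fib)) m₀ m) α =
        chartDeriv (𝓘(ℝ, EB).prod 𝓘(ℝ, Fib)) m₀ m
          (gaugeAt P Q t m (α.comp (chartDeriv (𝓘(ℝ, EB).prod 𝓘(ℝ, Fib)) m₀ m)))) := by
  have hiff := isUnit_gaugeOp_conj (E := EB × Fib)
    (a := chartDeriv (𝓘(ℝ, EB).prod 𝓘(ℝ, Fib)) m₀ m) (isInvertible_chartDeriv hm)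
    (chartSharp_apply P hm) (extD_chartForm_eq_dForm hN hQ hm hmN) t
  exact ⟨hiff, fun h α => gauge_conj (E := EB × Fib)
    (a := chartDeriv (𝓘(ℝ, EB).prod 𝓘(ℝ, Fib)) m₀ m)
    (chartSharp_apply P hm) (extD_chartForm_eq_dForm hN hQ hm hmN) (hiff.2 h) h α⟩

theorem mem_chartDomain (hN : IsOpen N) (hQ : Q.SmoothOn N) {m₀ m : TotalSpace Fib V}
    (hm : m ∈ (extChartAt (𝓘(ℝ, EB).prod 𝓘(ℝ, Fib)) m₀).source) (hmN : m ∈ N) {t : ℝ} :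
    (t, extChartAt (𝓘(ℝ, EB).prod 𝓘(ℝ, Fib)) m₀ m) ∈ chartDomain P Q N m₀ ↔
      IsUnit (gaugeOpAt P Q m t) := by
  have h1 : (extChartAt (𝓘(ℝ, EB).prod 𝓘(ℝ, Fib)) m₀).symm
      (extChartAt (𝓘(ℝ, EB).prod 𝓘(ℝ, Fib)) m₀ m) = m :=
    (extChartAt (𝓘(ℝ, EB).prod 𝓘(ℝ, Fib)) m₀).left_inv hm
  rw [← (chart_conj hN hQ hm hmN t).1]
  exact ⟨fun h => h.2, fun h => ⟨⟨(extChartAt (𝓘(ℝ, EB).prod 𝓘(ℝ, Fib)) m₀).map_source hm,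
    by rw [mem_preimage, h1]; exact hmN⟩, h⟩⟩

theorem isChartRep_homotopyField (hN : IsOpen N) (hP : P.SmoothOn N) (hQ : Q.SmoothOn N)
    (m₀ : TotalSpace Fib V) :
    IsChartRep (𝓘(ℝ, EB).prod 𝓘(ℝ, Fib)) (homotopyField P Q) (gaugeDomain P Q N) m₀
      (moserField (chartSharp P m₀) (chartForm Q m₀)) (chartDomain P Q N m₀) where
  isOpen := isOpen_chartDomain hN hP hQ m₀
  smooth p hp := by
    obtain ⟨h3, h4⟩ := contDiffAt_chartSharp_chartForm hN hP hQ hp.1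
    exact (contDiffAt_moserField h3 h4 hp.2).contDiffWithinAt
  mem t ht m hm hmW := (mem_chartDomain hN hQ hm hmW.1).2 (hmW.2 t ht)
  eq t ht m hm hmW := by
    have h1 := (chart_conj (P := P) hN hQ hm hmW.1 t).2 (hmW.2 t ht)
      (chartForm Q m₀ (extChartAt (𝓘(ℝ, EB).prod 𝓘(ℝ, Fib)) m₀ m))
    have h2 : (chartForm Q m₀ (extChartAt (𝓘(ℝ, EB).prod 𝓘(ℝ, Fib)) m₀ m)).comp
        (chartDeriv (𝓘(ℝ, EB).prod 𝓘(ℝ, Fib)) m₀ m) = (Q m).comp (dproj EB m) :=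
      ContinuousLinearMap.ext fun v => chartForm_chartDeriv Q hm v
    have h3 := h1.trans (congrArg (fun α => chartDeriv (𝓘(ℝ, EB).prod 𝓘(ℝ, Fib)) m₀ m
      (gaugeAt P Q t m α)) h2)
    rw [moserField]
    exact (map_neg (chartDeriv (𝓘(ℝ, EB).prod 𝓘(ℝ, Fib)) m₀ m) _).trans
      (congrArg Neg.neg h3.symm)

theorem isOpen_gaugeDomain (hN : IsOpen N) (hP : P.SmoothOn N) (hQ : Q.SmoothOn N) :
    IsOpen (gaugeDomain P Q N) := by
  rw [isOpen_iff_mem_nhds]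
  intro m hm
  set e := extChartAt (𝓘(ℝ, EB).prod 𝓘(ℝ, Fib)) m with he
  have hms : m ∈ e.source := mem_extChartAt_source m
  obtain ⟨u, v, -, hv, hu1, hv1, huv⟩ := generalized_tube_lemma isCompact_Icc
    (isCompact_singleton (x := e m)) (isOpen_chartDomain hN hP hQ m)
    (by
      rintro ⟨t, z⟩ ⟨ht, rfl : z = e m⟩
      exact (mem_chartDomain hN hQ hms hm.1).2 (hm.2 t ht))
  have h1 : e ⁻¹' v ∈ 𝓝 m := (continuousAt_extChartAt m).preimage_mem_nhds (hv.mem_nhds (hv1 rfl))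
  filter_upwards [h1, (isOpen_extChartAt_source m).mem_nhds hms, hN.mem_nhds hm.1]
    with y hy hys hyN
  exact ⟨hyN, fun t ht => (mem_chartDomain hN hQ hys hyN).1 (huv (mk_mem_prod (hu1 ht) hy))⟩

/-- Along the zero section the characteristic distribution of `P` is tangent to the zero section,
where `dForm Q` vanishes. -/
theorem zeroSec_subset_gaugeDomain {σ : ∀ b : B, TangentSpace 𝓘(ℝ, EB) b →L[ℝ]
    TangentSpace 𝓘(ℝ, EB) b →L[ℝ] ℝ} (hleaf : IsSymplecticLeaf P σ) (hN : IsOpen N)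
    (hBN : zeroSec Fib V ⊆ N) (hQ : Q.SmoothOn N) (hQ0 : Q.VanishesOnBase) :
    zeroSec Fib V ⊆ gaugeDomain P Q N := by
  rintro _ ⟨b, rfl⟩
  have hb : zeroSection Fib V b ∈ N := hBN (mem_range_self b)
  refine ⟨hb, fun t _ => isUnit_gaugeOp_of_range (E := EB × Fib) (P.skew _) (fun α β => ?_) t⟩
  have hr : ∀ α : TE EB (zeroSection Fib V b) →L[ℝ] ℝ, ∃ u,
      mfderiv 𝓘(ℝ, EB) (𝓘(ℝ, EB).prod 𝓘(ℝ, Fib)) (zeroSection Fib V) b u =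
        P.sharp (zeroSection Fib V b) α := by
    intro α
    have h1 := LinearMap.mem_range_self (P.sharp (zeroSection Fib V b)).toLinearMap α
    rw [hleaf.range_eq b] at h1
    exact h1
  obtain ⟨u, hu⟩ := hr α
  obtain ⟨v, hv⟩ := hr β
  have h2 := dForm_zeroSection hN hQ hQ0 hb u v
  rw [hu, hv] at h2
  exact h2

theorem homotopyField_zeroSec (hQ0 : Q.VanishesOnBase) (t : ℝ) {m : TotalSpace Fib V}
    (hm : m ∈ zeroSec Fib V) : homotopyField P Q t m = 0 := by
  have h1 : (Q m).comp (dproj EB m) = 0 := by rw [hQ0 m hm, ContinuousLinearMap.zero_comp]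
  have h2 : gaugeAt P Q t m ((Q m).comp (dproj EB m)) = 0 :=
    (congrArg (gaugeAt P Q t m) h1).trans (map_zero _)
  exact (congrArg Neg.neg h2).trans neg_zero

end HomotopyField

/-! ### Equivalence of the two Poisson tensors -/

section Equivalence

set_option linter.unusedSectionVars false

variable {EB : Type*} [NormedAddCommGroup EB] [NormedSpace ℝ EB] [FiniteDimensional ℝ EB]
  {B : Type*} [TopologicalSpace B] [ChartedSpace EB B] [IsManifold 𝓘(ℝ, EB) ∞ B] [T2Space B]
  {Fib : Type*} [NormedAddCommGroup Fib] [NormedSpace ℝ Fib] [FiniteDimensional ℝ Fib]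
  {V : B → Type*} [TopologicalSpace (TotalSpace Fib V)]
  [∀ b, AddCommGroup (V b)] [∀ b, Module ℝ (V b)] [∀ b, TopologicalSpace (V b)]
  [FiberBundle Fib V] [VectorBundle ℝ Fib V] [ContMDiffVectorBundle ∞ Fib V 𝓘(ℝ, EB)]
  {P P' Ups : BivectorField (𝓘(ℝ, EB).prod 𝓘(ℝ, Fib)) (TotalSpace Fib V)}
  {hor hor' : HorLift EB Fib V} {F F' : Form2 EB Fib V} {Q : Form1 EB Fib V}
  {N : Set (TotalSpace Fib V)}

theorem IsGeometricDataOn.mono {S : Set (TotalSpace Fib V)} (h : IsGeometricDataOn P Ups hor F S)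
    (hN : N ⊆ S) : IsGeometricDataOn P Ups hor F N where
  lift m hm := h.lift m (hN hm)
  horizontal m hm := h.horizontal m (hN hm)
  vertical m hm := h.vertical m (hN hm)
  form m hm := h.form m (hN hm)

theorem BivectorField.IsPoissonOn.mono {S : Set (TotalSpace Fib V)} (h : P.IsPoissonOn S)
    (hN : N ⊆ S) : P.IsPoissonOn N where
  smooth U hU hUN := h.smooth U hU (hUN.trans hN)
  jacobi U hU hUN := h.jacobi U hU (hUN.trans hN)

theorem RelatedOn.mono {S : Set (TotalSpace Fib V)} (h : RelatedOn Ups hor' hor Q S)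
    (hN : N ⊆ S) : RelatedOn Ups hor' hor Q N where
  smooth W hW u hu := (h.smooth W hW u hu).mono (inter_subset_inter_left _ hN)
  vanishes := h.vanishes
  hor_eq u hu m hm := h.hor_eq u hu m (hN hm)

/-- If `Q` is adapted, then `P'` is the gauge transform of `P` by the differential of `Q ∘ dπ`. -/
theorem gaugeAt_one_eq_sharp (hdata : IsGeometricDataOn P Ups hor F N)
    (hdata' : IsGeometricDataOn P' Ups hor' F' N) (hN : IsOpen N)
    (hQ : IsAdaptedOn Ups hor' hor F' F Q N) {m : TotalSpace Fib V} (hm : m ∈ gaugeDomain P Q N)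
    (α : EB × Fib →L[ℝ] ℝ) : gaugeAt P Q 1 m α = P'.sharp m α := by
  have hs := hQ.related.smooth
  refine (hdata.isLinearCoupling hm.1).gauge_one_eq (hdata'.isLinearCoupling hm.1) (dForm_skew Q m)
    (fun x y => dForm_vert hN hs hm.1 x y) (hm.2 1 (right_mem_Icc.2 zero_le_one))
    (fun x => ?_) (fun x y => ?_) α
  · obtain ⟨u, hu, e⟩ := exists_smoothVF_eq (I := 𝓘(ℝ, EB)) (m₀ := m.proj) x
    have h1 := hQ.related.hor_eq u hu m hm.1
    rw [ham_eval hdata hN hs hm.1 hu, e, ← sub_eq_add_neg] at h1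
    exact h1
  · obtain ⟨u₀, hu₀, e₀⟩ := exists_smoothVF_eq (I := 𝓘(ℝ, EB)) (m₀ := m.proj) x
    obtain ⟨u₁, hu₁, e₁⟩ := exists_smoothVF_eq (I := 𝓘(ℝ, EB)) (m₀ := m.proj) y
    have h1 := hQ.cocycle_eq_zero u₀ u₁ hu₀ hu₁ m hm.1
    rw [casimirCocycle, covDeriv_eq_dForm hN hs hm.1 (hdata.lift m hm.1) hu₀ hu₁,
      wedgeBracket_eq_dForm hdata hN hs hm.1 hu₀ hu₁, e₀, e₁] at h1
    have h2 : ∀ a b c d : ℝ, a - b + (c + (1 / 2 : ℝ) * (2 * d)) = 0 → a = b - (c + d) :=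
      fun a b c d h => by linarith
    exact h2 _ _ _ _ h1

/-- The homotopy field, with the data of the gauge transforms by `t` times the differential of
`Q ∘ dπ`. -/
theorem isHomotopyFieldOn_homotopyField (hdata : IsGeometricDataOn P Ups hor F N) (hN : IsOpen N)
    (hQ : Q.SmoothOn N) :
    IsHomotopyFieldOn Ups hor F Q
      (fun t m => gaugeHor (E := EB × Fib) (B := EB) (Ups.sharp m) (hor m) (t • dForm Q m))
      (fun t m => gaugeForm (E := EB × Fib) (B := EB) (Ups.sharp m) (hor m) (F m) (t • dForm Q m))
      (homotopyField P Q) (gaugeDomain P Q N) := by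
  have hv : ∀ m ∈ N, ∀ x y : TE EB m, dproj EB m x = 0 → dproj EB m y = 0 →
      dForm Q m x y = 0 := fun m hm x y => dForm_vert hN hQ hm x y
  constructor
  · intro t ht u hu m hm
    exact (IsLinearCoupling.gaugeHor_smul (E := EB × Fib) (B := EB) (Υ := Ups.sharp m)
      (hor := hor m) (D := dForm Q m) t (u m.proj)).trans
      (congrArg (fun w : TE EB m => hor m (u m.proj) + t • w) (ham_eval hdata hN hQ hm.1 hu).symm)
  · intro t ht u₀ u₁ hu₀ hu₁ m hm
    rw [covDeriv_eq_dForm hN hQ hm.1 (hdata.lift m hm.1) hu₀ hu₁,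
      wedgeBracket_eq_dForm hdata hN hQ hm.1 hu₀ hu₁]
    exact IsLinearCoupling.gaugeForm_smul (E := EB × Fib) (B := EB) (dForm_skew Q m) t _ _
  · intro t ht m hm v hv0
    exact (hdata.isLinearCoupling hm.1).gaugeForm_smul_nondegenerate (dForm_skew Q m) (hv m hm.1)
      (hm.2 t ht) hv0
  · intro t ht m hm
    exact ⟨_, ((hdata.isLinearCoupling hm.1).neg_gauge_horizontal (dForm_skew Q m) (hv m hm.1)
      (hm.2 t ht) (Q m)).1⟩
  · intro t ht m hm
    exact ((hdata.isLinearCoupling hm.1).neg_gauge_horizontal (dForm_skew Q m) (hv m hm.1)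
      (hm.2 t ht) (Q m)).2

/-- For adapted `Q`, the time-one flow of the homotopy field carries `P` to `P'`. -/
theorem exists_flow_pullsBack [Nonempty B]
    {σ : ∀ b : B, TangentSpace 𝓘(ℝ, EB) b →L[ℝ] TangentSpace 𝓘(ℝ, EB) b →L[ℝ] ℝ}
    (hleaf : IsSymplecticLeaf P σ) (hN : IsOpen N) (hBN : zeroSec Fib V ⊆ N)
    (hP : P.IsPoissonOn N) (hdata : IsGeometricDataOn P Ups hor F N)
    (hdata' : IsGeometricDataOn P' Ups hor' F' N) (hQ : IsAdaptedOn Ups hor' hor F' F Q N) :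
    ∃ φ : OpenPartialHomeomorph (TotalSpace Fib V) (TotalSpace Fib V),
      IsTimeOneFlow (homotopyField P Q) (gaugeDomain P Q N) φ ∧
        PullsBackOn φ P' P φ.source := by
  have hs := hQ.related.smooth
  have hQ0 := hQ.related.vanishes
  have hrep := isChartRep_homotopyField hN hP.smooth hs
  have hWo : IsOpen (gaugeDomain P Q N) := isOpen_gaugeDomain hN hP.smooth hs
  have hBW := zeroSec_subset_gaugeDomain hleaf hN hBN hs hQ0
  have hX0 : ∀ t ∈ Icc (0 : ℝ) 1, ∀ m ∈ zeroSec Fib V, homotopyField P Q t m = 0 :=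
    fun t _ m hm => homotopyField_zeroSec hQ0 t hm
  have : T2Space (TotalSpace Fib V) := t2Space_totalSpace
  have : Nonempty (TotalSpace Fib V) :=
    ⟨zeroSection Fib V (Classical.arbitrary B)⟩
  have h01 : (0 : ℝ) ∈ Icc (0 : ℝ) 1 := left_mem_Icc.2 zero_le_one
  have h11 : (1 : ℝ) ∈ Icc (0 : ℝ) 1 := right_mem_Icc.2 zero_le_one
  obtain ⟨φ, Φ, hS1, hS2, hφ, hφs, hΦ0, hΦ1, hsol, htraj⟩ :=
    exists_flow_near_zeros hrep hWo hBW hX0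
  have hφW : ∀ m ∈ φ.source, m ∈ gaugeDomain P Q N ∧ φ m ∈ gaugeDomain P Q N := fun m hm =>
    ⟨by have h := (hsol m hm 0 h01).1; simpa only [hΦ0 m hm] using h,
      by have h := (hsol m hm 1 h11).1; simpa only [hΦ1 m hm] using h⟩
  refine ⟨φ, ⟨hWo, hBW, smoothTimeVFOn_of_isChartRep hrep, hX0, ⟨hS1, hS2, hφ, hφs⟩,
    Φ, hΦ0, hΦ1, hsol⟩, ?_⟩
  intro m hm α
  obtain ⟨m₀, hms, γ, A, hγ0, hφms, hγ1, hγ, hA0, hA, hL, hd⟩ := htraj m hm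
  have hγN : ∀ t ∈ Icc (0 : ℝ) 1, γ t ∈ (extChartAt (𝓘(ℝ, EB).prod 𝓘(ℝ, Fib)) m₀).target ∩
      (extChartAt (𝓘(ℝ, EB).prod 𝓘(ℝ, Fib)) m₀).symm ⁻¹' N :=
    fun t ht => ⟨(hγ t ht).1, (hγ t ht).2.1.1⟩
  have hγu : ∀ t ∈ Icc (0 : ℝ) 1, IsUnit (gaugeOp (chartSharp P m₀ (γ t))
      (extD (chartForm Q m₀) (γ t)) t) := by
    intro t ht
    have h1 := (mem_chartDomain (P := P) hN hs
      ((extChartAt (𝓘(ℝ, EB).prod 𝓘(ℝ, Fib)) m₀).map_target (hγ t ht).1)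
      (hγ t ht).2.1.1).2 ((hγ t ht).2.1.2 t ht)
    rw [(extChartAt (𝓘(ℝ, EB).prod 𝓘(ℝ, Fib)) m₀).right_inv (hγ t ht).1] at h1
    exact h1.2
  have key := gaugePath_eq_pushforward (Λ := chartSharp P m₀) (θ := chartForm Q m₀)
    (fun t ht => (contDiffAt_chartSharp_chartForm hN hP.smooth hs (hγN t ht)).1)
    (fun t ht => Eventually.of_forall fun z => chartSharp_skew P m₀ z)
    (fun t ht => chartSharp_jacobi hN hP (hγN t ht).1 (hγN t ht).2)
    (fun t ht => (contDiffAt_chartSharp_chartForm hN hP.smooth hs (hγN t ht)).2)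
    hγu (fun t ht => (hγ t ht).2.2) hA0 hA hL
  -- transport the identity `key` in the chart at `m₀` back to the tangent spaces at `m` and `φ m`
  set a : TE EB m →L[ℝ] EB × Fib := chartDeriv (𝓘(ℝ, EB).prod 𝓘(ℝ, Fib)) m₀ m with ha
  set a' : TE EB (φ m) →L[ℝ] EB × Fib :=
    chartDeriv (𝓘(ℝ, EB).prod 𝓘(ℝ, Fib)) m₀ (φ m) with ha'
  obtain ⟨e', he'⟩ : a'.IsInvertible := isInvertible_chartDeriv hφms
  have hinj : Function.Injective a' := by
    rw [← he']
    exact e'.injective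
  obtain ⟨β, hβ⟩ : ∃ β : EB × Fib →L[ℝ] ℝ, β.comp a' = α :=
    ⟨α.comp (e'.symm : EB × Fib →L[ℝ] TE EB (φ m)), by
      ext v
      rw [← he']
      simp⟩
  apply hinj
  have h2 : (α.comp (mfderiv (𝓘(ℝ, EB).prod 𝓘(ℝ, Fib)) (𝓘(ℝ, EB).prod 𝓘(ℝ, Fib)) φ m)) =
      (β.comp (A 1)).comp a := by
    ext v
    rw [← hβ]
    exact congrArg β (hd v)
  have h3 : A 1 (a (P.sharp m ((β.comp (A 1)).comp a))) = gaugePath (chartSharp P m₀)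
      (chartForm Q m₀) (1, γ 1) β := by
    rw [← key, hγ0]
    change _ =
      A 1 (chartSharp P m₀ (extChartAt (𝓘(ℝ, EB).prod 𝓘(ℝ, Fib)) m₀ m) (transpose (A 1) β))
    rw [chartSharp_apply P hms]
    rfl
  have h4 := (chart_conj (P := P) hN hs hφms (hφW m hm).2.1 1).2 ((hφW m hm).2.2 1 h11) β
  rw [← hγ1] at h4
  have h5 : gaugeAt P Q 1 (φ m) (β.comp a') = P'.sharp (φ m) α :=
    (gaugeAt_one_eq_sharp hdata hdata' hN hQ (hφW m hm).2 _).trans (congrArg (P'.sharp (φ m)) hβ)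
  refine (hd _).trans ?_
  refine (congrArg (fun ξ => A 1 (a (P.sharp m ξ))) h2).trans ?_
  exact h3.trans (h4.trans (congrArg a' h5))

/-- Subtracting a primitive of the Casimir cocycle makes `Q` adapted. -/
theorem isAdaptedOn_sub {K : Form1 EB Fib V} (hN : IsOpen N) (hQ : RelatedOn Ups hor' hor Q N)
    (hK : IsCasimirForm1On Ups K N)
    (hC : ∀ u₀ u₁ : ∀ b : B, TangentSpace 𝓘(ℝ, EB) b,
      SmoothVFOn 𝓘(ℝ, EB) u₀ univ → SmoothVFOn 𝓘(ℝ, EB) u₁ univ →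
      ∀ m ∈ N, casimirCocycle Ups hor F' F Q u₀ u₁ m = covDeriv hor K u₀ u₁ m) :
    IsAdaptedOn Ups hor' hor F' F (fun m => Q m - K m) N := by
  have heval : ∀ u : ∀ b : B, TangentSpace 𝓘(ℝ, EB) b,
      Form1.eval (fun m => Q m - K m) u = Q.eval u - K.eval u := fun u => rfl
  have hmd : ∀ R : Form1 EB Fib V, R.SmoothOn N → ∀ u : ∀ b : B, TangentSpace 𝓘(ℝ, EB) b,
      SmoothVFOn 𝓘(ℝ, EB) u univ → ∀ m ∈ N,
      MDifferentiableAt (𝓘(ℝ, EB).prod 𝓘(ℝ, Fib)) 𝓘(ℝ, ℝ) (R.eval u) m := by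
    intro R hR u hu m hm
    exact ((hR univ isOpen_univ u hu).contMDiffAt (by
      simpa using hN.mem_nhds hm)).mdifferentiableAt (by simp)
  have hd : ∀ u : ∀ b : B, TangentSpace 𝓘(ℝ, EB) b, SmoothVFOn 𝓘(ℝ, EB) u univ → ∀ m ∈ N,
      mvfderiv (𝓘(ℝ, EB).prod 𝓘(ℝ, Fib)) (Form1.eval (fun m => Q m - K m) u) m =
        mvfderiv (𝓘(ℝ, EB).prod 𝓘(ℝ, Fib)) (Q.eval u) m -
          mvfderiv (𝓘(ℝ, EB).prod 𝓘(ℝ, Fib)) (K.eval u) m := by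
    intro u hu m hm
    rw [heval]
    exact mvfderiv_sub (hmd Q hQ.smooth u hu m hm) (hmd K hK.smooth u hu m hm)
  -- `K` has no Hamiltonian fields, so that it drops out of all terms but the covariant derivative
  have hham : ∀ u : ∀ b : B, TangentSpace 𝓘(ℝ, EB) b, SmoothVFOn 𝓘(ℝ, EB) u univ → ∀ m ∈ N,
      Ups.ham (Form1.eval (fun m => Q m - K m) u) m = Ups.ham (Q.eval u) m := by
    intro u hu m hm
    have h1 : Ups.ham (K.eval u) m = 0 := hK.casimir u hu m hm
    have h2 : Ups.ham (Form1.eval (fun m => Q m - K m) u) m =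
        Ups.ham (Q.eval u) m - Ups.ham (K.eval u) m := by
      unfold BivectorField.ham
      rw [hd u hu m hm, map_sub]
    rw [h2, h1, sub_zero]
  have hbr : ∀ u₀ u₁ : ∀ b : B, TangentSpace 𝓘(ℝ, EB) b,
      SmoothVFOn 𝓘(ℝ, EB) u₀ univ → SmoothVFOn 𝓘(ℝ, EB) u₁ univ → ∀ m ∈ N,
      Ups.bracket (Form1.eval (fun m => Q m - K m) u₀) (Form1.eval (fun m => Q m - K m) u₁) m =
        Ups.bracket (Q.eval u₀) (Q.eval u₁) m := by
    intro u₀ u₁ hu₀ hu₁ m hm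
    have hB : ∀ f g : TotalSpace Fib V → ℝ, Ups.bracket f g m =
        mvfderiv (𝓘(ℝ, EB).prod 𝓘(ℝ, Fib)) g m (Ups.ham f m) := fun f g => rfl
    have hB' : ∀ f g : TotalSpace Fib V → ℝ, Ups.bracket f g m = -Ups.bracket g f m :=
      fun f g => Ups.skew m _ _
    rw [hB, hham u₀ hu₀ m hm, ← hB, hB', hB, hham u₁ hu₁ m hm, ← hB, ← hB']
  constructor
  · constructor
    · intro W hW u hu
      exact (hQ.smooth W hW u hu).sub (hK.smooth W hW u hu)
    · intro m hm
      change Q m - K m = 0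
      rw [hQ.vanishes m hm, hK.vanishes m hm, sub_zero]
    · intro u hu m hm
      rw [hham u hu m hm]
      exact hQ.hor_eq u hu m hm
  · intro u₀ u₁ hu₀ hu₁ m hm
    have h1 := hC u₀ u₁ hu₀ hu₁ m hm
    have h2 : covDeriv hor (fun m => Q m - K m) u₀ u₁ m =
        covDeriv hor Q u₀ u₁ m - covDeriv hor K u₀ u₁ m := by
      have h3 : ∀ x y z x' y' z' : ℝ, x - x' - (y - y') - (z - z') = x - y - z - (x' - y' - z') :=
        fun x y z x' y' z' => by ring
      unfold covDeriv
      rw [hd u₀ hu₀ m hm, hd u₁ hu₁ m hm]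
      exact h3 _ _ _ _ _ _
    have h4 : wedgeBracket Ups (fun m => Q m - K m) (fun m => Q m - K m) u₀ u₁ m =
        wedgeBracket Ups Q Q u₀ u₁ m := by
      unfold wedgeBracket
      rw [hbr u₀ u₁ hu₀ hu₁ m hm, hbr u₁ u₀ hu₁ hu₀ m hm]
    unfold casimirCocycle at h1 ⊢
    rw [h2, h4]
    linarith

end Equivalence

end

end CouplingPoisson

theorem theorem3p4
    {EB : Type*} [NormedAddCommGroup EB] [NormedSpace ℝ EB] [FiniteDimensional ℝ EB]
    {B : Type*} [TopologicalSpace B] [ChartedSpace EB B] [IsManifold 𝓘(ℝ, EB) ∞ B]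
    [T2Space B] [SecondCountableTopology B] [ConnectedSpace B]
    {Fib : Type*} [NormedAddCommGroup Fib] [NormedSpace ℝ Fib] [FiniteDimensional ℝ Fib]
    {V : B → Type*} [TopologicalSpace (TotalSpace Fib V)]
    [∀ b, AddCommGroup (V b)] [∀ b, Module ℝ (V b)] [∀ b, TopologicalSpace (V b)]
    [FiberBundle Fib V] [VectorBundle ℝ Fib V] [ContMDiffVectorBundle ∞ Fib V 𝓘(ℝ, EB)]
    -- the symplectic base
    (σ : ∀ b : B, TangentSpace 𝓘(ℝ, EB) b →L[ℝ] TangentSpace 𝓘(ℝ, EB) b →L[ℝ] ℝ)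
    (hσ : CouplingPoisson.IsSymplecticForm 𝓘(ℝ, EB) σ)
    -- a neighbourhood `N` of the zero section on which representatives of all germs are defined
    (N : Set (TotalSpace Fib V)) (hN : IsOpen N) (hBN : CouplingPoisson.zeroSec Fib V ⊆ N)
    -- the coupling Poisson tensors `P = Π`, `P' = Π̃` with common vertical part `Υ`
    (P P' Ups : CouplingPoisson.BivectorField (𝓘(ℝ, EB).prod 𝓘(ℝ, Fib)) (TotalSpace Fib V))
    (hor hor' : CouplingPoisson.HorLift EB Fib V) (F F' : CouplingPoisson.Form2 EB Fib V)
    (hP : CouplingPoisson.IsCouplingOn P N) (hP' : CouplingPoisson.IsCouplingOn P' N)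
    (hdata : CouplingPoisson.IsGeometricDataOn P Ups hor F N)
    (hdata' : CouplingPoisson.IsGeometricDataOn P' Ups hor' F' N)
    (hleaf : CouplingPoisson.IsSymplecticLeaf P σ)
    (hleaf' : CouplingPoisson.IsSymplecticLeaf P' σ)
    -- `Π̃ ∼_Q Π` and `[C] = 0`
    (Q : CouplingPoisson.Form1 EB Fib V)
    (hQ : CouplingPoisson.RelatedOn Ups hor' hor Q N)
    (hC : CouplingPoisson.CasimirClassZero Ups hor F' F Q N) :
    -- `Π` and `Π̃` are isomorphic by some `φ` in `𝔇𝔦𝔣𝔣⁰_B(E)`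
    (∃ φ : OpenPartialHomeomorph (TotalSpace Fib V) (TotalSpace Fib V),
      CouplingPoisson.IsDiffB0 EB φ ∧ φ.source ⊆ N ∧ MapsTo φ φ.source N ∧
        CouplingPoisson.PullsBackOn φ P' P φ.source) ∧
    -- `Q` can be chosen, near the zero section, with zero cocycle
    (∃ (N₁ : Set (TotalSpace Fib V)) (Q₁ : CouplingPoisson.Form1 EB Fib V),
      IsOpen N₁ ∧ CouplingPoisson.zeroSec Fib V ⊆ N₁ ∧ N₁ ⊆ N ∧
        CouplingPoisson.IsAdaptedOn Ups hor' hor F' F Q₁ N₁) ∧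
    -- and for every such choice `φ` can be taken as the time-one flow of the horizontal field `Xₜ`
    -- with `i_{Xₜ} Fₜ = Q₁`
    (∀ (N₁ : Set (TotalSpace Fib V)) (Q₁ : CouplingPoisson.Form1 EB Fib V),
      IsOpen N₁ → CouplingPoisson.zeroSec Fib V ⊆ N₁ → N₁ ⊆ N →
      CouplingPoisson.IsAdaptedOn Ups hor' hor F' F Q₁ N₁ →
      ∃ (W : Set (TotalSpace Fib V)) (hort : ℝ → CouplingPoisson.HorLift EB Fib V)
        (Ft : ℝ → CouplingPoisson.Form2 EB Fib V)
        (X : ℝ → ∀ m : TotalSpace Fib V, CouplingPoisson.TE EB m)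
        (φ : OpenPartialHomeomorph (TotalSpace Fib V) (TotalSpace Fib V)),
        W ⊆ N₁ ∧ CouplingPoisson.IsHomotopyFieldOn Ups hor F Q₁ hort Ft X W ∧
        CouplingPoisson.IsTimeOneFlow X W φ ∧
        CouplingPoisson.PullsBackOn φ P' P φ.source) := by
  have part3 : ∀ (N₁ : Set (TotalSpace Fib V)) (Q₁ : CouplingPoisson.Form1 EB Fib V),
      IsOpen N₁ → CouplingPoisson.zeroSec Fib V ⊆ N₁ → N₁ ⊆ N →
      CouplingPoisson.IsAdaptedOn Ups hor' hor F' F Q₁ N₁ →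
      ∃ (W : Set (TotalSpace Fib V)) (hort : ℝ → CouplingPoisson.HorLift EB Fib V)
        (Ft : ℝ → CouplingPoisson.Form2 EB Fib V)
        (X : ℝ → ∀ m : TotalSpace Fib V, CouplingPoisson.TE EB m)
        (φ : OpenPartialHomeomorph (TotalSpace Fib V) (TotalSpace Fib V)),
        W ⊆ N₁ ∧ CouplingPoisson.IsHomotopyFieldOn Ups hor F Q₁ hort Ft X W ∧
        CouplingPoisson.IsTimeOneFlow X W φ ∧
        CouplingPoisson.PullsBackOn φ P' P φ.source := by
    intro N₁ Q₁ hN₁ hBN₁ hN₁N hQ₁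
    have hdata₁ := hdata.mono hN₁N
    obtain ⟨φ, hφ, hpull⟩ := CouplingPoisson.exists_flow_pullsBack hleaf hN₁ hBN₁
      (hP.poisson.mono hN₁N) hdata₁ (hdata'.mono hN₁N) hQ₁
    exact ⟨_, _, _, _, φ, fun m hm => hm.1,
      CouplingPoisson.isHomotopyFieldOn_homotopyField hdata₁ hN₁ hQ₁.related.smooth, hφ, hpull⟩
  obtain ⟨N', K, hN', hBN', hN'N, hK, hCK⟩ := hC
  have hadapt : CouplingPoisson.IsAdaptedOn Ups hor' hor F' F (fun m => Q m - K m) N' :=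
    CouplingPoisson.isAdaptedOn_sub hN' (hQ.mono hN'N) hK hCK
  refine ⟨?_, ⟨N', _, hN', hBN', hN'N, hadapt⟩, part3⟩
  obtain ⟨W, -, -, X, φ, hWN, -, hφ, hpull⟩ := part3 N' _ hN' hBN' hN'N hadapt
  obtain ⟨Φ, hΦ0, hΦ1, hΦ⟩ := hφ.flow
  refine ⟨φ, ⟨X, W, hφ⟩, fun m hm => ?_, fun m hm => ?_, hpull⟩
  · rw [← hΦ0 m hm]
    exact hN'N (hWN (hΦ m hm 0 (left_mem_Icc.2 zero_le_one)).1)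
  · rw [← hΦ1 m hm]
    exact hN'N (hWN (hΦ m hm 1 (right_mem_Icc.2 zero_le_one)).1)
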